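/- Let $k=k_0\oplus k_1$ be a commutative superring: an associative unital $\mathbb Z/2\mathbb Z$-graded ring with $\alpha\beta=(-1)^{p(\alpha)p(\beta)}\beta\alpha$ for homogeneous $\alpha,\beta$ (where $p$ is the parity) and $\alpha^2=0$ for $\alpha\in k_1$. Modules over $k$ are $\mathbb Z/2\mathbb Z$-graded right modules, with $\alpha m:=(-1)^{p(\alpha)p(m)}m\alpha$; here and below, expressions with signs are extended by linearity from homogeneous elements. A Lie $k$-superalgebra is a $k$-module $\mathfrak g$ with a biadditive bracket such that $p([X,Y])=p(X)+p(Y)$, $[X,Y]\alpha=[X,Y\alpha]=(-1)^{p(Y)p(\alpha)}[X\alpha,Y]$, $[X,Y]=-(-1)^{p(X)p(Y)}[Y,X]$, $[[X,Y],Z]=[X,[Y,Z]]-(-1)^{p(X)p(Y)}[Y,[X,Z]]$, $[X,X]=0$ for even $X$, and $[Y,[Y,Y]]=0$ for odd $Y$. Let $S(\mathfrak g)$ be the symmetric algebra of $\mathfrak g$, the quotient of the tensor algebra by the relations $v\otimes w=(-1)^{p(v)p(w)}w\otimes v$ and $u\otimes u=0$ for odd $u$, with the comultiplication $\Delta$ which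 is the morphism of superalgebras with $\Delta(X)=X\otimes1+1\otimes X$ for $X\in\mathfrak g$. On morphisms of $k$-modules $F,G$ put $(F\otimes G)(v\otimes w)=(-1)^{p(G)p(v)}F(v)\otimes G(w)$. Let $F*G=\mathrm{mult}\circ(F\otimes G)\circ\Delta$ for $F,G\in\mathrm{Hom}(S(\mathfrak g),S(\mathfrak g))$, and $[F,G]=[\cdot,\cdot]\circ(F\otimes G)\circ\Delta$ for $F,G\in\mathfrak g_x:=\mathrm{Hom}(S(\mathfrak g),\mathfrak g)$. View $a\in\mathfrak g$ as the element of $\mathfrak g_x$ with $1\mapsto a$ and $S^n(\mathfrak g)\mapsto0$ for $n\ne0$, and let $x\in\mathfrak g_x$ be the identity on $S^1(\mathfrak g)=\mathfrak g$ and $0$ on $S^n(\mathfrak g)$ for $n\neq1$. For $\varphi=\sum_n c_nt^n\in k[[t]]$ and $a\in\mathfrak g$, let $\varphi^a=\varphi(\mathrm{ad}\,x)(a)\in\mathfrak g_x$ be the morphism whose restriction to $S^n(\mathfrak g)$ is $c_n(\mathrm{ad}\,x)^n(a)$ for every $n\ge0$, and let $\Phi^a=\mathrm{id}*\varphi^a:S(\mathfrak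 g)\to S(\mathfrak g)$. Write $\Psi^a,\Lambda^a$ for the maps attached in the same way to $\psi,\lambda\in k[[t]]$. On $\mathrm{Hom}(S(\mathfrak g),S(\mathfrak g))$ put $[F,G]=F\circ G-(-1)^{p(F)p(G)}G\circ F$. **Theorem.** 1. Let $\varphi,\psi,\lambda\in k_0[[t]]$. The identity $[\Phi^a,\Psi^b]=\Lambda^{[a,b]}$ holds for all $a,b\in\mathfrak g$ in every Lie $k$-superalgebra $\mathfrak g$ if and only if $$-\frac{\varphi(t+u)-\varphi(t)}{u}\,\psi(u)-\varphi(t)\,\frac{\psi(t+u)-\psi(u)}{t}=\lambda(t+u)\quad\text{in }k_0[[t,u]].$$ 2. Let $\varphi\in k[[t]]$. The identity $[\Phi^a,\Phi^b]=\Phi^{[a,b]}$ holds for all $a,b\in\mathfrak g$ in every Lie $k$-superalgebra $\mathfrak g$ if and only if $\varphi$ has even coefficients and $$-\frac{\varphi(t+u)-\varphi(t)}{u}\,\varphi(u)-\varphi(t)\,\frac{\varphi(t+u)-\varphi(u)}{t}=\varphi(t+u)\quad\text{in }k_0[[t,u]].$$ 3. Let $\varphi\in k[[t]]$. The map $a\mapsto\Phi^a$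 is, for every Lie $k$-superalgebra $\mathfrak g$, a representation of $\mathfrak g$ on $S(\mathfrak g)$ by coderivations (that is, an even morphism of $k$-modules $\mathfrak g\to\mathrm{Hom}(S(\mathfrak g),S(\mathfrak g))$ which is compatible with the brackets and whose values $F$ satisfy $\Delta\circ F=(F\otimes\mathrm{id}+\mathrm{id}\otimes F)\circ\Delta$) if and only if $\varphi$ has even coefficients and satisfies the equation of part 2. -/

import Mathlib

set_option linter.unusedSectionVars false
set_option linter.unusedSimpArgs false

universe u v

namespace SuperSym

open scoped RightActions TensorProduct DirectSum

/-- The sign `(-1) ^ (i j)` for parities `i, j ∈ ℤ/2ℤ`. -/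
def sgn (i j : ZMod 2) : ℤ := (-1) ^ (i.val * j.val)

/-- A `ℤ/2ℤ`-grading of an abelian group `M`: `part 0` are the even, `part 1` the odd elements. -/
class SuperGroup (M : Type*) [AddCommGroup M] where
  part : ZMod 2 → AddSubgroup M
  [dec : DirectSum.Decomposition part]

attribute [instance, reducible] SuperGroup.dec

/-- The homogeneous component of parity `i`. -/
def proj {M : Type*} [AddCommGroup M] [SuperGroup M] (i : ZMod 2) : M →+ M where
  toFun m := (DirectSum.decompose SuperGroup.part m i : M)
  map_zero' := by simp
  map_add' m n := by simp

section Grading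

variable {M : Type*} [AddCommGroup M] [SuperGroup M]

theorem proj_of_mem {i : ZMod 2} {m : M} (h : m ∈ SuperGroup.part i) : proj i m = m :=
  DirectSum.decompose_of_mem_same _ h

theorem proj_of_mem_ne {i j : ZMod 2} {m : M} (h : m ∈ SuperGroup.part i) (hij : i ≠ j) :
    proj j m = 0 :=
  DirectSum.decompose_of_mem_ne _ h hij

theorem proj_mem (i : ZMod 2) (m : M) : proj i m ∈ SuperGroup.part i :=
  SetLike.coe_mem (DirectSum.decompose SuperGroup.part m i)

theorem sum_proj (m : M) : ∑ i, proj i m = m := by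
  classical
  conv_rhs => rw [← DirectSum.sum_support_decompose SuperGroup.part m]
  symm
  apply Finset.sum_subset (Finset.subset_univ _)
  intro i _ hi
  simpa using hi

theorem homog_induction {P : M → Prop} (hadd : ∀ m n, P m → P n → P (m + n))
    (hom : ∀ i, ∀ m ∈ SuperGroup.part i, P m) (m : M) : P m := by
  rw [← sum_proj m, show (Finset.univ : Finset (ZMod 2)) = {0, 1} from rfl,
    Finset.sum_pair (by decide)]
  exact hadd _ _ (hom 0 _ (proj_mem 0 m)) (hom 1 _ (proj_mem 1 m))

theorem addHom_ext_homog {N : Type*} [AddCommGroup N] {f g : M →+ N}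
    (h : ∀ i, ∀ m ∈ SuperGroup.part i, f m = g m) : f = g := by
  ext m
  induction m using homog_induction with
  | hadd m n hm hn => simp [hm, hn]
  | hom i m hm => exact h i m hm

end Grading

/-- A grading from its subgroups and the family of its projections. -/
abbrev SuperGroup.ofProj {M : Type*} [AddCommGroup M] (P : ZMod 2 → AddSubgroup M)
    (p : ZMod 2 → M →+ M) (hmem : ∀ i m, p i m ∈ P i) (heq : ∀ i, ∀ m ∈ P i, p i m = m)
    (hne : ∀ i j, i ≠ j → ∀ m ∈ P i, p j m = 0) (hsum : ∀ m, ∑ i, p i m = m) : SuperGroup M where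
  part := P
  dec := DirectSum.Decomposition.ofAddHom P
    (∑ i : ZMod 2, (DirectSum.of (fun j => ↥(P j)) i).comp ((p i).codRestrict (P i) (hmem i)))
    (by
      ext m
      simp only [AddMonoidHom.comp_apply, AddMonoidHom.finsetSum_apply, map_sum,
        DirectSum.coeAddMonoidHom_of, AddMonoidHom.id_apply]
      exact hsum m)
    (by
      ext i m : 2
      simp only [AddMonoidHom.comp_apply, AddMonoidHom.finsetSum_apply,
        DirectSum.coeAddMonoidHom_of, AddMonoidHom.id_apply]
      rw [Finset.sum_eq_single i]
      · congr 1
        exact Subtype.ext (heq i m m.2)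
      · intro j _ hj
        rw [show ((p j).codRestrict (P j) (hmem j)) (m : M) = 0 from
          Subtype.ext (hne i j hj.symm m m.2), map_zero]
      · simp)

/-- A biadditive expression `f a b` with the sign `(-1) ^ (p(a) p(b))` in front, extended from
homogeneous `a, b` by linearity. -/
def signed {A B C : Type*} [AddCommGroup A] [SuperGroup A] [AddCommGroup B] [SuperGroup B]
    [AddCommGroup C] (f : A →+ B →+ C) : A →+ B →+ C :=
  ∑ i, ∑ j, sgn i j • ((f.comp (proj i)).flip.comp (proj j)).flip

theorem signed_apply {A B C : Type*} [AddCommGroup A] [SuperGroup A] [AddCommGroup B]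
    [SuperGroup B] [AddCommGroup C] (f : A →+ B →+ C) (a : A) (b : B) :
    signed f a b = ∑ i, ∑ j, sgn i j • f (proj i a) (proj j b) := by
  simp [signed, AddMonoidHom.finsetSum_apply]

theorem signed_homog {A B C : Type*} [AddCommGroup A] [SuperGroup A] [AddCommGroup B]
    [SuperGroup B] [AddCommGroup C] (f : A →+ B →+ C) {i j : ZMod 2} {a : A} {b : B}
    (ha : a ∈ SuperGroup.part i) (hb : b ∈ SuperGroup.part j) :
    signed f a b = sgn i j • f a b := by
  rw [signed_apply, Finset.sum_eq_single i, Finset.sum_eq_single j, proj_of_mem ha, proj_of_mem hb]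
  · intro l _ hl
    rw [proj_of_mem_ne hb hl.symm]; simp
  · simp
  · intro l _ hl
    rw [proj_of_mem_ne ha hl.symm]; simp
  · simp

/-- Commutative superrings. -/
class CommSuperRing (k : Type*) [Ring k] [SuperGroup k] : Prop where
  one_mem : (1 : k) ∈ SuperGroup.part 0
  mul_mem : ∀ {i j : ZMod 2} {a b : k},
    a ∈ SuperGroup.part i → b ∈ SuperGroup.part j → a * b ∈ SuperGroup.part (i + j)
  mul_comm : ∀ {i j : ZMod 2} {a b : k},
    a ∈ SuperGroup.part i → b ∈ SuperGroup.part j → a * b = sgn i j • (b * a)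
  mul_self : ∀ {a : k}, a ∈ SuperGroup.part 1 → a * a = 0

/-- Graded (right) modules over a superring `k`; the action `m α` is written `m <• α`. -/
class SuperModule (k M : Type*) [Ring k] [SuperGroup k] [AddCommGroup M] [Module kᵐᵒᵖ M]
    [SuperGroup M] : Prop where
  smul_mem : ∀ {i j : ZMod 2} {m : M} {α : k},
    m ∈ SuperGroup.part i → α ∈ SuperGroup.part j → m <• α ∈ SuperGroup.part (i + j)

/-- Lie superalgebras over a commutative superring `k`. -/
class LieSuperalgebra (k g : Type*) [Ring k] [SuperGroup k] [AddCommGroup g] [Module kᵐᵒᵖ g]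
    [SuperGroup g] [Bracket g g] : Prop extends SuperModule k g where
  add_lie : ∀ a b c : g, ⁅a + b, c⁆ = ⁅a, c⁆ + ⁅b, c⁆
  lie_add : ∀ a b c : g, ⁅a, b + c⁆ = ⁅a, b⁆ + ⁅a, c⁆
  lie_mem : ∀ {i j : ZMod 2} {a b : g},
    a ∈ SuperGroup.part i → b ∈ SuperGroup.part j → ⁅a, b⁆ ∈ SuperGroup.part (i + j)
  lie_smul : ∀ (a b : g) (α : k), ⁅a, b⁆ <• α = ⁅a, b <• α⁆
  smul_lie : ∀ {i j : ZMod 2} (a : g) {b : g} {α : k},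
    b ∈ SuperGroup.part i → α ∈ SuperGroup.part j → ⁅a, b⁆ <• α = sgn i j • ⁅a <• α, b⁆
  skew : ∀ {i j : ZMod 2} {a b : g},
    a ∈ SuperGroup.part i → b ∈ SuperGroup.part j → ⁅a, b⁆ = -(sgn i j • ⁅b, a⁆)
  lie_self : ∀ {a : g}, a ∈ SuperGroup.part 0 → ⁅a, a⁆ = 0
  jacobi : ∀ {i j : ZMod 2} {a b : g} (c : g),
    a ∈ SuperGroup.part i → b ∈ SuperGroup.part j →
      ⁅⁅a, b⁆, c⁆ = ⁅a, ⁅b, c⁆⁆ - sgn i j • ⁅b, ⁅a, c⁆⁆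
  lie_lie_self : ∀ {a : g}, a ∈ SuperGroup.part 1 → ⁅a, ⁅a, a⁆⁆ = 0

theorem sgn_mul_self (i j : ZMod 2) : sgn i j * sgn i j = 1 := by
  revert i j; decide

theorem sgn_add_left (i j l : ZMod 2) : sgn (i + j) l = sgn i l * sgn j l := by
  revert i j l; decide

theorem sgn_add_right (i j l : ZMod 2) : sgn i (j + l) = sgn i j * sgn i l := by
  revert i j l; decide

theorem sgn_comm (i j : ZMod 2) : sgn i j = sgn j i := by
  revert i j; decide

theorem sgn_smul_smul {M : Type*} [AddCommGroup M] (i j : ZMod 2) (m : M) :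
    sgn i j • sgn i j • m = m := by
  rw [smul_smul, sgn_mul_self, one_smul]

theorem sgn_smul_rsmul {k M : Type*} [Ring k] [AddCommGroup M] [Module kᵐᵒᵖ M] (n : ℤ) (m : M)
    (α : k) : (n • m) <• α = n • (m <• α) :=
  smul_comm _ _ _

section Modules

variable {k : Type*} [Ring k]

/-- The right action as a biadditive map. -/
def rightMul (k M : Type*) [Ring k] [AddCommGroup M] [Module kᵐᵒᵖ M] : M →+ k →+ M :=
  AddMonoidHom.mk' (fun m => AddMonoidHom.mk' (fun α : k => m <• α) (by
    intro α β; rw [MulOpposite.op_add, add_smul])) (by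
    intro m n; ext α; exact smul_add _ _ _)

theorem rightMul_apply {M : Type*} [AddCommGroup M] [Module kᵐᵒᵖ M] (m : M) (α : k) :
    rightMul k M m α = m <• α := rfl

variable [SuperGroup k]

/-- The left action `α m := (-1) ^ (p(α) p(m)) m α`. -/
def leftMul (k M : Type*) [Ring k] [SuperGroup k] [AddCommGroup M] [Module kᵐᵒᵖ M]
    [SuperGroup M] : k →+ M →+ M :=
  (signed (rightMul k M)).flip

variable {M : Type*} [AddCommGroup M] [Module kᵐᵒᵖ M] [SuperGroup M]

theorem leftMul_homog {i j : ZMod 2} {α : k} {m : M} (hα : α ∈ SuperGroup.part i)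
    (hm : m ∈ SuperGroup.part j) : leftMul k M α m = sgn i j • (m <• α) := by
  rw [leftMul, AddMonoidHom.flip_apply, signed_homog _ hm hα, sgn_comm, rightMul_apply]

variable [CommSuperRing k] [SuperModule k M]

theorem leftMul_smul (α : k) (m : M) (β : k) :
    leftMul k M α (m <• β) = leftMul k M α m <• β := by
  induction α using homog_induction with
  | hadd a b ha hb => simp only [map_add, AddMonoidHom.add_apply, ha, hb, smul_add]
  | hom i α hα =>
  induction m using homog_induction with
  | hadd a b ha hb => simp only [map_add, ha, hb, smul_add]
  | hom j m hm =>
  induction β using homog_induction with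
  | hadd a b ha hb => simp only [map_add, MulOpposite.op_add, add_smul, ha, hb]
  | hom l β hβ =>
  rw [leftMul_homog hα (SuperModule.smul_mem hm hβ), leftMul_homog hα hm, sgn_smul_rsmul,
    op_smul_op_smul, op_smul_op_smul, CommSuperRing.mul_comm hβ hα, sgn_add_right, mul_smul,
    MulOpposite.op_smul, smul_assoc, sgn_comm l i, sgn_smul_smul]

theorem one_leftMul (m : M) : leftMul k M 1 m = m := by
  induction m using homog_induction with
  | hadd a b ha hb => simp only [map_add, ha, hb]
  | hom j m hm =>
  rw [leftMul_homog CommSuperRing.one_mem hm, MulOpposite.op_one, one_smul,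
    show sgn 0 j = 1 by clear hm; revert j; decide, one_smul]

theorem mul_leftMul (α β : k) (m : M) :
    leftMul k M (α * β) m = leftMul k M α (leftMul k M β m) := by
  induction α using homog_induction with
  | hadd a b ha hb => simp only [map_add, AddMonoidHom.add_apply, ha, hb, add_mul]
  | hom i α hα =>
  induction β using homog_induction with
  | hadd a b ha hb => simp only [map_add, AddMonoidHom.add_apply, ha, hb, mul_add]
  | hom l β hβ =>
  induction m using homog_induction with
  | hadd a b ha hb => simp only [map_add, ha, hb]
  | hom j m hm =>
  rw [leftMul_homog (CommSuperRing.mul_mem hα hβ) hm, leftMul_homog hβ hm, map_zsmul,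
    leftMul_homog hα (SuperModule.smul_mem hm hβ), op_smul_op_smul, 
    CommSuperRing.mul_comm hα hβ, sgn_add_left, sgn_add_right, MulOpposite.op_smul, smul_assoc,
    smul_smul, smul_smul]
  congr 1
  ring

end Modules

section Tensor

/-- The defining relations of `M ⊗ N` over `k`: `m ⊗ n α = (-1) ^ (p(n) p(α)) m α ⊗ n`. -/
def tensorRel (k M N : Type*) [Ring k] [SuperGroup k] [AddCommGroup M] [Module kᵐᵒᵖ M]
    [AddCommGroup N] [Module kᵐᵒᵖ N] [SuperGroup N] : Submodule ℤ (M ⊗[ℤ] N) :=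
  Submodule.span ℤ {z | ∃ (i j : ZMod 2) (m : M) (n : N) (α : k), n ∈ SuperGroup.part i ∧
    α ∈ SuperGroup.part j ∧ z = m ⊗ₜ[ℤ] (n <• α) - sgn i j • ((m <• α) ⊗ₜ[ℤ] n)}

/-- The tensor product `M ⊗ N` over the superring `k`. -/
def STensor (k M N : Type*) [Ring k] [SuperGroup k] [AddCommGroup M] [Module kᵐᵒᵖ M]
    [AddCommGroup N] [Module kᵐᵒᵖ N] [SuperGroup N] : Type _ :=
  (M ⊗[ℤ] N) ⧸ tensorRel k M N

variable {k : Type*} [Ring k] [SuperGroup k]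
  {M : Type*} [AddCommGroup M] [Module kᵐᵒᵖ M]
  {N : Type*} [AddCommGroup N] [Module kᵐᵒᵖ N] [SuperGroup N]

noncomputable instance : AddCommGroup (STensor k M N) :=
  inferInstanceAs (AddCommGroup ((M ⊗[ℤ] N) ⧸ tensorRel k M N))

/-- The biadditive map `(m, n) ↦ m ⊗ n`. -/
noncomputable def tmulHom (k M N : Type*) [Ring k] [SuperGroup k] [AddCommGroup M]
    [Module kᵐᵒᵖ M] [AddCommGroup N] [Module kᵐᵒᵖ N] [SuperGroup N] :
    M →+ N →+ STensor k M N :=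
  AddMonoidHom.mk' (fun m => AddMonoidHom.mk'
    (fun n => Submodule.Quotient.mk (p := tensorRel k M N) (m ⊗ₜ[ℤ] n))
    (by intro a b; rw [TensorProduct.tmul_add]; rfl))
    (by intro a b; ext n
        simp only [AddMonoidHom.mk'_apply, AddMonoidHom.add_apply, TensorProduct.add_tmul]; rfl)

/-- The element `m ⊗ n`. -/
noncomputable abbrev tm (k : Type*) {M N : Type*} [Ring k] [SuperGroup k] [AddCommGroup M]
    [Module kᵐᵒᵖ M] [AddCommGroup N] [Module kᵐᵒᵖ N] [SuperGroup N] (m : M) (n : N) :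
    STensor k M N := tmulHom k M N m n

theorem tm_smul {i j : ZMod 2} (m : M) {n : N} {α : k} (hn : n ∈ SuperGroup.part i)
    (hα : α ∈ SuperGroup.part j) : tm k m (n <• α) = sgn i j • tm k (m <• α) n :=
  (Submodule.Quotient.eq (tensorRel k M N)).2
    (Submodule.subset_span ⟨i, j, m, n, α, hn, hα, rfl⟩)

theorem tensor_induction {P : STensor k M N → Prop} (hz : P 0)
    (hadd : ∀ x y, P x → P y → P (x + y)) (ht : ∀ m n, P (tm k m n)) (x : STensor k M N) :
    P x := by
  induction x using Submodule.Quotient.induction_on with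
  | H x =>
  induction x using TensorProduct.induction_on with
  | zero => exact hz
  | tmul m n => exact ht m n
  | add x y hx hy => exact hadd _ _ hx hy

theorem tensor_hom_ext {Q : Type*} [AddCommGroup Q] {f g : STensor k M N →+ Q}
    (h : ∀ m n, f (tm k m n) = g (tm k m n)) : f = g := by
  ext x
  induction x using tensor_induction with
  | hz => simp
  | hadd x y hx hy => rw [map_add, map_add, hx, hy]
  | ht m n => exact h m n

/-- The additive map on `M ⊗ N` induced by a balanced biadditive map. -/
noncomputable def tlift {Q : Type*} [AddCommGroup Q] (f : M →+ N →+ Q)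
    (hf : ∀ (i j : ZMod 2) (m : M) (n : N) (α : k), n ∈ SuperGroup.part i →
      α ∈ SuperGroup.part j → f m (n <• α) = sgn i j • f (m <• α) n) : STensor k M N →+ Q :=
  ((tensorRel k M N).liftQ (TensorProduct.liftAddHom f (by intro r m n; simp)).toIntLinearMap (by
    rw [tensorRel, Submodule.span_le]
    rintro _ ⟨i, j, m, n, α, hn, hα, rfl⟩
    rw [SetLike.mem_coe, LinearMap.mem_ker, map_sub, map_zsmul, sub_eq_zero]
    exact hf i j m n α hn hα)).toAddMonoidHom

@[simp]
theorem tlift_tm {Q : Type*} [AddCommGroup Q] (f : M →+ N →+ Q)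
    (hf : ∀ (i j : ZMod 2) (m : M) (n : N) (α : k), n ∈ SuperGroup.part i →
      α ∈ SuperGroup.part j → f m (n <• α) = sgn i j • f (m <• α) n) (m : M) (n : N) :
    tlift f hf (tm k m n) = f m n := rfl

variable [CommSuperRing k] [SuperModule k N]

/-- The right action of `α` on `M ⊗ N`. -/
noncomputable def tensorSMul (α : k) : STensor k M N →+ STensor k M N :=
  tlift (AddMonoidHom.mk' (fun m => (tmulHom k M N m).comp ((rightMul k N).flip α))
      (by intro a b; ext n; simp)) (by
    intro i j m n β hn hβ
    simp only [AddMonoidHom.mk'_apply, AddMonoidHom.comp_apply, AddMonoidHom.flip_apply,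
      rightMul_apply]
    induction α using homog_induction with
    | hadd a b ha hb => simp only [map_add, MulOpposite.op_add, add_smul, ha, hb, smul_add]
    | hom l α hα =>
    rw [op_smul_op_smul, CommSuperRing.mul_comm hβ hα, MulOpposite.op_smul, smul_assoc, map_zsmul,
      ← op_smul_op_smul]
    refine (congrArg _ (tm_smul m (SuperModule.smul_mem hn hα) hβ)).trans ?_
    rw [sgn_add_left, mul_smul, smul_comm (sgn j l), sgn_comm j l, sgn_smul_smul])

theorem tensorSMul_tm (α : k) (m : M) (n : N) :
    tensorSMul α (tm k m n) = tm k m (n <• α) := rfl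

noncomputable instance : Module kᵐᵒᵖ (STensor k M N) :=
  Module.compHom (R := AddMonoid.End (STensor k M N)) _
    ({ toFun := fun α => tensorSMul α.unop
       map_one' := tensor_hom_ext fun m n => by
        rw [tensorSMul_tm, MulOpposite.op_unop, one_smul]; rfl
       map_mul' := fun α β => tensor_hom_ext fun m n => by
        rw [tensorSMul_tm, MulOpposite.op_unop, mul_smul]; rfl
       map_zero' := tensor_hom_ext fun m n => by
        rw [tensorSMul_tm, MulOpposite.op_unop, zero_smul]; exact map_zero _
       map_add' := fun α β => tensor_hom_ext fun m n => by
        rw [tensorSMul_tm, MulOpposite.op_unop, add_smul]; exact map_add _ _ _ } :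
      kᵐᵒᵖ →+* AddMonoid.End (STensor k M N))

theorem tm_rsmul (m : M) (n : N) (α : k) : tm k m n <• α = tm k m (n <• α) := rfl

end Tensor

section Hom

variable {k : Type*} [Ring k] [SuperGroup k]
  {M : Type*} [AddCommGroup M] [Module kᵐᵒᵖ M] [SuperGroup M] [SuperModule k M]
  {N : Type*} [AddCommGroup N] [Module kᵐᵒᵖ N] [SuperGroup N] [SuperModule k N]

theorem proj_smul {i l : ZMod 2} (n : N) {α : k} (hα : α ∈ SuperGroup.part l) :
    proj (i + l) (n <• α) = proj i n <• α := by
  induction n using homog_induction with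
  | hadd a b ha hb => simp only [smul_add, map_add, ha, hb]
  | hom j n hn =>
  by_cases h : j = i
  · subst h
    rw [proj_of_mem hn, proj_of_mem (SuperModule.smul_mem hn hα)]
  · rw [proj_of_mem_ne hn h, smul_zero, proj_of_mem_ne (SuperModule.smul_mem hn hα)]
    simpa using h

/-- The component of parity `i` of a morphism, as an additive map. -/
def homPartAux (i : ZMod 2) (F : M →ₗ[kᵐᵒᵖ] N) : M →+ N :=
  ∑ j, (proj (i + j)).comp (F.toAddMonoidHom.comp (proj j))

theorem homPartAux_homog (i : ZMod 2) (F : M →ₗ[kᵐᵒᵖ] N) {j : ZMod 2} {m : M}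
    (hm : m ∈ SuperGroup.part j) : homPartAux i F m = proj (i + j) (F m) := by
  rw [homPartAux, AddMonoidHom.finsetSum_apply, Finset.sum_eq_single j]
  · simp [proj_of_mem hm]
  · intro l _ hl
    simp [proj_of_mem_ne hm hl.symm]
  · simp

/-- The component of parity `i` of a morphism of modules: `m ↦ (F m)_{i + j}` for `m` of
parity `j`. -/
def homPart (i : ZMod 2) : (M →ₗ[kᵐᵒᵖ] N) →+ (M →ₗ[kᵐᵒᵖ] N) :=
  AddMonoidHom.mk' (fun F =>
    { homPartAux i F with
      map_smul' := by
        intro β m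
        obtain ⟨α, rfl⟩ := MulOpposite.op_surjective β
        show homPartAux i F (m <• α) = homPartAux i F m <• α
        induction m using homog_induction with
        | hadd a b ha hb => simp only [smul_add, map_add, ha, hb]
        | hom j m hm =>
        induction α using homog_induction with
        | hadd a b ha hb => simp only [MulOpposite.op_add, add_smul, map_add, ha, hb]
        | hom l α hα =>
        rw [homPartAux_homog i F hm, homPartAux_homog i F (SuperModule.smul_mem hm hα),
          map_smul, ← add_assoc, proj_smul _ hα] })
    (by
      intro F G
      ext m
      show homPartAux i (F + G) m = homPartAux i F m + homPartAux i G m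
      simp [homPartAux, AddMonoidHom.finsetSum_apply, Finset.sum_add_distrib])

theorem homPart_homog (i : ZMod 2) (F : M →ₗ[kᵐᵒᵖ] N) {j : ZMod 2} {m : M}
    (hm : m ∈ SuperGroup.part j) : homPart i F m = proj (i + j) (F m) :=
  homPartAux_homog i F hm

theorem hom_ext_homog {F G : M →ₗ[kᵐᵒᵖ] N}
    (h : ∀ j, ∀ m ∈ SuperGroup.part j, F m = G m) : F = G := by
  ext m
  induction m using homog_induction with
  | hadd m n hm hn => rw [map_add, map_add, hm, hn]
  | hom i m hm => exact h i m hm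

/-- The parity of morphisms: `F` has parity `i` if `F (M_j) ⊆ N_{i + j}` for all `j`. -/
instance : SuperGroup (M →ₗ[kᵐᵒᵖ] N) :=
  SuperGroup.ofProj
    (fun i =>
      { carrier := {F | ∀ j, ∀ m ∈ SuperGroup.part j, F m ∈ SuperGroup.part (i + j)}
        zero_mem' := fun j m _ => zero_mem _
        add_mem' := fun hF hG j m hm => add_mem (hF j m hm) (hG j m hm)
        neg_mem' := fun hF j m hm => neg_mem (hF j m hm) })
    homPart
    (fun i F j m hm => by rw [homPart_homog i F hm]; exact proj_mem _ _)
    (fun i F hF => hom_ext_homog fun j m hm => by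
      rw [homPart_homog i F hm, proj_of_mem (hF j m hm)])
    (fun i j hij F hF => hom_ext_homog fun l m hm => by
      rw [homPart_homog j F hm, proj_of_mem_ne (hF l m hm) (by simpa using hij)]; rfl)
    (fun F => hom_ext_homog fun j m hm => by
      rw [LinearMap.sum_apply]
      simp only [homPart_homog _ F hm]
      rw [Fintype.sum_equiv (Equiv.addRight j) (fun i => proj (i + j) (F m))
        (fun i => proj i (F m)) (fun _ => rfl), sum_proj])

theorem mem_homPart_iff {i : ZMod 2} {F : M →ₗ[kᵐᵒᵖ] N} : F ∈ SuperGroup.part i ↔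
    ∀ j, ∀ m ∈ SuperGroup.part j, F m ∈ SuperGroup.part (i + j) := Iff.rfl

/-- Composition as a biadditive map. -/
def compHom (k M N P : Type*) [Ring k] [AddCommGroup M] [Module kᵐᵒᵖ M] [AddCommGroup N]
    [Module kᵐᵒᵖ N] [AddCommGroup P] [Module kᵐᵒᵖ P] :
    (N →ₗ[kᵐᵒᵖ] P) →+ (M →ₗ[kᵐᵒᵖ] N) →+ (M →ₗ[kᵐᵒᵖ] P) :=
  AddMonoidHom.mk' (fun F => AddMonoidHom.mk' (fun G => F.comp G) (fun G H => by
    ext m; simp)) (fun F G => by ext H m; simp)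

/-- The bracket `F ∘ G - (-1) ^ (p(F) p(G)) G ∘ F` of endomorphisms. -/
def superComm (F G : M →ₗ[kᵐᵒᵖ] M) : M →ₗ[kᵐᵒᵖ] M :=
  compHom k M M M F G - signed (compHom k M M M).flip F G

variable [CommSuperRing k]

variable {P : Type*} [AddCommGroup P] [Module kᵐᵒᵖ P]
  {Q : Type*} [AddCommGroup Q] [Module kᵐᵒᵖ Q] [SuperGroup Q] [SuperModule k Q]

/-- The map `(m, n) ↦ (-1) ^ (p(G) p(m)) F m ⊗ G n`. -/
noncomputable def tmapAux (F : M →ₗ[kᵐᵒᵖ] P) (G : N →ₗ[kᵐᵒᵖ] Q) : M →+ N →+ STensor k P Q :=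
  AddMonoidHom.mk' (fun m => AddMonoidHom.mk'
    (fun n => signed
      (AddMonoidHom.mk' (fun G' : N →ₗ[kᵐᵒᵖ] Q => AddMonoidHom.mk'
        (fun m' : M => tm k (F m') (G' n)) (by intro a b; simp [tm])) (by intro a b; ext; simp [tm])) G m)
    (by intro a b
        simp only [signed_apply, AddMonoidHom.mk'_apply, map_add, smul_add,
          Finset.sum_add_distrib]))
    (by intro a b; ext n
        simp only [signed_apply, AddMonoidHom.mk'_apply, map_add, smul_add,
          Finset.sum_add_distrib, AddMonoidHom.add_apply])

theorem tmapAux_apply (F : M →ₗ[kᵐᵒᵖ] P) (G : N →ₗ[kᵐᵒᵖ] Q) (m : M) (n : N) :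
    tmapAux F G m n = ∑ i, ∑ j, sgn i j • tm k (F (proj j m)) (proj i G n) := by
  show signed _ G m = _
  rw [signed_apply]
  rfl

theorem tmapAux_homog (F : M →ₗ[kᵐᵒᵖ] P) {G : N →ₗ[kᵐᵒᵖ] Q} {i j : ZMod 2}
    (hG : G ∈ SuperGroup.part i) {m : M} (hm : m ∈ SuperGroup.part j) (n : N) :
    tmapAux F G m n = sgn i j • tm k (F m) (G n) := by
  show signed _ G m = _
  rw [signed_homog _ hG hm]
  rfl

theorem tmapAux_add_right (F : M →ₗ[kᵐᵒᵖ] P) (G H : N →ₗ[kᵐᵒᵖ] Q) (m : M) (n : N) :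
    tmapAux F (G + H) m n = tmapAux F G m n + tmapAux F H m n := by
  simp only [tmapAux_apply, map_add, LinearMap.add_apply, smul_add, Finset.sum_add_distrib]

/-- The tensor product `F ⊗ G` of morphisms of modules:
`m ⊗ n ↦ (-1) ^ (p(G) p(m)) F m ⊗ G n`. -/
noncomputable def tmap (F : M →ₗ[kᵐᵒᵖ] P) (G : N →ₗ[kᵐᵒᵖ] Q) :
    STensor k M N →ₗ[kᵐᵒᵖ] STensor k P Q :=
  { tlift (tmapAux F G) (by
      intro i j m n α hn hα
      induction G using homog_induction with
      | hadd G H hG hH => rw [tmapAux_add_right, tmapAux_add_right, hG, hH, smul_add]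
      | hom a G hG =>
      induction m using homog_induction with
      | hadd a b ha hb => simp only [smul_add, map_add, AddMonoidHom.add_apply, ha, hb]
      | hom b m hm =>
      rw [tmapAux_homog F hG hm, tmapAux_homog F hG (SuperModule.smul_mem hm hα), map_smul,
        map_smul]
      refine (congrArg _ (tm_smul (F m) (hG i n hn) hα)).trans ?_
      simp only [smul_smul, sgn_add_left, sgn_add_right]
      congr 1
      ring) with
    map_smul' := by
      intro β x
      obtain ⟨α, rfl⟩ := MulOpposite.op_surjective β
      show tlift _ _ (x <• α) = tlift _ _ x <• α
      induction x using tensor_induction with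
      | hz => simp
      | hadd x y hx hy => rw [smul_add, map_add, hx, hy, map_add, smul_add]
      | ht m n =>
      rw [tm_rsmul, tlift_tm, tlift_tm, tmapAux_apply, tmapAux_apply, Finset.smul_sum]
      refine Finset.sum_congr rfl fun i _ => ?_
      rw [Finset.smul_sum]
      refine Finset.sum_congr rfl fun j _ => ?_
      rw [map_smul, sgn_smul_rsmul, tm_rsmul] }

theorem tmap_tm (F : M →ₗ[kᵐᵒᵖ] P) (G : N →ₗ[kᵐᵒᵖ] Q) (m : M) (n : N) :
    tmap F G (tm k m n) = ∑ i, ∑ j, sgn i j • tm k (F (proj j m)) (proj i G n) :=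
  tmapAux_apply F G m n

theorem tmap_homog (F : M →ₗ[kᵐᵒᵖ] P) {G : N →ₗ[kᵐᵒᵖ] Q} {i j : ZMod 2}
    (hG : G ∈ SuperGroup.part i) {m : M} (hm : m ∈ SuperGroup.part j) (n : N) :
    tmap F G (tm k m n) = sgn i j • tm k (F m) (G n) :=
  tmapAux_homog F hG hm n

end Hom

section SymAlg

/-- The defining relations of the symmetric algebra, on the free ring generated by the elements of
`k` and of `M`: the ring and module operations of `k` and `M`, the supercommutation of homogeneous
elements, and the vanishing of the squares of odd elements of `M`. -/
inductive SymRel (k M : Type*) [Ring k] [SuperGroup k] [AddCommGroup M] [Module kᵐᵒᵖ M]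
    [SuperGroup M] : FreeAlgebra ℤ (k ⊕ M) → FreeAlgebra ℤ (k ⊕ M) → Prop
  | scalar_one : SymRel k M (FreeAlgebra.ι ℤ (.inl 1)) 1
  | scalar_add (α β : k) : SymRel k M (FreeAlgebra.ι ℤ (.inl (α + β)))
      (FreeAlgebra.ι ℤ (.inl α) + FreeAlgebra.ι ℤ (.inl β))
  | scalar_mul (α β : k) : SymRel k M (FreeAlgebra.ι ℤ (.inl (α * β)))
      (FreeAlgebra.ι ℤ (.inl α) * FreeAlgebra.ι ℤ (.inl β))
  | add (m n : M) : SymRel k M (FreeAlgebra.ι ℤ (.inr (m + n)))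
      (FreeAlgebra.ι ℤ (.inr m) + FreeAlgebra.ι ℤ (.inr n))
  | smul (m : M) (α : k) : SymRel k M (FreeAlgebra.ι ℤ (.inr (m <• α)))
      (FreeAlgebra.ι ℤ (.inr m) * FreeAlgebra.ι ℤ (.inl α))
  | comm_scalar {i j : ZMod 2} (m : M) (α : k) : m ∈ SuperGroup.part i → α ∈ SuperGroup.part j →
      SymRel k M (FreeAlgebra.ι ℤ (.inr m) * FreeAlgebra.ι ℤ (.inl α))
        (sgn i j • (FreeAlgebra.ι ℤ (.inl α) * FreeAlgebra.ι ℤ (.inr m)))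
  | comm {i j : ZMod 2} (m n : M) : m ∈ SuperGroup.part i → n ∈ SuperGroup.part j →
      SymRel k M (FreeAlgebra.ι ℤ (.inr m) * FreeAlgebra.ι ℤ (.inr n))
        (sgn i j • (FreeAlgebra.ι ℤ (.inr n) * FreeAlgebra.ι ℤ (.inr m)))
  | sq (m : M) : m ∈ SuperGroup.part 1 →
      SymRel k M (FreeAlgebra.ι ℤ (.inr m) * FreeAlgebra.ι ℤ (.inr m)) 0

/-- The symmetric algebra `S(M) = T(M) / I` of a module `M` over a commutative superring `k`. The
tensor algebra of the bimodule `M` (with `α m = (-1) ^ (p(α) p(m)) m α`) is the ring generated by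
the ring `k` and the bimodule `M`; the ideal `I` adds the relations `comm` and `sq`. -/
def SymAlg (k M : Type*) [Ring k] [SuperGroup k] [AddCommGroup M] [Module kᵐᵒᵖ M]
    [SuperGroup M] : Type _ :=
  RingQuot (SymRel k M)

variable (k : Type*) [Ring k] [SuperGroup k] (M : Type*) [AddCommGroup M] [Module kᵐᵒᵖ M]
    [SuperGroup M]

noncomputable instance : Ring (SymAlg k M) := inferInstanceAs (Ring (RingQuot (SymRel k M)))

/-- The inclusion of scalars `k → S(M)`. -/
noncomputable def scal : k →+* SymAlg k M where
  toFun α := RingQuot.mkRingHom (SymRel k M) (FreeAlgebra.ι ℤ (.inl α))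
  map_one' := (RingQuot.mkRingHom_rel SymRel.scalar_one).trans (map_one _)
  map_mul' α β := (RingQuot.mkRingHom_rel (SymRel.scalar_mul α β)).trans (map_mul _ _ _)
  map_add' α β := (RingQuot.mkRingHom_rel (SymRel.scalar_add α β)).trans (map_add _ _ _)
  map_zero' := by
    have h := RingQuot.mkRingHom_rel (SymRel.scalar_add (k := k) (M := M) 0 0)
    rw [map_add, add_zero] at h
    exact left_eq_add.1 h

/-- The inclusion `M → S(M)`, as an additive map. -/
noncomputable def incl : M →+ SymAlg k M :=
  AddMonoidHom.mk' (fun m => RingQuot.mkRingHom (SymRel k M) (FreeAlgebra.ι ℤ (.inr m)))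
    (fun m n => (RingQuot.mkRingHom_rel (SymRel.add m n)).trans (map_add _ _ _))

variable {k M}

theorem incl_smul (m : M) (α : k) : incl k M (m <• α) = incl k M m * scal k M α :=
  (RingQuot.mkRingHom_rel (SymRel.smul m α)).trans (map_mul _ _ _)

theorem incl_mul_scal {i j : ZMod 2} {m : M} {α : k} (hm : m ∈ SuperGroup.part i)
    (hα : α ∈ SuperGroup.part j) :
    incl k M m * scal k M α = sgn i j • (scal k M α * incl k M m) :=
  (map_mul (RingQuot.mkRingHom (SymRel k M)) _ _).symm.trans ((RingQuot.mkRingHom_rel (SymRel.comm_scalar m α hm hα)).trans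
    ((map_zsmul _ _ _).trans (congrArg _ (map_mul _ _ _))))

theorem incl_mul_incl {i j : ZMod 2} {m n : M} (hm : m ∈ SuperGroup.part i)
    (hn : n ∈ SuperGroup.part j) :
    incl k M m * incl k M n = sgn i j • (incl k M n * incl k M m) :=
  (map_mul (RingQuot.mkRingHom (SymRel k M)) _ _).symm.trans ((RingQuot.mkRingHom_rel (SymRel.comm m n hm hn)).trans
    ((map_zsmul _ _ _).trans (congrArg _ (map_mul _ _ _))))

theorem incl_mul_self {m : M} (hm : m ∈ SuperGroup.part 1) : incl k M m * incl k M m = 0 :=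
  (map_mul (RingQuot.mkRingHom (SymRel k M)) _ _).symm.trans ((RingQuot.mkRingHom_rel (SymRel.sq m hm)).trans (map_zero _))

/-- The universal property of the symmetric algebra. -/
noncomputable def symLift {A : Type*} [Ring A] (f : k →+* A) (g : M →+ A)
    (smul : ∀ m α, g (m <• α) = g m * f α)
    (comm_scalar : ∀ (i j : ZMod 2) (m : M) (α : k), m ∈ SuperGroup.part i →
      α ∈ SuperGroup.part j → g m * f α = sgn i j • (f α * g m))
    (comm : ∀ (i j : ZMod 2) (m n : M), m ∈ SuperGroup.part i → n ∈ SuperGroup.part j →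
      g m * g n = sgn i j • (g n * g m))
    (sq : ∀ m ∈ SuperGroup.part 1, g m * g m = 0) : SymAlg k M →+* A :=
  RingQuot.lift ⟨(FreeAlgebra.lift ℤ (Sum.elim f g)).toRingHom, by
    intro a b h
    cases h with
    | scalar_one => simp
    | scalar_add α β => simp
    | scalar_mul α β => simp
    | add m n => simp
    | smul m α => simpa using smul m α
    | comm_scalar m α hm hα => simpa using comm_scalar _ _ m α hm hα
    | comm m n hm hn => simpa using comm _ _ m n hm hn
    | sq m hm => simpa using sq m hm⟩

section

variable {A : Type*} [Ring A] (f : k →+* A) (g : M →+ A)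
    (smul : ∀ m α, g (m <• α) = g m * f α)
    (comm_scalar : ∀ (i j : ZMod 2) (m : M) (α : k), m ∈ SuperGroup.part i →
      α ∈ SuperGroup.part j → g m * f α = sgn i j • (f α * g m))
    (comm : ∀ (i j : ZMod 2) (m n : M), m ∈ SuperGroup.part i → n ∈ SuperGroup.part j →
      g m * g n = sgn i j • (g n * g m))
    (sq : ∀ m ∈ SuperGroup.part 1, g m * g m = 0)

theorem symLift_scal (α : k) : symLift f g smul comm_scalar comm sq (scal k M α) = f α := by
  refine (RingQuot.lift_mkRingHom_apply _ _ _).trans ?_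
  simp

theorem symLift_incl (m : M) : symLift f g smul comm_scalar comm sq (incl k M m) = g m := by
  refine (RingQuot.lift_mkRingHom_apply _ _ _).trans ?_
  simp

end

theorem symAlg_hom_ext {A : Type*} [Ring A] {f g : SymAlg k M →+* A}
    (hs : ∀ α, f (scal k M α) = g (scal k M α)) (hi : ∀ m, f (incl k M m) = g (incl k M m)) :
    f = g := by
  refine RingQuot.ringQuot_ext _ _ ?_
  have : (f.comp (RingQuot.mkRingHom (SymRel k M))).toIntAlgHom =
      (g.comp (RingQuot.mkRingHom (SymRel k M))).toIntAlgHom := by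
    refine FreeAlgebra.hom_ext (funext fun x => ?_)
    cases x with
    | inl α => exact hs α
    | inr m => exact hi m
  exact RingHom.ext fun x => DFunLike.congr_fun this x

noncomputable instance : Module kᵐᵒᵖ (SymAlg k M) := Module.compHom _ (scal k M).op

theorem rsmul_eq_mul (s : SymAlg k M) (α : k) : s <• α = s * scal k M α := rfl

variable [CommSuperRing k] [SuperModule k M]

variable (k M) in
/-- The coaction `s ↦ ∑ i, s_i e^i` of the parity grading, determined by its values on scalars and
elements of `M`. -/
noncomputable def parityCoaction : SymAlg k M →+* AddMonoidAlgebra (SymAlg k M) (ZMod 2) :=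
  let f : k →+ AddMonoidAlgebra (SymAlg k M) (ZMod 2) :=
    ∑ i, (AddMonoidAlgebra.singleAddHom i).comp ((scal k M).toAddMonoidHom.comp (proj i))
  let g : M →+ AddMonoidAlgebra (SymAlg k M) (ZMod 2) :=
    ∑ i, (AddMonoidAlgebra.singleAddHom i).comp ((incl k M).comp (proj i))
  have hf : ∀ i, ∀ α ∈ SuperGroup.part i, f α = AddMonoidAlgebra.single i (scal k M α) := by
    intro i α hα
    simp only [f, AddMonoidHom.finsetSum_apply]
    rw [Finset.sum_eq_single i]
    · simp [proj_of_mem hα]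
    · intro j _ hj
      simp [proj_of_mem_ne hα hj.symm]
    · simp
  have hg : ∀ i, ∀ m ∈ SuperGroup.part i, g m = AddMonoidAlgebra.single i (incl k M m) := by
    intro i m hm
    simp only [g, AddMonoidHom.finsetSum_apply]
    rw [Finset.sum_eq_single i]
    · simp [proj_of_mem hm]
    · intro j _ hj
      simp [proj_of_mem_ne hm hj.symm]
    · simp
  symLift
    { f with
      map_one' := by
        show f 1 = 1
        rw [hf 0 1 CommSuperRing.one_mem, map_one]; rfl
      map_mul' := by
        intro α β
        show f (α * β) = f α * f β
        induction α using homog_induction with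
        | hadd a b ha hb => rw [add_mul, map_add, map_add, add_mul, ha, hb]
        | hom i α hα =>
        induction β using homog_induction with
        | hadd a b ha hb => rw [mul_add, map_add, map_add, mul_add, ha, hb]
        | hom j β hβ =>
        rw [hf i α hα, hf j β hβ, hf _ _ (CommSuperRing.mul_mem hα hβ),
          AddMonoidAlgebra.single_mul_single, map_mul] }
    g
    (by
      intro m α
      show g (m <• α) = g m * f α
      induction α using homog_induction with
      | hadd a b ha hb =>
        rw [MulOpposite.op_add, add_smul, map_add, map_add, mul_add, ha, hb]
      | hom i α hα =>
      induction m using homog_induction with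
      | hadd a b ha hb => rw [smul_add, map_add, map_add, add_mul, ha, hb]
      | hom j m hm =>
      rw [hf i α hα, hg j m hm, hg _ _ (SuperModule.smul_mem hm hα),
        AddMonoidAlgebra.single_mul_single, incl_smul])
    (by
      intro i j m α hm hα
      show g m * f α = sgn i j • (f α * g m)
      rw [hf j α hα, hg i m hm, AddMonoidAlgebra.single_mul_single,
        AddMonoidAlgebra.single_mul_single, incl_mul_scal hm hα, add_comm j i,
        ← AddMonoidAlgebra.singleAddHom_apply, map_zsmul, AddMonoidAlgebra.singleAddHom_apply])
    (by
      intro i j m n hm hn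
      rw [hg j n hn, hg i m hm, AddMonoidAlgebra.single_mul_single,
        AddMonoidAlgebra.single_mul_single, incl_mul_incl hm hn, add_comm j i,
        ← AddMonoidAlgebra.singleAddHom_apply, map_zsmul, AddMonoidAlgebra.singleAddHom_apply])
    (by
      intro m hm
      rw [hg 1 m hm, AddMonoidAlgebra.single_mul_single, incl_mul_self hm,
        AddMonoidAlgebra.single_zero])



theorem symAlg_induction {P : SymAlg k M → Prop} (hs : ∀ α, P (scal k M α))
    (hi : ∀ m, P (incl k M m)) (hadd : ∀ s t, P s → P t → P (s + t))
    (hmul : ∀ s t, P s → P t → P (s * t)) (s : SymAlg k M) : P s := by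
  obtain ⟨x, rfl⟩ := RingQuot.mkRingHom_surjective (SymRel k M) s
  induction x using FreeAlgebra.induction with
  | grade0 r =>
    have : RingQuot.mkRingHom (SymRel k M) (algebraMap ℤ _ r) = scal k M (r : k) := by
      rw [map_intCast (scal k M) r, eq_intCast, map_intCast]; rfl
    rw [this]; exact hs _
  | grade1 x =>
    cases x with
    | inl α => exact hs α
    | inr m => exact hi m
  | mul a b ha hb => rw [map_mul]; exact hmul _ _ ha hb
  | add a b ha hb => rw [map_add]; exact hadd _ _ ha hb

variable (k M) in
/-- The elements of parity `i` of the symmetric algebra. By `scal_mem`, `incl_mem` and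
`sym_mul_mem`, this is the grading for which products of homogeneous elements of `k` and `M` have
the sum of the parities as their parity. -/
noncomputable def symPart (i : ZMod 2) : AddSubgroup (SymAlg k M) :=
  (parityCoaction k M).toAddMonoidHom.eqLocus (AddMonoidAlgebra.singleAddHom i)

theorem mem_symPart {i : ZMod 2} {s : SymAlg k M} :
    s ∈ symPart k M i ↔ parityCoaction k M s = AddMonoidAlgebra.single i s := Iff.rfl

theorem scal_mem_symPart {i : ZMod 2} {α : k} (hα : α ∈ SuperGroup.part i) :
    scal k M α ∈ symPart k M i := by
  rw [mem_symPart, parityCoaction, symLift_scal]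
  show (∑ i, (AddMonoidAlgebra.singleAddHom i).comp
    ((scal k M).toAddMonoidHom.comp (proj i)) : k →+ _) α = _
  rw [AddMonoidHom.finsetSum_apply, Finset.sum_eq_single i]
  · simp [proj_of_mem hα]
  · intro j _ hj
    simp [proj_of_mem_ne hα hj.symm]
  · simp

theorem incl_mem_symPart {i : ZMod 2} {m : M} (hm : m ∈ SuperGroup.part i) :
    incl k M m ∈ symPart k M i := by
  rw [mem_symPart, parityCoaction, symLift_incl]
  rw [AddMonoidHom.finsetSum_apply, Finset.sum_eq_single i]
  · simp [proj_of_mem hm]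
  · intro j _ hj
    simp [proj_of_mem_ne hm hj.symm]
  · simp

theorem mul_mem_symPart {i j : ZMod 2} {s t : SymAlg k M} (hs : s ∈ symPart k M i)
    (ht : t ∈ symPart k M j) : s * t ∈ symPart k M (i + j) := by
  rw [mem_symPart] at *
  rw [map_mul, hs, ht, AddMonoidAlgebra.single_mul_single]

theorem symAlg_homog_induction {P : SymAlg k M → Prop} (hadd : ∀ s t, P s → P t → P (s + t))
    (hom : ∀ i, ∀ s ∈ symPart k M i, P s) (s : SymAlg k M) : P s := by
  have key : s ∈ AddSubgroup.closure (⋃ i, (symPart k M i : Set (SymAlg k M))) := by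
    induction s using symAlg_induction with
    | hs α =>
      induction α using homog_induction with
      | hadd a b ha hb => rw [map_add]; exact add_mem ha hb
      | hom i α hα =>
        exact AddSubgroup.subset_closure (Set.mem_iUnion.2 ⟨i, scal_mem_symPart hα⟩)
    | hi m =>
      induction m using homog_induction with
      | hadd a b ha hb => rw [map_add]; exact add_mem ha hb
      | hom i m hm =>
        exact AddSubgroup.subset_closure (Set.mem_iUnion.2 ⟨i, incl_mem_symPart hm⟩)
    | hadd a b ha hb => exact add_mem ha hb
    | hmul a b ha hb =>
      induction ha, hb using AddSubgroup.closure_induction₂ with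
      | mem a b ha hb =>
        obtain ⟨i, hi⟩ := Set.mem_iUnion.1 ha
        obtain ⟨j, hj⟩ := Set.mem_iUnion.1 hb
        exact AddSubgroup.subset_closure (Set.mem_iUnion.2 ⟨_, mul_mem_symPart hi hj⟩)
      | zero_left x hx => rw [zero_mul]; exact zero_mem _
      | zero_right x hx => rw [mul_zero]; exact zero_mem _
      | add_left x y z _ _ _ h1 h2 => rw [add_mul]; exact add_mem h1 h2
      | add_right x y z _ _ _ h1 h2 => rw [mul_add]; exact add_mem h1 h2
      | neg_left x y _ _ h => rw [neg_mul]; exact neg_mem h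
      | neg_right x y _ _ h => rw [mul_neg]; exact neg_mem h
  induction key using AddSubgroup.closure_induction with
  | mem a ha =>
    obtain ⟨i, hi⟩ := Set.mem_iUnion.1 ha
    exact hom i a hi
  | zero => exact hom 0 0 (zero_mem _)
  | add a b _ _ ha hb => exact hadd a b ha hb
  | neg a ha h =>
    have h' : ∀ a : SymAlg k M, a ∈ AddSubgroup.closure
        (⋃ i, (symPart k M i : Set (SymAlg k M))) → P a ∧ P (-a) := by
      intro a ha
      induction ha using AddSubgroup.closure_induction with
      | mem a ha =>
        obtain ⟨i, hi⟩ := Set.mem_iUnion.1 ha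
        exact ⟨hom i a hi, hom i (-a) (neg_mem hi)⟩
      | zero => rw [neg_zero]; exact ⟨hom 0 0 (zero_mem _), hom 0 0 (zero_mem _)⟩
      | add a b _ _ ha hb =>
        rw [neg_add]; exact ⟨hadd _ _ ha.1 hb.1, hadd _ _ ha.2 hb.2⟩
      | neg a _ h => rw [neg_neg]; exact h.symm
    exact (h' a ha).2

variable (k M) in
/-- The projection of the symmetric algebra to its elements of parity `i`. -/
noncomputable def symProj (i : ZMod 2) : SymAlg k M →+ SymAlg k M :=
  AddMonoidHom.mk' (fun s => (parityCoaction k M s).coeff i) (by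
    intro a b; rw [map_add, AddMonoidAlgebra.coeff_add, Finsupp.add_apply])

theorem symProj_of_mem {i j : ZMod 2} {s : SymAlg k M} (hs : s ∈ symPart k M i) :
    symProj k M j s = if i = j then s else 0 := by
  show (parityCoaction k M s).coeff j = _
  rw [mem_symPart.1 hs, AddMonoidAlgebra.coeff_single, Finsupp.single_apply]

noncomputable instance : SuperGroup (SymAlg k M) :=
  SuperGroup.ofProj (symPart k M) (symProj k M)
    (by
      intro i s
      induction s using symAlg_homog_induction with
      | hadd a b ha hb => rw [map_add]; exact add_mem ha hb
      | hom j s hs =>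
        rw [symProj_of_mem hs]
        split_ifs with h
        · exact h ▸ hs
        · exact zero_mem _)
    (fun i s hs => by rw [symProj_of_mem hs, if_pos rfl])
    (fun i j hij s hs => by rw [symProj_of_mem hs, if_neg hij])
    (by
      intro s
      induction s using symAlg_homog_induction with
      | hadd a b ha hb => simp only [map_add, Finset.sum_add_distrib, ha, hb]
      | hom j s hs => simp [symProj_of_mem hs])

theorem scal_mem {i : ZMod 2} {α : k} (hα : α ∈ SuperGroup.part i) :
    scal k M α ∈ SuperGroup.part i := scal_mem_symPart hα

theorem incl_mem {i : ZMod 2} {m : M} (hm : m ∈ SuperGroup.part i) :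
    incl k M m ∈ SuperGroup.part i := incl_mem_symPart hm

theorem sym_mul_mem {i j : ZMod 2} {s t : SymAlg k M} (hs : s ∈ SuperGroup.part i)
    (ht : t ∈ SuperGroup.part j) : s * t ∈ SuperGroup.part (i + j) := mul_mem_symPart hs ht

instance : SuperModule k (SymAlg k M) where
  smul_mem hs hα := mul_mem_symPart hs (scal_mem_symPart hα)

theorem scal_mul_homog {i j : ZMod 2} {α : k} {s : SymAlg k M} (hα : α ∈ SuperGroup.part i)
    (hs : s ∈ SuperGroup.part j) : scal k M α * s = sgn i j • (s * scal k M α) := by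
  let T : SymAlg k M →+ SymAlg k M := ∑ j, sgn i j • proj j
  have hT : ∀ {l : ZMod 2} {c : SymAlg k M}, c ∈ SuperGroup.part l → T c = sgn i l • c := by
    intro l c hc
    rw [AddMonoidHom.finsetSum_apply, Finset.sum_eq_single l]
    · rw [AddMonoidHom.smul_apply, proj_of_mem hc]
    · intro a _ ha
      rw [AddMonoidHom.smul_apply, proj_of_mem_ne hc ha.symm, smul_zero]
    · simp
  have hTmul : ∀ a b, T (a * b) = T a * T b := by
    intro a b
    induction a using homog_induction with
    | hadd a b ha hb => rw [add_mul, map_add, map_add, add_mul, ha, hb]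
    | hom l a ha =>
    induction b using homog_induction with
    | hadd a b ha hb => rw [mul_add, map_add, map_add, mul_add, ha, hb]
    | hom j b hb =>
    rw [hT ha, hT hb, hT (sym_mul_mem ha hb), sgn_add_right, smul_mul_smul_comm]
  have key : ∀ s : SymAlg k M, scal k M α * s = T s * scal k M α := by
    intro s
    induction s using symAlg_induction with
    | hs β =>
      induction β using homog_induction with
      | hadd a b ha hb => rw [map_add, map_add, mul_add, add_mul, ha, hb]
      | hom l β hβ =>
      rw [hT (scal_mem hβ), smul_mul_assoc, ← map_mul, ← map_mul, CommSuperRing.mul_comm hα hβ,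
        map_zsmul]
    | hi m =>
      induction m using homog_induction with
      | hadd a b ha hb => rw [map_add, map_add, mul_add, add_mul, ha, hb]
      | hom l m hm =>
      rw [hT (incl_mem hm), smul_mul_assoc, incl_mul_scal hm hα, sgn_comm, sgn_smul_smul]
    | hadd a b ha hb => rw [map_add, mul_add, add_mul, ha, hb]
    | hmul a b ha hb => rw [← mul_assoc, ha, mul_assoc, hb, hTmul, mul_assoc]
  rw [key s, hT hs, smul_mul_assoc]

/-- Left multiplication `Y^L` in the symmetric algebra. -/
noncomputable def symLeft (s : SymAlg k M) : SymAlg k M →ₗ[kᵐᵒᵖ] SymAlg k M where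
  toFun t := s * t
  map_add' := mul_add s
  map_smul' α t := (mul_assoc s t (scal k M α.unop)).symm

theorem symLeft_apply (s t : SymAlg k M) : symLeft s t = s * t := rfl

theorem symLeft_mem {i : ZMod 2} {s : SymAlg k M} (hs : s ∈ SuperGroup.part i) :
    symLeft s ∈ SuperGroup.part i := fun _ _ ht => sym_mul_mem hs ht

theorem id_mem : (LinearMap.id : SymAlg k M →ₗ[kᵐᵒᵖ] SymAlg k M) ∈ SuperGroup.part 0 :=
  fun j m hm => by rw [zero_add]; exact hm

/-- `(s ⊗ 1) z` for `z ∈ S(M) ⊗ S(M)`. -/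
noncomputable def mulLeft₁ (s : SymAlg k M) :
    STensor k (SymAlg k M) (SymAlg k M) →ₗ[kᵐᵒᵖ] STensor k (SymAlg k M) (SymAlg k M) :=
  tmap (symLeft s) LinearMap.id

/-- `(1 ⊗ s) z` for `z ∈ S(M) ⊗ S(M)`. -/
noncomputable def mulLeft₂ (s : SymAlg k M) :
    STensor k (SymAlg k M) (SymAlg k M) →ₗ[kᵐᵒᵖ] STensor k (SymAlg k M) (SymAlg k M) :=
  tmap LinearMap.id (symLeft s)

theorem sgn_zero_left (j : ZMod 2) : sgn 0 j = 1 := by revert j; decide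

theorem mulLeft₁_tm (s v w : SymAlg k M) : mulLeft₁ s (tm k v w) = tm k (s * v) w := by
  induction v using homog_induction with
  | hadd a b ha hb =>
    simp only [tm, map_add, AddMonoidHom.add_apply, mul_add] at *
    rw [ha, hb]
  | hom j v hv =>
  rw [mulLeft₁, tmap_homog _ id_mem hv, sgn_zero_left, one_smul]; rfl

theorem mulLeft₂_tm {i j : ZMod 2} {s v : SymAlg k M} (hs : s ∈ SuperGroup.part i)
    (hv : v ∈ SuperGroup.part j) (w : SymAlg k M) :
    mulLeft₂ s (tm k v w) = sgn i j • tm k v (s * w) := by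
  rw [mulLeft₂, tmap_homog _ (symLeft_mem hs) hv]; rfl

theorem tensor_homog_ext {Q : Type*} [AddCommGroup Q]
    {f g : STensor k (SymAlg k M) (SymAlg k M) → Q}
    (hf : ∀ x y, f (x + y) = f x + f y) (hg : ∀ x y, g (x + y) = g x + g y)
    (h : ∀ i j (v w : SymAlg k M), v ∈ SuperGroup.part i → w ∈ SuperGroup.part j →
      f (tm k v w) = g (tm k v w)) (z : STensor k (SymAlg k M) (SymAlg k M)) : f z = g z := by
  have : AddMonoidHom.mk' f hf = AddMonoidHom.mk' g hg := by
    refine tensor_hom_ext fun v w => ?_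
    induction v using homog_induction with
    | hadd a b ha hb =>
      simp only [tm, map_add, AddMonoidHom.add_apply] at *
      rw [ha, hb]
    | hom i v hv =>
    induction w using homog_induction with
    | hadd a b ha hb =>
      simp only [tm, map_add] at *
      rw [ha, hb]
    | hom j w hw => exact h i j v w hv hw
  exact DFunLike.congr_fun this z

theorem mulLeft₂_add (s t : SymAlg k M) : mulLeft₂ (s + t) = mulLeft₂ s + mulLeft₂ t := by
  have h : symLeft (s + t) = symLeft s + symLeft t := by ext x; exact add_mul s t x
  ext z
  refine tensor_homog_ext (f := fun z => mulLeft₂ (s + t) z)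
    (g := fun z => mulLeft₂ s z + mulLeft₂ t z) (by simp) (fun x y => ?_) ?_ z
  · simp only [map_add]; abel
  intro i j v w hv hw
  show tmapAux _ _ _ _ = tmapAux _ _ _ _ + tmapAux _ _ _ _
  rw [h, tmapAux_add_right]

theorem mulLeft₁_add (s t : SymAlg k M) : mulLeft₁ (s + t) = mulLeft₁ s + mulLeft₁ t := by
  ext z
  refine tensor_homog_ext (f := fun z => mulLeft₁ (s + t) z)
    (g := fun z => mulLeft₁ s z + mulLeft₁ t z) (by simp) (fun x y => ?_) ?_ z
  · simp only [map_add]; abel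
  intro i j v w hv hw
  simp only [mulLeft₁_tm, add_mul]
  simp [tm]

theorem mulLeft₁_zsmul (n : ℤ) (s : SymAlg k M) (z : STensor k (SymAlg k M) (SymAlg k M)) :
    mulLeft₁ (n • s) z = n • mulLeft₁ s z := by
  have h : mulLeft₁ (n • s) = n • mulLeft₁ s :=
    map_zsmul (AddMonoidHom.mk' (mulLeft₁ (k := k) (M := M)) mulLeft₁_add) n s
  rw [h]; rfl

theorem mulLeft₁_zero : mulLeft₁ (0 : SymAlg k M) = 0 :=
  map_zero (AddMonoidHom.mk' (mulLeft₁ (k := k) (M := M)) mulLeft₁_add)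

theorem mulLeft₂_zsmul (n : ℤ) (s : SymAlg k M) (z : STensor k (SymAlg k M) (SymAlg k M)) :
    mulLeft₂ (n • s) z = n • mulLeft₂ s z := by
  have h : mulLeft₂ (n • s) = n • mulLeft₂ s :=
    map_zsmul (AddMonoidHom.mk' (mulLeft₂ (k := k) (M := M)) mulLeft₂_add) n s
  rw [h]; rfl

theorem mulLeft₂_zero : mulLeft₂ (0 : SymAlg k M) = 0 :=
  map_zero (AddMonoidHom.mk' (mulLeft₂ (k := k) (M := M)) mulLeft₂_add)

theorem mulLeft₁_mul (s t : SymAlg k M) (z : STensor k (SymAlg k M) (SymAlg k M)) :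
    mulLeft₁ (s * t) z = mulLeft₁ s (mulLeft₁ t z) :=
  tensor_homog_ext (f := fun z => mulLeft₁ (s * t) z)
    (g := fun z => mulLeft₁ s (mulLeft₁ t z)) (by simp) (by simp)
    (fun i j v w _ _ => by simp only [mulLeft₁_tm, mul_assoc]) z

theorem mulLeft₂_mul (s t : SymAlg k M) (z : STensor k (SymAlg k M) (SymAlg k M)) :
    mulLeft₂ (s * t) z = mulLeft₂ s (mulLeft₂ t z) := by
  induction s using homog_induction with
  | hadd a b ha hb => rw [add_mul, mulLeft₂_add, mulLeft₂_add, LinearMap.add_apply, ha, hb]; rfl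
  | hom a s hs =>
  induction t using homog_induction with
  | hadd a b ha hb =>
    rw [mul_add, mulLeft₂_add, mulLeft₂_add, LinearMap.add_apply, ha, hb, LinearMap.add_apply,
      map_add]
  | hom b t ht =>
  refine tensor_homog_ext (f := fun z => mulLeft₂ (s * t) z)
    (g := fun z => mulLeft₂ s (mulLeft₂ t z)) (by simp) (by simp) ?_ z
  intro i j v w hv hw
  show mulLeft₂ (s * t) (tm k v w) = mulLeft₂ s (mulLeft₂ t (tm k v w))
  rw [mulLeft₂_tm (sym_mul_mem hs ht) hv, mulLeft₂_tm ht hv, map_zsmul, mulLeft₂_tm hs hv,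
    sgn_add_left, smul_smul, mul_assoc, mul_comm (sgn a i)]

theorem mulLeft₂_mulLeft₁ {i j : ZMod 2} {s t : SymAlg k M} (hs : s ∈ SuperGroup.part i)
    (ht : t ∈ SuperGroup.part j) (z : STensor k (SymAlg k M) (SymAlg k M)) :
    mulLeft₂ s (mulLeft₁ t z) = sgn i j • mulLeft₁ t (mulLeft₂ s z) := by
  refine tensor_homog_ext (f := fun z => mulLeft₂ s (mulLeft₁ t z))
    (g := fun z => sgn i j • mulLeft₁ t (mulLeft₂ s z)) (by simp) (by simp) ?_ z
  intro a b v w hv hw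
  show mulLeft₂ s (mulLeft₁ t (tm k v w)) = sgn i j • mulLeft₁ t (mulLeft₂ s (tm k v w))
  rw [mulLeft₁_tm, mulLeft₂_tm hs (sym_mul_mem ht hv), mulLeft₂_tm hs hv, map_zsmul, mulLeft₁_tm,
    sgn_add_right, smul_smul]

theorem mulLeft₂_scal (α : k) (z : STensor k (SymAlg k M) (SymAlg k M)) :
    mulLeft₂ (scal k M α) z = mulLeft₁ (scal k M α) z := by
  induction α using homog_induction with
  | hadd a b ha hb =>
    rw [map_add, mulLeft₂_add, mulLeft₁_add, LinearMap.add_apply, LinearMap.add_apply, ha, hb]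
  | hom l α hα =>
  refine tensor_homog_ext (f := fun z => mulLeft₂ (scal k M α) z)
    (g := fun z => mulLeft₁ (scal k M α) z) (by simp) (by simp) ?_ z
  intro i j v w hv hw
  show mulLeft₂ _ (tm k v w) = mulLeft₁ _ (tm k v w)
  rw [mulLeft₂_tm (scal_mem hα) hv, mulLeft₁_tm, scal_mul_homog hα hw, scal_mul_homog hα hv]
  have h : tm k v (w * scal k M α) = sgn j l • tm k (v * scal k M α) w := tm_smul v hw hα
  simp only [tm, map_zsmul, AddMonoidHom.smul_apply] at *
  rw [h, sgn_comm j l, sgn_smul_smul]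

variable (k M) in
/-- The algebra morphism from `S(M)` to the endomorphisms of `S(M) ⊗ S(M)` under which `m ∈ M`
acts as left multiplication by `m ⊗ 1 + 1 ⊗ m`. -/
noncomputable def comulAction :
    SymAlg k M →+* Module.End kᵐᵒᵖ (STensor k (SymAlg k M) (SymAlg k M)) :=
  symLift
    { toFun := fun α => mulLeft₁ (scal k M α)
      map_one' := LinearMap.toAddMonoidHom_injective (tensor_hom_ext fun v w => by
        show mulLeft₁ (scal k M 1) (tm k v w) = tm k v w
        rw [mulLeft₁_tm, map_one, one_mul])
      map_mul' := fun α β => LinearMap.ext fun z => by rw [map_mul]; exact mulLeft₁_mul _ _ z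
      map_zero' := LinearMap.toAddMonoidHom_injective (tensor_hom_ext fun v w => by
        show mulLeft₁ (scal k M 0) (tm k v w) = 0
        rw [mulLeft₁_tm, map_zero, zero_mul]; simp [tm])
      map_add' := fun α β => by rw [map_add]; exact mulLeft₁_add _ _ }
    (AddMonoidHom.mk' (fun m => mulLeft₁ (incl k M m) + mulLeft₂ (incl k M m)) (by
      intro a b; rw [map_add, mulLeft₁_add, mulLeft₂_add]; abel))
    (by
      intro m α
      refine LinearMap.ext fun z => ?_
      show mulLeft₁ (incl k M (m <• α)) z + mulLeft₂ (incl k M (m <• α)) z =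
        mulLeft₁ (incl k M m) (mulLeft₁ (scal k M α) z) +
          mulLeft₂ (incl k M m) (mulLeft₁ (scal k M α) z)
      rw [incl_smul, mulLeft₁_mul, mulLeft₂_mul, mulLeft₂_scal])
    (by
      intro i j m α hm hα
      refine LinearMap.ext fun z => ?_
      show mulLeft₁ (incl k M m) (mulLeft₁ (scal k M α) z) +
          mulLeft₂ (incl k M m) (mulLeft₁ (scal k M α) z) =
        sgn i j • mulLeft₁ (scal k M α) (mulLeft₁ (incl k M m) z + mulLeft₂ (incl k M m) z)
      have h : mulLeft₁ (sgn i j • (scal k M α * incl k M m)) z =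
          sgn i j • mulLeft₁ (scal k M α * incl k M m) z :=
        mulLeft₁_zsmul _ _ z
      rw [mulLeft₂_mulLeft₁ (incl_mem hm) (scal_mem hα), map_add, smul_add, ← mulLeft₁_mul,
        ← mulLeft₁_mul, incl_mul_scal hm hα, h])
    (by
      intro i j m n hm hn
      refine LinearMap.ext fun z => ?_
      show mulLeft₁ (incl k M m) (mulLeft₁ (incl k M n) z + mulLeft₂ (incl k M n) z) +
          mulLeft₂ (incl k M m) (mulLeft₁ (incl k M n) z + mulLeft₂ (incl k M n) z) =
        sgn i j • (mulLeft₁ (incl k M n) (mulLeft₁ (incl k M m) z + mulLeft₂ (incl k M m) z) +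
          mulLeft₂ (incl k M n) (mulLeft₁ (incl k M m) z + mulLeft₂ (incl k M m) z))
      have h₁ : mulLeft₁ (sgn i j • (incl k M n * incl k M m)) z =
          sgn i j • mulLeft₁ (incl k M n * incl k M m) z :=
        mulLeft₁_zsmul _ _ z
      have h₂ : mulLeft₂ (sgn i j • (incl k M n * incl k M m)) z =
          sgn i j • mulLeft₂ (incl k M n * incl k M m) z :=
        mulLeft₂_zsmul _ _ z
      simp only [map_add, smul_add]
      rw [mulLeft₂_mulLeft₁ (incl_mem hm) (incl_mem hn),
        mulLeft₂_mulLeft₁ (incl_mem hn) (incl_mem hm), ← mulLeft₁_mul, ← mulLeft₂_mul,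
        incl_mul_incl hm hn, h₁, h₂, mulLeft₁_mul, mulLeft₂_mul, sgn_comm j i, sgn_smul_smul]
      abel)
    (by
      intro m hm
      refine LinearMap.ext fun z => ?_
      show mulLeft₁ (incl k M m) (mulLeft₁ (incl k M m) z + mulLeft₂ (incl k M m) z) +
          mulLeft₂ (incl k M m) (mulLeft₁ (incl k M m) z + mulLeft₂ (incl k M m) z) = 0
      have h₁ : mulLeft₁ (0 : SymAlg k M) z = 0 :=
        by rw [mulLeft₁_zero]; rfl
      have h₂ : mulLeft₂ (0 : SymAlg k M) z = 0 :=
        by rw [mulLeft₂_zero]; rfl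
      rw [map_add, map_add, mulLeft₂_mulLeft₁ (incl_mem hm) (incl_mem hm), ← mulLeft₁_mul,
        ← mulLeft₂_mul, incl_mul_self hm, h₁, h₂, show sgn 1 1 = -1 by decide]
      simp)

variable (k M) in
/-- The comultiplication `Δ : S(M) → S(M) ⊗ S(M)`, the morphism of superalgebras with
`Δ m = m ⊗ 1 + 1 ⊗ m` for `m ∈ M`; see `comul_one`, `comul_scal_mul` and `comul_incl_mul`. -/
noncomputable def comul : SymAlg k M →ₗ[kᵐᵒᵖ] STensor k (SymAlg k M) (SymAlg k M) where
  toFun s := comulAction k M s (tm k 1 1)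
  map_add' s t := by rw [map_add]; rfl
  map_smul' β s := by
    obtain ⟨α, rfl⟩ := MulOpposite.op_surjective β
    show comulAction k M (s * scal k M α) (tm k 1 1) = comulAction k M s (tm k 1 1) <• α
    rw [← map_smul, map_mul, tm_rsmul, rsmul_eq_mul, one_mul]
    show comulAction k M s (comulAction k M (scal k M α) (tm k 1 1)) = _
    congr 1
    rw [comulAction, symLift_scal]
    show mulLeft₁ (scal k M α) (tm k 1 1) = _
    rw [← mulLeft₂_scal]
    induction α using homog_induction with
    | hadd a b ha hb =>
      rw [map_add, mulLeft₂_add, LinearMap.add_apply, ha, hb]; simp [tm]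
    | hom l α hα =>
    rw [mulLeft₂_tm (j := 0) (scal_mem hα), mul_one, sgn_comm, sgn_zero_left, one_smul]
    rw [← map_one (scal k M)]
    exact scal_mem CommSuperRing.one_mem

theorem comul_one : comul k M 1 = tm k 1 1 := by
  show comulAction k M 1 (tm k 1 1) = _
  rw [map_one]; rfl

theorem comul_scal_mul (α : k) (s : SymAlg k M) :
    comul k M (scal k M α * s) = mulLeft₁ (scal k M α) (comul k M s) := by
  show comulAction k M _ (tm k 1 1) = _
  rw [map_mul]
  show comulAction k M (scal k M α) (comul k M s) = _
  rw [comulAction, symLift_scal]; rfl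

theorem comul_incl_mul (m : M) (s : SymAlg k M) :
    comul k M (incl k M m * s) =
      mulLeft₁ (incl k M m) (comul k M s) + mulLeft₂ (incl k M m) (comul k M s) := by
  show comulAction k M _ (tm k 1 1) = _
  rw [map_mul]
  show comulAction k M (incl k M m) (comul k M s) = _
  rw [comulAction, symLift_incl]; rfl

variable (k M) in
/-- The counit `ε : S(M) → k`. -/
noncomputable def counit : SymAlg k M →+* k :=
  symLift (RingHom.id k) 0 (by simp) (by simp) (by simp) (by simp)

theorem counit_scal (α : k) : counit k M (scal k M α) = α := symLift_scal _ _ _ _ _ _ _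

theorem counit_incl (m : M) : counit k M (incl k M m) = 0 := symLift_incl _ _ _ _ _ _ _

variable (k M) in
/-- The inclusion `M → S(M)`, as a morphism of modules. -/
noncomputable def inclHom : M →ₗ[kᵐᵒᵖ] SymAlg k M where
  toFun := incl k M
  map_add' := map_add _
  map_smul' α m := incl_smul m α.unop

variable (k M) in
/-- The multiplication `S(M) ⊗ S(M) → S(M)`. -/
noncomputable def symMult : STensor k (SymAlg k M) (SymAlg k M) →ₗ[kᵐᵒᵖ] SymAlg k M :=
  { tlift (AddMonoidHom.mul (R := SymAlg k M)) (by
      intro i j s t α ht hα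
      show s * (t * scal k M α) = sgn i j • (s * scal k M α * t)
      rw [mul_assoc, scal_mul_homog hα ht, mul_smul_comm, sgn_comm j i, sgn_smul_smul]) with
    map_smul' := by
      intro β x
      obtain ⟨α, rfl⟩ := MulOpposite.op_surjective β
      show tlift _ _ (x <• α) = tlift _ _ x <• α
      induction x using tensor_induction with
      | hz => simp
      | hadd x y hx hy => rw [smul_add, map_add, hx, hy, map_add, smul_add]
      | ht m n => exact (mul_assoc m n (scal k M α)).symm }

theorem symMult_tm (s t : SymAlg k M) : symMult k M (tm k s t) = s * t := rfl

/-- The product `F * G = mult ∘ (F ⊗ G) ∘ Δ` of `Hom(S(M), S(M))`. -/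
noncomputable def conv (F G : SymAlg k M →ₗ[kᵐᵒᵖ] SymAlg k M) : SymAlg k M →ₗ[kᵐᵒᵖ] SymAlg k M :=
  symMult k M ∘ₗ tmap F G ∘ₗ comul k M

/-- Coderivations of `S(M)`: `Δ ∘ F = (F ⊗ id + id ⊗ F) ∘ Δ`. -/
def IsCoderivation (F : SymAlg k M →ₗ[kᵐᵒᵖ] SymAlg k M) : Prop :=
  comul k M ∘ₗ F = (tmap F LinearMap.id + tmap LinearMap.id F) ∘ₗ comul k M

variable (k M) in
/-- The coaction `s ↦ ∑ n, s_n T^n` of the grading `S(M) = ⨁ S^n(M)`, determined by the values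
`α` on scalars and `m T` on elements of `M`. -/
noncomputable def degCoaction : SymAlg k M →+* Polynomial (SymAlg k M) :=
  symLift (Polynomial.C.comp (scal k M))
    ((Polynomial.monomial 1).toAddMonoidHom.comp (incl k M))
    (by
      intro m α
      simp [incl_smul, Polynomial.monomial_mul_C])
    (by
      intro i j m α hm hα
      show Polynomial.monomial 1 (incl k M m) * Polynomial.C (scal k M α) =
        sgn i j • (Polynomial.C (scal k M α) * Polynomial.monomial 1 (incl k M m))
      rw [Polynomial.monomial_mul_C, Polynomial.C_mul_monomial, incl_mul_scal hm hα, map_zsmul])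
    (by
      intro i j m n hm hn
      show Polynomial.monomial 1 (incl k M m) * Polynomial.monomial 1 (incl k M n) =
        sgn i j • (Polynomial.monomial 1 (incl k M n) * Polynomial.monomial 1 (incl k M m))
      rw [Polynomial.monomial_mul_monomial, Polynomial.monomial_mul_monomial,
        incl_mul_incl hm hn, map_zsmul])
    (by
      intro m hm
      simp [Polynomial.monomial_mul_monomial, incl_mul_self hm])

theorem degCoaction_scal (α : k) :
    degCoaction k M (scal k M α) = Polynomial.C (scal k M α) := symLift_scal _ _ _ _ _ _ _

theorem degCoaction_incl (m : M) :
    degCoaction k M (incl k M m) = Polynomial.monomial 1 (incl k M m) :=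
  symLift_incl _ _ _ _ _ _ _

/-- A product of `n` elements of `M` and a scalar is homogeneous of degree `n`. -/
theorem degCoaction_prod (l : List M) (α : k) :
    degCoaction k M ((l.map (incl k M)).prod * scal k M α) =
      Polynomial.monomial l.length ((l.map (incl k M)).prod * scal k M α) := by
  induction l with
  | nil => simp [degCoaction_scal]
  | cons m l ih =>
    rw [List.map_cons, List.prod_cons, mul_assoc, map_mul, ih, degCoaction_incl,
      Polynomial.monomial_mul_monomial, List.length_cons, add_comm]

variable (k M) in
/-- The algebra morphism from `S(M)` to the endomorphisms of `k × M` under which `m ∈ M` acts by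
`(β, n) ↦ (0, m β)` and `α ∈ k` by left multiplication. -/
noncomputable def pointAction : SymAlg k M →+* Module.End kᵐᵒᵖ (k × M) :=
  symLift
    { toFun := fun α =>
        { toFun := fun p => (α * p.1, leftMul k M α p.2)
          map_add' := fun p q => by simp [mul_add]
          map_smul' := fun β p => by
            obtain ⟨γ, rfl⟩ := MulOpposite.op_surjective β
            exact Prod.ext (mul_assoc _ _ _).symm (leftMul_smul _ _ _) }
      map_one' := by
        refine LinearMap.ext fun p => Prod.ext (one_mul _) (one_leftMul _)
      map_mul' := fun α β => by
        refine LinearMap.ext fun p => Prod.ext (mul_assoc _ _ _) (mul_leftMul _ _ _)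
      map_zero' := by
        refine LinearMap.ext fun p => Prod.ext (zero_mul _) ?_
        show leftMul k M 0 p.2 = 0
        rw [map_zero]; rfl
      map_add' := fun α β => by
        refine LinearMap.ext fun p => Prod.ext (add_mul _ _ _) ?_
        show leftMul k M (α + β) p.2 = leftMul k M α p.2 + leftMul k M β p.2
        rw [map_add]; rfl }
    (AddMonoidHom.mk' (fun m =>
        { toFun := fun p => (0, m <• p.1)
          map_add' := fun p q => by
            refine Prod.ext (add_zero _).symm ?_
            show m <• (p.1 + q.1) = m <• p.1 + m <• q.1
            rw [MulOpposite.op_add, add_smul]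
          map_smul' := fun β p => by
            obtain ⟨γ, rfl⟩ := MulOpposite.op_surjective β
            refine Prod.ext (smul_zero _).symm ?_
            show m <• (p.1 * γ) = m <• p.1 <• γ
            rw [op_smul_op_smul] })
      (fun m n => by
        refine LinearMap.ext fun p => Prod.ext (add_zero _).symm ?_
        exact smul_add _ _ _))
    (by
      intro m α
      refine LinearMap.ext fun p => Prod.ext rfl ?_
      show m <• α <• p.1 = m <• (α * p.1)
      rw [op_smul_op_smul])
    (by
      intro i j m α hm hα
      refine LinearMap.ext fun p => Prod.ext ?_ ?_
      · show (0 : k) = sgn i j • (α * 0)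
        simp
      · show m <• (α * p.1) = sgn i j • leftMul k M α (m <• p.1)
        rw [leftMul_smul, leftMul_homog hα hm, sgn_smul_rsmul, sgn_comm j i, sgn_smul_smul,
          op_smul_op_smul])
    (by
      intro i j m n hm hn
      refine LinearMap.ext fun p => Prod.ext ?_ ?_
      · show (0 : k) = sgn i j • 0
        simp
      · show m <• (0 : k) = sgn i j • (n <• (0 : k))
        simp)
    (by
      intro m hm
      refine LinearMap.ext fun p => Prod.ext rfl ?_
      show m <• (0 : k) = 0
      simp)

variable (k M) in
/-- The generic point `x : S(M) → M`: the identity on `S¹(M) = M`, and zero on `Sⁿ(M)`, `n ≠ 1`. -/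
noncomputable def genericPoint : SymAlg k M →ₗ[kᵐᵒᵖ] M where
  toFun s := (pointAction k M s (1, 0)).2
  map_add' s t := by rw [map_add]; rfl
  map_smul' β s := by
    obtain ⟨α, rfl⟩ := MulOpposite.op_surjective β
    show (pointAction k M (s * scal k M α) (1, 0)).2 = (pointAction k M s (1, 0)).2 <• α
    rw [map_mul]
    show (pointAction k M s (pointAction k M (scal k M α) (1, 0))).2 = _
    have h : pointAction k M (scal k M α) (1, 0) = ((1, 0) : k × M) <• α := by
      rw [pointAction, symLift_scal]
      refine Prod.ext ?_ ?_
      · show α * 1 = 1 * α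
        rw [mul_one, one_mul]
      · show leftMul k M α 0 = (0 : M) <• α
        rw [map_zero, smul_zero]
    rw [h, map_smul]; rfl

theorem genericPoint_scal (α : k) : genericPoint k M (scal k M α) = 0 := by
  show (pointAction k M (scal k M α) (1, 0)).2 = 0
  rw [pointAction, symLift_scal]
  show leftMul k M α 0 = 0
  rw [map_zero]

theorem genericPoint_incl (m : M) : genericPoint k M (incl k M m) = m := by
  show (pointAction k M (incl k M m) (1, 0)).2 = m
  rw [pointAction, symLift_incl]
  show m <• (1 : k) = m
  simp

theorem genericPoint_mul (m n : M) (s : SymAlg k M) :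
    genericPoint k M (incl k M m * (incl k M n * s)) = 0 := by
  show (pointAction k M _ (1, 0)).2 = 0
  rw [map_mul, map_mul]
  show (pointAction k M (incl k M m) (pointAction k M (incl k M n)
    (pointAction k M s (1, 0)))).2 = 0
  rw [pointAction, symLift_incl, symLift_incl]
  show m <• (0 : k) = 0
  simp

variable (k) in
/-- The constant function `S(M) → N` attached to `a ∈ N`: `1 ↦ a` and `Sⁿ(M) ↦ 0` for `n ≠ 0`. -/
noncomputable def constHom {N : Type*} [AddCommGroup N] [Module kᵐᵒᵖ N] (a : N) :
    SymAlg k M →ₗ[kᵐᵒᵖ] N where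
  toFun s := a <• counit k M s
  map_add' s t := by rw [map_add, MulOpposite.op_add, add_smul]
  map_smul' β s := by
    obtain ⟨α, rfl⟩ := MulOpposite.op_surjective β
    show a <• counit k M (s * scal k M α) = a <• counit k M s <• α
    rw [map_mul, counit_scal, op_smul_op_smul]

end SymAlg

section Lie

variable (k : Type*) [Ring k] [SuperGroup k] [CommSuperRing k]
  (g : Type*) [AddCommGroup g] [Module kᵐᵒᵖ g] [SuperGroup g] [Bracket g g] [LieSuperalgebra k g]

/-- The Lie bracket as a morphism of modules `g ⊗ g → g`. -/
noncomputable def lieHom : STensor k g g →ₗ[kᵐᵒᵖ] g :=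
  { tlift (AddMonoidHom.mk' (fun a : g => AddMonoidHom.mk' (fun b : g => ⁅a, b⁆)
        (LieSuperalgebra.lie_add k a))
      (fun a b => AddMonoidHom.ext fun c => LieSuperalgebra.add_lie k a b c)) (by
      intro i j a b α hb hα
      show ⁅a, b <• α⁆ = sgn i j • ⁅a <• α, b⁆
      rw [← LieSuperalgebra.lie_smul, LieSuperalgebra.smul_lie a hb hα]) with
    map_smul' := by
      intro β x
      obtain ⟨α, rfl⟩ := MulOpposite.op_surjective β
      show tlift _ _ (x <• α) = tlift _ _ x <• α
      induction x using tensor_induction with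
      | hz => simp
      | hadd x y hx hy => rw [smul_add, map_add, hx, hy, map_add, smul_add]
      | ht a b => exact (LieSuperalgebra.lie_smul a b α).symm }

theorem lieHom_tm (a b : g) : lieHom k g (tm k a b) = ⁅a, b⁆ := rfl

variable {k g}

/-- The bracket `[F, G] = [·,·] ∘ (F ⊗ G) ∘ Δ` of formal vector fields `F, G : S(g) → g`. -/
noncomputable def fieldBracket (F G : SymAlg k g →ₗ[kᵐᵒᵖ] g) : SymAlg k g →ₗ[kᵐᵒᵖ] g :=
  lieHom k g ∘ₗ tmap F G ∘ₗ comul k g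

/-- `(ad x)^n (a)`, where `x` is the generic point of `g`. -/
noncomputable def adPow (n : ℕ) (a : g) : SymAlg k g →ₗ[kᵐᵒᵖ] g :=
  (fieldBracket (genericPoint k g))^[n] (constHom k a)

/-- The map `∑ n, s_n T^n ↦ ∑ n, c_n ((ad x)^n (a)) (s_n)`, where `φ = ∑ c_n t^n`. -/
noncomputable def fieldAux (φ : PowerSeries k) (a : g) : Polynomial (SymAlg k g) →+ g :=
  AddMonoidHom.mk'
    (fun p => p.sum fun n t => leftMul k g (PowerSeries.coeff n φ) (adPow n a t))
    (fun p q => Polynomial.sum_add_index p q _ (fun n => by simp) (fun n x y => by simp))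

theorem fieldAux_monomial (φ : PowerSeries k) (a : g) (n : ℕ) (t : SymAlg k g) :
    fieldAux φ a (Polynomial.monomial n t) =
      leftMul k g (PowerSeries.coeff n φ) (adPow n a t) := by
  show Polynomial.sum (Polynomial.monomial n t)
    (fun n t => leftMul k g (PowerSeries.coeff n φ) (adPow n a t)) = _
  rw [Polynomial.sum_monomial_index _ _ (by simp)]

theorem fieldAux_mul_C (φ : PowerSeries k) (a : g) (p : Polynomial (SymAlg k g)) (α : k) :
    fieldAux φ a (p * Polynomial.C (scal k g α)) = fieldAux φ a p <• α := by
  induction p using Polynomial.induction_on' with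
  | add p q hp hq => rw [add_mul, map_add, map_add, hp, hq, smul_add]
  | monomial n t =>
    rw [Polynomial.monomial_mul_C, fieldAux_monomial, fieldAux_monomial, ← leftMul_smul,
      ← map_smul]
    rfl

/-- The formal vector field `φ^a = φ(ad x)(a)`, `φ = ∑ c_n t^n`: its restriction to `S^n(g)` is
`c_n (ad x)^n (a)`. -/
noncomputable def field (φ : PowerSeries k) (a : g) : SymAlg k g →ₗ[kᵐᵒᵖ] g where
  toFun s := fieldAux φ a (degCoaction k g s)
  map_add' s t := by rw [map_add, map_add]
  map_smul' β s := by
    obtain ⟨α, rfl⟩ := MulOpposite.op_surjective β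
    show fieldAux φ a (degCoaction k g (s * scal k g α)) = fieldAux φ a (degCoaction k g s) <• α
    rw [map_mul, degCoaction_scal, fieldAux_mul_C]

/-- The value of `φ^a` on a product of `n` elements of `g` and a scalar. -/
theorem field_prod (φ : PowerSeries k) (a : g) (l : List g) (α : k) :
    field φ a ((l.map (incl k g)).prod * scal k g α) =
      leftMul k g (PowerSeries.coeff l.length φ)
        (adPow l.length a ((l.map (incl k g)).prod * scal k g α)) := by
  show fieldAux φ a (degCoaction k g _) = _
  rw [degCoaction_prod, fieldAux_monomial]

/-- The coderivation `Φ^a = id * φ^a` of `S(g)`. -/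
noncomputable def coder (φ : PowerSeries k) (a : g) : SymAlg k g →ₗ[kᵐᵒᵖ] SymAlg k g :=
  conv LinearMap.id (inclHom k g ∘ₗ field φ a)

/-- Representations of `g` on `S(g)` by coderivations: even morphisms of modules
`ρ : g → Hom(S(g), S(g))`, compatible with the brackets, whose values are coderivations. -/
structure IsCoderivationRep (ρ : g → SymAlg k g →ₗ[kᵐᵒᵖ] SymAlg k g) : Prop where
  map_add : ∀ a b, ρ (a + b) = ρ a + ρ b
  map_smul : ∀ {i j : ZMod 2} (a : g) {α : k} {s : SymAlg k g}, s ∈ SuperGroup.part i →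
    α ∈ SuperGroup.part j → ρ (a <• α) s = sgn i j • (ρ a s <• α)
  map_mem : ∀ {i : ZMod 2} {a : g}, a ∈ SuperGroup.part i → ρ a ∈ SuperGroup.part i
  map_lie : ∀ a b, ρ ⁅a, b⁆ = superComm (ρ a) (ρ b)
  coderivation : ∀ a, IsCoderivation (ρ a)

end Lie

section Series

variable {k : Type*} [Ring k]

/-- `φ ∈ k_0[[t]]`: all the coefficients of `φ` are even. -/
def HasEvenCoeffs [SuperGroup k] (φ : PowerSeries k) : Prop :=
  ∀ n, PowerSeries.coeff n φ ∈ SuperGroup.part 0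

/-- The series `φ(t)` (for `i = 0`) or `φ(u)` (for `i = 1`) in `k[[t, u]]`. -/
noncomputable def inVar (i : Fin 2) (φ : PowerSeries k) : MvPowerSeries (Fin 2) k :=
  fun d => if d = Finsupp.single i (d i) then PowerSeries.coeff (d i) φ else 0

/-- The series `φ(t + u) = ∑ c_n (t + u)^n` in `k[[t, u]]`. -/
noncomputable def inSum (φ : PowerSeries k) : MvPowerSeries (Fin 2) k :=
  fun d => ((d 0 + d 1).choose (d 0) : k) * PowerSeries.coeff (d 0 + d 1) φ

/-- Division by the variable `i` of the series that are divisible by it. -/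
noncomputable def divVar (i : Fin 2) (f : MvPowerSeries (Fin 2) k) : MvPowerSeries (Fin 2) k :=
  fun d => MvPowerSeries.coeff (d + Finsupp.single i 1) f

theorem inVar_monomial (i : Fin 2) (n : ℕ) (c : k) :
    inVar i (PowerSeries.monomial n c) = MvPowerSeries.C c * MvPowerSeries.X i ^ n := by
  ext d
  rw [MvPowerSeries.coeff_C_mul, MvPowerSeries.coeff_X_pow]
  show (if d = Finsupp.single i (d i) then PowerSeries.coeff (d i) (PowerSeries.monomial n c)
    else 0) = _
  rw [PowerSeries.coeff_monomial]
  by_cases h : d = Finsupp.single i n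
  · subst h; simp
  · rw [if_neg h, mul_zero]
    split_ifs with h1 h2
    · exact absurd (h2 ▸ h1) h
    · rfl
    · rfl

theorem inSum_monomial (n : ℕ) (c : k) :
    inSum (PowerSeries.monomial n c) =
      MvPowerSeries.C c * (MvPowerSeries.X 0 + MvPowerSeries.X 1) ^ n := by
  ext d
  rw [MvPowerSeries.coeff_C_mul, (MvPowerSeries.commute_X _ _).add_pow, map_sum]
  show ((d 0 + d 1).choose (d 0) : k) * PowerSeries.coeff (d 0 + d 1) (PowerSeries.monomial n c) = _
  have hd : ∀ a b : ℕ, d = Finsupp.single 0 a + Finsupp.single 1 b ↔ d 0 = a ∧ d 1 = b := by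
    intro a b
    constructor
    · rintro rfl; simp
    · rintro ⟨rfl, rfl⟩; ext i; fin_cases i <;> simp
  have key : ∀ m, MvPowerSeries.coeff d ((MvPowerSeries.X 0 : MvPowerSeries (Fin 2) k) ^ m *
      MvPowerSeries.X 1 ^ (n - m) * (n.choose m : MvPowerSeries (Fin 2) k)) =
      if d 0 = m ∧ d 1 = n - m then (n.choose m : k) else 0 := by
    intro m
    rw [← map_natCast (MvPowerSeries.C (σ := Fin 2) (R := k)), MvPowerSeries.coeff_mul_C,
      MvPowerSeries.X_pow_eq, MvPowerSeries.X_pow_eq, MvPowerSeries.monomial_mul_monomial,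
      MvPowerSeries.coeff_monomial]
    simp only [hd, mul_one, ite_mul, one_mul, zero_mul]
  simp only [key]
  rw [PowerSeries.coeff_monomial]
  by_cases h : d 0 + d 1 = n
  · rw [if_pos h, Finset.sum_eq_single (d 0), if_pos ⟨rfl, by omega⟩, h]
    · exact Nat.cast_commute _ _
    · intro b _ hb
      rw [if_neg (fun h => hb h.1.symm)]
    · intro h'; simp at h'; omega
  · rw [if_neg h, mul_zero, Finset.sum_eq_zero, mul_zero]
    intro m hm
    rw [if_neg]
    rintro ⟨h1, h2⟩
    simp at hm
    omega

theorem X_mul_divVar (i : Fin 2) (f : MvPowerSeries (Fin 2) k)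
    (hf : ∀ d : Fin 2 →₀ ℕ, d i = 0 → MvPowerSeries.coeff d f = 0) :
    MvPowerSeries.X i * divVar i f = f := by
  classical
  ext d
  rw [MvPowerSeries.X, MvPowerSeries.coeff_monomial_mul, one_mul]
  split_ifs with h
  · show MvPowerSeries.coeff (d - Finsupp.single i 1 + Finsupp.single i 1) f = _
    rw [tsub_add_cancel_of_le h]
  · refine (hf d ?_).symm
    by_contra h'
    exact h (Finsupp.single_le_iff.2 (Nat.one_le_iff_ne_zero.2 h'))

theorem X_mul_divVar_one (φ : PowerSeries k) :
    MvPowerSeries.X 1 * divVar 1 (inSum φ - inVar 0 φ) = inSum φ - inVar 0 φ := by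
  refine X_mul_divVar _ _ fun d hd => ?_
  have h : d = Finsupp.single 0 (d 0) := by ext i; fin_cases i <;> simp [hd]
  show ((d 0 + d 1).choose (d 0) : k) * PowerSeries.coeff (d 0 + d 1) φ -
    (if d = Finsupp.single 0 (d 0) then PowerSeries.coeff (d 0) φ else 0) = 0
  rw [if_pos h, hd]; simp

theorem X_mul_divVar_zero (φ : PowerSeries k) :
    MvPowerSeries.X 0 * divVar 0 (inSum φ - inVar 1 φ) = inSum φ - inVar 1 φ := by
  refine X_mul_divVar _ _ fun d hd => ?_
  have h : d = Finsupp.single 1 (d 1) := by ext i; fin_cases i <;> simp [hd]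
  show ((d 0 + d 1).choose (d 0) : k) * PowerSeries.coeff (d 0 + d 1) φ -
    (if d = Finsupp.single 1 (d 1) then PowerSeries.coeff (d 1) φ else 0) = 0
  rw [if_pos h, hd]; simp

/-- The functional equation
`-((φ(t + u) - φ(t)) / u) ψ(u) - φ(t) ((ψ(t + u) - ψ(u)) / t) = χ(t + u)` in `k[[t, u]]`. -/
def FunctionalEq (φ ψ χ : PowerSeries k) : Prop :=
  -(divVar 1 (inSum φ - inVar 0 φ) * inVar 1 ψ) -
    inVar 0 φ * divVar 0 (inSum ψ - inVar 1 ψ) = inSum χ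

end Series

end SuperSym

namespace SuperSym

open scoped RightActions TensorProduct DirectSum

/-! A formal vector field `h : S(M) → M` and the coderivation `coderOf h = id * h` determine each
other: the projection `genericPoint` onto `M` recovers `h` (`genericPoint_comp_coderOf`).
Precomposition with `coderOf h` is the derivative along `h`, and the supercommutator of two such
coderivations is attached to the commutator of the two vector fields (`superComm_coderOf`). The
identity `[Φ^a, Ψ^b] = Λ^[a,b]` is therefore an identity between vector fields.

The bracket of vector fields inherits skew-symmetry and the Jacobi identity from `g`. The derivative
along `h` is a derivation of this bracket, kills constants and sends the generic point `x` to `h`.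
Induction on `p` then gives the derivative of `(ad x)^p (a)` along `h` as `-∑_{r<p} C(p,r) [(ad x)^r
a, (ad x)^(p-1-r) h]` (`adPow_comp_coderOf`). Inserting the terms of `ψ^b` for `h`, and
symmetrically those of `φ^a`, the coefficient of `[(ad x)^p a, (ad x)^q b]` in the commutator is
that of `t^p u^q` in the left side of the functional equation, except that the coefficients of `ψ`
have to pass `a` and pick up a sign (`twist`). By the Leibniz rule the coefficient in `λ^[a,b]` is
that of `t^p u^q` in `λ(t + u)` (`field_lie`). The comparison is `superComm_coder_eq_iff`, and it
shows that the functional equation suffices.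

For the converse, each pair `(p, q)` has to be isolated. In the Lie superalgebra of matrices over a
superalgebra `R`, elementary matrices along a path are inserted into the brackets, so that only
`[(ad x)^p a, (ad x)^q b]` survives and one matrix entry is `± r` times the difference of the two
coefficients, where `r ∈ R` is the entry of `a` (`feCoeff_eq_of_superComm`). The choice `r = 1`
gives the functional equation. The choice of an odd variable for `r` gives the same system with the
odd coefficients of `ψ` negated. For `φ = ψ = λ` the two systems together force the odd part of `φ`
to vanish (`odd_part_eq_zero`), which is the evenness claim of the last two parts. The coderivation
property holds for every vector field (`isCoderivation_coderOf`), so a representation by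
coderivations requires nothing more. -/

theorem sgn_zero_right (i : ZMod 2) : sgn i 0 = 1 := by rw [sgn_comm, sgn_zero_left]

theorem sgn_one_one : sgn 1 1 = -1 := by decide

theorem parity_cases (i : ZMod 2) : i = 0 ∨ i = 1 := by revert i; decide

theorem parity_one_add_one : (1 + 1 : ZMod 2) = 0 := by decide

/-! ### Monomials of the symmetric algebra -/

section Monomials

variable {k : Type*} [Ring k] [SuperGroup k] [CommSuperRing k]
  {M : Type*} [AddCommGroup M] [Module kᵐᵒᵖ M] [SuperGroup M] [SuperModule k M]

/-- Products of `n` homogeneous elements of `M` and a homogeneous scalar, of total parity `j`. -/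
inductive IsMonomial (k : Type*) {M : Type*} [Ring k] [SuperGroup k] [CommSuperRing k]
    [AddCommGroup M] [Module kᵐᵒᵖ M] [SuperGroup M] [SuperModule k M] :
    ZMod 2 → ℕ → SymAlg k M → Prop
  | scal {j : ZMod 2} {α : k} : α ∈ SuperGroup.part j → IsMonomial k j 0 (scal k M α)
  | cons {i j : ZMod 2} {n : ℕ} {m : M} {s : SymAlg k M} : m ∈ SuperGroup.part i →
      IsMonomial k j n s → IsMonomial k (i + j) (n + 1) (incl k M m * s)

theorem IsMonomial.mem {j : ZMod 2} {n : ℕ} {s : SymAlg k M} (h : IsMonomial k j n s) :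
    s ∈ SuperGroup.part j := by
  induction h with
  | scal hα => exact scal_mem hα
  | cons hm _ ih => exact sym_mul_mem (incl_mem hm) ih

theorem IsMonomial.degCoaction {j : ZMod 2} {n : ℕ} {s : SymAlg k M} (h : IsMonomial k j n s) :
    degCoaction k M s = Polynomial.monomial n s := by
  induction h with
  | scal hα => rw [degCoaction_scal]; rfl
  | cons hm _ ih =>
    rw [map_mul, ih, degCoaction_incl, Polynomial.monomial_mul_monomial, add_comm 1]

theorem IsMonomial.mul_scal {i j : ZMod 2} {n : ℕ} {s : SymAlg k M} (h : IsMonomial k i n s)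
    {α : k} (hα : α ∈ SuperGroup.part j) : IsMonomial k (i + j) n (s * SuperSym.scal k M α) := by
  induction h with
  | scal hβ => rw [← map_mul]; exact .scal (CommSuperRing.mul_mem hβ hα)
  | cons hm _ ih => rw [mul_assoc, add_assoc]; exact .cons hm ih

theorem isMonomial_one : IsMonomial k 0 0 (1 : SymAlg k M) := by
  rw [← map_one (scal k M)]
  exact .scal CommSuperRing.one_mem

theorem isMonomial_incl {i : ZMod 2} {m : M} (hm : m ∈ SuperGroup.part i) :
    IsMonomial k i 1 (incl k M m) := by
  simpa using IsMonomial.cons hm (isMonomial_one (k := k))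

/-- The additive span of the monomials is stable under left multiplication by the generators of
`S(M)`, a scalar being moved to the right end past a homogeneous monomial. It is thus a left ideal,
and it contains `1`. -/
theorem closure_isMonomial :
    AddSubgroup.closure {s : SymAlg k M | ∃ j n, IsMonomial k j n s} = ⊤ := by
  set C := AddSubgroup.closure {s : SymAlg k M | ∃ j n, IsMonomial k j n s} with hC
  have hscal : ∀ α : k, ∀ t ∈ C, scal k M α * t ∈ C := by
    intro α t ht
    induction α using homog_induction with
    | hadd a b ha hb => rw [map_add, add_mul]; exact add_mem ha hb
    | hom i α hα =>
    induction ht using AddSubgroup.closure_induction with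
    | mem t ht =>
      obtain ⟨j, n, ht⟩ := ht
      rw [scal_mul_homog hα ht.mem]
      have h : t * scal k M α ∈ C := AddSubgroup.subset_closure ⟨_, _, ht.mul_scal hα⟩
      exact zsmul_mem h _
    | zero => rw [mul_zero]; exact zero_mem _
    | add x y _ _ hx hy => rw [mul_add]; exact add_mem hx hy
    | neg x _ hx => rw [mul_neg]; exact neg_mem hx
  have hincl : ∀ m : M, ∀ t ∈ C, incl k M m * t ∈ C := by
    intro m t ht
    induction m using homog_induction with
    | hadd a b ha hb => rw [map_add, add_mul]; exact add_mem ha hb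
    | hom i m hm =>
    induction ht using AddSubgroup.closure_induction with
    | mem t ht =>
      obtain ⟨j, n, ht⟩ := ht
      exact AddSubgroup.subset_closure ⟨_, _, .cons hm ht⟩
    | zero => rw [mul_zero]; exact zero_mem _
    | add x y _ _ hx hy => rw [mul_add]; exact add_mem hx hy
    | neg x _ hx => rw [mul_neg]; exact neg_mem hx
  have key : ∀ s : SymAlg k M, ∀ t ∈ C, s * t ∈ C := by
    intro s
    induction s using symAlg_induction with
    | hs α => exact hscal α
    | hi m => exact hincl m
    | hadd a b ha hb => intro t ht; rw [add_mul]; exact add_mem (ha t ht) (hb t ht)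
    | hmul a b ha hb => intro t ht; rw [mul_assoc]; exact ha _ (hb t ht)
  refine eq_top_iff.2 fun s _ => ?_
  simpa using key s 1 (AddSubgroup.subset_closure ⟨_, _, isMonomial_one⟩)

theorem addHom_ext_monomial {Q : Type*} [AddCommGroup Q] {f g : SymAlg k M →+ Q}
    (h : ∀ j n s, IsMonomial k j n s → f s = g s) : f = g := by
  refine AddMonoidHom.eq_of_eqOn_dense closure_isMonomial ?_
  rintro s ⟨j, n, hs⟩
  exact h j n s hs

/-- Two morphisms on `S(M)` agree if they agree on monomials. -/
theorem symHom_ext_monomial {N : Type*} [AddCommGroup N] [Module kᵐᵒᵖ N]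
    {F G : SymAlg k M →ₗ[kᵐᵒᵖ] N} (h : ∀ j n s, IsMonomial k j n s → F s = G s) : F = G :=
  LinearMap.toAddMonoidHom_injective (addHom_ext_monomial h)

/-- `S(M)` is spanned over `k` by the products of homogeneous elements of `M`. -/
theorem sym_induction {P : SymAlg k M → Prop} (one : P 1) (add : ∀ s t, P s → P t → P (s + t))
    (smul : ∀ s (α : k), P s → P (s <• α))
    (mul : ∀ i, ∀ m : M, m ∈ SuperGroup.part i → ∀ s, P s → P (incl k M m * s))
    (s : SymAlg k M) : P s := by
  have hs : s ∈ AddSubgroup.closure {s : SymAlg k M | ∃ j n, IsMonomial k j n s} := by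
    rw [closure_isMonomial]; trivial
  induction hs using AddSubgroup.closure_induction with
  | mem s hs =>
    obtain ⟨j, n, hs⟩ := hs
    induction hs with
    | @scal j α hα => rw [← one_mul (scal k M α)]; exact smul 1 α one
    | @cons i j n m s hm _ ih => exact mul i m hm s ih
  | zero => simpa using smul 1 0 one
  | add s t _ _ hs ht => exact add s t hs ht
  | neg s _ hs => simpa [rsmul_eq_mul] using smul s (-1) hs

/-- A morphism on `S(M)` has parity `i` if it shifts the parity of monomials by `i`. -/
theorem mem_part_of_monomial {N : Type*} [AddCommGroup N] [Module kᵐᵒᵖ N] [SuperGroup N]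
    [SuperModule k N] {i : ZMod 2} {F : SymAlg k M →ₗ[kᵐᵒᵖ] N}
    (h : ∀ j n s, IsMonomial k j n s → F s ∈ SuperGroup.part (i + j)) :
    F ∈ SuperGroup.part i := by
  -- The component `homPart i F` has parity `i` by construction, so it is enough that it agrees with
  -- `F` on monomials.
  have hF : homPart i F = F := symHom_ext_monomial fun j n s hs => by
    rw [homPart_homog i F hs.mem, proj_of_mem (h j n s hs)]
  intro j s hs
  rw [← hF, homPart_homog i F hs]
  exact proj_mem _ _

end Monomials

/-! ### Composition and supercommutators of morphisms -/

section Homs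

variable {k : Type*} [Ring k] [SuperGroup k]
  {M : Type*} [AddCommGroup M] [Module kᵐᵒᵖ M] [SuperGroup M] [SuperModule k M]
  {N : Type*} [AddCommGroup N] [Module kᵐᵒᵖ N] [SuperGroup N] [SuperModule k N]
  {P : Type*} [AddCommGroup P] [Module kᵐᵒᵖ P] [SuperGroup P] [SuperModule k P]

theorem comp_mem {i j : ZMod 2} {F : N →ₗ[kᵐᵒᵖ] P} {G : M →ₗ[kᵐᵒᵖ] N}
    (hF : F ∈ SuperGroup.part i) (hG : G ∈ SuperGroup.part j) :
    F ∘ₗ G ∈ SuperGroup.part (i + j) := fun l m hm => by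
  rw [add_assoc]; exact hF _ _ (hG _ _ hm)

theorem superComm_homog {i j : ZMod 2} {F G : M →ₗ[kᵐᵒᵖ] M} (hF : F ∈ SuperGroup.part i)
    (hG : G ∈ SuperGroup.part j) : superComm F G = F ∘ₗ G - sgn i j • (G ∘ₗ F) := by
  rw [superComm, signed_homog _ hF hG]; rfl

theorem superComm_add_left (F F' G : M →ₗ[kᵐᵒᵖ] M) :
    superComm (F + F') G = superComm F G + superComm F' G := by
  simp only [superComm, map_add, AddMonoidHom.add_apply]; abel

theorem superComm_add_right (F G G' : M →ₗ[kᵐᵒᵖ] M) :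
    superComm F (G + G') = superComm F G + superComm F G' := by
  simp only [superComm, map_add]; abel

end Homs

/-! ### Vector fields and their coderivations -/

section Rules

variable {k : Type*} [Ring k] [SuperGroup k] [CommSuperRing k]
  {M : Type*} [AddCommGroup M] [Module kᵐᵒᵖ M] [SuperGroup M] [SuperModule k M]
  {P : Type*} [AddCommGroup P] [Module kᵐᵒᵖ P] [SuperGroup P] [SuperModule k P]
  {Q : Type*} [AddCommGroup Q] [Module kᵐᵒᵖ Q] [SuperGroup Q] [SuperModule k Q]

theorem tmap_mulLeft₁ {i j : ZMod 2} (F : SymAlg k M →ₗ[kᵐᵒᵖ] P) {G : SymAlg k M →ₗ[kᵐᵒᵖ] Q}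
    (hG : G ∈ SuperGroup.part i) {s : SymAlg k M} (hs : s ∈ SuperGroup.part j)
    (z : STensor k (SymAlg k M) (SymAlg k M)) :
    tmap F G (mulLeft₁ s z) = sgn i j • tmap (F ∘ₗ symLeft s) G z := by
  refine tensor_homog_ext (f := fun z => tmap F G (mulLeft₁ s z))
    (g := fun z => sgn i j • tmap (F ∘ₗ symLeft s) G z) (by simp) (by simp) ?_ z
  intro a b v w hv hw
  show tmap F G (mulLeft₁ s (tm k v w)) = sgn i j • tmap (F ∘ₗ symLeft s) G (tm k v w)
  rw [mulLeft₁_tm, tmap_homog F hG (sym_mul_mem hs hv), tmap_homog _ hG hv, smul_smul,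
    sgn_add_right]
  rfl

theorem tmap_mulLeft₂ {j : ZMod 2} (F : SymAlg k M →ₗ[kᵐᵒᵖ] P) (G : SymAlg k M →ₗ[kᵐᵒᵖ] Q)
    {s : SymAlg k M} (hs : s ∈ SuperGroup.part j) (z : STensor k (SymAlg k M) (SymAlg k M)) :
    tmap F G (mulLeft₂ s z) = tmap F (G ∘ₗ symLeft s) z := by
  refine tensor_homog_ext (f := fun z => tmap F G (mulLeft₂ s z))
    (g := fun z => tmap F (G ∘ₗ symLeft s) z) (by simp) (by simp) ?_ z
  intro a b v w hv hw
  show tmap F G (mulLeft₂ s (tm k v w)) = tmap F (G ∘ₗ symLeft s) (tm k v w)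
  rw [mulLeft₂_tm hs hv, map_zsmul]
  induction G using homog_induction with
  | hadd G H hG hH =>
    have h1 := tmapAux_add_right F G H v (s * w)
    have h2 := tmapAux_add_right F (G ∘ₗ symLeft s) (H ∘ₗ symLeft s) v w
    calc _ = sgn j a • (tmap F G (tm k v (s * w)) + tmap F H (tm k v (s * w))) :=
          congrArg _ h1
      _ = _ := by
        rw [smul_add, hG, hH, LinearMap.add_comp]; exact h2.symm
  | hom i G hG =>
  rw [tmap_homog F hG hv, tmap_homog F (comp_mem hG (symLeft_mem hs)) hv, smul_smul,
    sgn_add_left, mul_comm]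
  rfl

/-- Since `Δ` is multiplicative, the factor `m` goes either to `F`, passing `G` with a sign, or to
`G`. This recursion is behind all the later inductions on products. -/
theorem tmap_comul_incl_mul {i j : ZMod 2} (F : SymAlg k M →ₗ[kᵐᵒᵖ] P)
    {G : SymAlg k M →ₗ[kᵐᵒᵖ] Q} (hG : G ∈ SuperGroup.part i) {m : M}
    (hm : m ∈ SuperGroup.part j) (s : SymAlg k M) :
    tmap F G (comul k M (incl k M m * s)) =
      sgn i j • tmap (F ∘ₗ symLeft (incl k M m)) G (comul k M s) +
        tmap F (G ∘ₗ symLeft (incl k M m)) (comul k M s) := by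
  rw [comul_incl_mul, map_add, tmap_mulLeft₁ F hG (incl_mem hm), tmap_mulLeft₂ F G (incl_mem hm)]

/-- A scalar may be absorbed by either tensor factor; in the second one no sign arises. -/
theorem tmap_comul_scal_mul (F : SymAlg k M →ₗ[kᵐᵒᵖ] P) (G : SymAlg k M →ₗ[kᵐᵒᵖ] Q) {j : ZMod 2}
    {α : k} (hα : α ∈ SuperGroup.part j) (s : SymAlg k M) :
    tmap F G (comul k M (scal k M α * s)) = tmap F (G ∘ₗ symLeft (scal k M α)) (comul k M s) := by
  rw [comul_scal_mul, ← mulLeft₂_scal, tmap_mulLeft₂ F G (scal_mem hα)]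

theorem one_mem_symAlg : (1 : SymAlg k M) ∈ SuperGroup.part 0 := by
  rw [← map_one (scal k M)]
  exact scal_mem CommSuperRing.one_mem

theorem tmap_comul_one (F : SymAlg k M →ₗ[kᵐᵒᵖ] P) (G : SymAlg k M →ₗ[kᵐᵒᵖ] Q) :
    tmap F G (comul k M 1) = tm k (F 1) (G 1) := by
  rw [comul_one]
  induction G using homog_induction with
  | hadd G H hG hH =>
    exact (tmapAux_add_right F G H 1 1).trans ((congrArg₂ (· + ·) hG hH).trans (map_add _ _ _).symm)
  | hom i G hG => rw [tmap_homog F hG one_mem_symAlg, sgn_zero_right, one_smul]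

theorem tmap_add_left (F F' : SymAlg k M →ₗ[kᵐᵒᵖ] P) (G : SymAlg k M →ₗ[kᵐᵒᵖ] Q) :
    tmap (F + F') G = tmap F G + tmap F' G := by
  refine LinearMap.toAddMonoidHom_injective (tensor_hom_ext fun v w => ?_)
  show tmap (F + F') G (tm k v w) = tmap F G (tm k v w) + tmap F' G (tm k v w)
  simp only [tmap_tm, LinearMap.add_apply, tm, map_add, AddMonoidHom.add_apply, smul_add,
    Finset.sum_add_distrib]

theorem tmap_add_right (F : SymAlg k M →ₗ[kᵐᵒᵖ] P) (G G' : SymAlg k M →ₗ[kᵐᵒᵖ] Q) :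
    tmap F (G + G') = tmap F G + tmap F G' :=
  LinearMap.toAddMonoidHom_injective (tensor_hom_ext fun v w => tmapAux_add_right F G G' v w)

theorem inclHom_mem : inclHom k M ∈ SuperGroup.part 0 := fun j m hm => by
  rw [zero_add]; exact incl_mem hm

variable (k M) in
/-- The coderivation `id * h` of `S(M)` attached to a formal vector field `h : S(M) → M`, as an
additive function of `h`. -/
noncomputable def coderOf : (SymAlg k M →ₗ[kᵐᵒᵖ] M) →+ (SymAlg k M →ₗ[kᵐᵒᵖ] SymAlg k M) :=
  AddMonoidHom.mk' (fun h => conv LinearMap.id (inclHom k M ∘ₗ h)) (by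
    intro h h'
    simp only [conv, LinearMap.comp_add, tmap_add_right, LinearMap.add_comp])

theorem coderOf_one (h : SymAlg k M →ₗ[kᵐᵒᵖ] M) : coderOf k M h 1 = incl k M (h 1) := by
  show symMult k M (tmap LinearMap.id (inclHom k M ∘ₗ h) (comul k M 1)) = _
  rw [tmap_comul_one, symMult_tm]
  exact one_mul _

theorem symMult_tmap_symLeft {G : SymAlg k M →ₗ[kᵐᵒᵖ] SymAlg k M}
    (s : SymAlg k M) (z : STensor k (SymAlg k M) (SymAlg k M)) :
    symMult k M (tmap (symLeft s) G z) = s * symMult k M (tmap LinearMap.id G z) := by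
  refine DFunLike.congr_fun (f := ((symMult k M ∘ₗ tmap (symLeft s) G).toAddMonoidHom))
    (g := ((symLeft s ∘ₗ symMult k M ∘ₗ tmap LinearMap.id G).toAddMonoidHom))
    (tensor_hom_ext fun v w => ?_) z
  show symMult k M (tmap (symLeft s) G (tm k v w)) =
    s * symMult k M (tmap LinearMap.id G (tm k v w))
  simp only [tmap_tm, map_sum, map_zsmul, symMult_tm, Finset.mul_sum, mul_smul_comm]
  simp [symLeft_apply, mul_assoc]

/-- Precomposition with left multiplication by `m` is differentiation in the constant direction `m`.
In these terms the rule computes the commutator of `id * h` with left multiplication by `m`. In an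
induction on products, one factor is removed at the price of differentiating `h`, so the fields
always have to be generalized. -/
theorem coderOf_incl_mul {i j : ZMod 2} {h : SymAlg k M →ₗ[kᵐᵒᵖ] M} (hh : h ∈ SuperGroup.part i)
    {m : M} (hm : m ∈ SuperGroup.part j) (s : SymAlg k M) :
    coderOf k M h (incl k M m * s) = sgn i j • (incl k M m * coderOf k M h s) +
      coderOf k M (h ∘ₗ symLeft (incl k M m)) s := by
  have h' : inclHom k M ∘ₗ h ∈ SuperGroup.part i := by simpa using comp_mem inclHom_mem hh
  show symMult k M (tmap LinearMap.id (inclHom k M ∘ₗ h) (comul k M _)) = _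
  rw [tmap_comul_incl_mul _ h' hm, map_add, map_zsmul, LinearMap.id_comp,
    symMult_tmap_symLeft]
  rfl

theorem coderOf_comp_symLeft {i j : ZMod 2} {h : SymAlg k M →ₗ[kᵐᵒᵖ] M}
    (hh : h ∈ SuperGroup.part i) {m : M} (hm : m ∈ SuperGroup.part j) :
    coderOf k M h ∘ₗ symLeft (incl k M m) = sgn i j • (symLeft (incl k M m) ∘ₗ coderOf k M h) +
      coderOf k M (h ∘ₗ symLeft (incl k M m)) :=
  LinearMap.ext (coderOf_incl_mul hh hm)

theorem coderOf_scal_mul (h : SymAlg k M →ₗ[kᵐᵒᵖ] M) {j : ZMod 2}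
    {α : k} (hα : α ∈ SuperGroup.part j) (s : SymAlg k M) :
    coderOf k M h (scal k M α * s) = coderOf k M (h ∘ₗ symLeft (scal k M α)) s := by
  show symMult k M (tmap LinearMap.id (inclHom k M ∘ₗ h) (comul k M _)) = _
  rw [tmap_comul_scal_mul _ _ hα]
  rfl

theorem comp_symLeft_mem {N : Type*} [AddCommGroup N] [Module kᵐᵒᵖ N] [SuperGroup N]
    [SuperModule k N] {i j : ZMod 2} {F : SymAlg k M →ₗ[kᵐᵒᵖ] N} (hF : F ∈ SuperGroup.part i)
    {m : M} (hm : m ∈ SuperGroup.part j) :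
    F ∘ₗ symLeft (incl k M m) ∈ SuperGroup.part (i + j) :=
  comp_mem hF (symLeft_mem (incl_mem hm))

theorem apply_one_mem {N : Type*} [AddCommGroup N] [Module kᵐᵒᵖ N] [SuperGroup N]
    [SuperModule k N] {i : ZMod 2} {F : SymAlg k M →ₗ[kᵐᵒᵖ] N} (hF : F ∈ SuperGroup.part i) :
    F 1 ∈ SuperGroup.part i := by simpa using hF 0 1 one_mem_symAlg

theorem scal_eq_one_smul (α : k) : scal k M α = (1 : SymAlg k M) <• α := (one_mul _).symm

theorem coderOf_mem {i : ZMod 2} {h : SymAlg k M →ₗ[kᵐᵒᵖ] M} (hh : h ∈ SuperGroup.part i) :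
    coderOf k M h ∈ SuperGroup.part i := by
  refine mem_part_of_monomial fun j n s hs => ?_
  induction hs generalizing i h with
  | @scal j α hα =>
    rw [scal_eq_one_smul, map_smul, coderOf_one]
    exact SuperModule.smul_mem (incl_mem (apply_one_mem hh)) hα
  | @cons l j n m s hm hs ih =>
    rw [coderOf_incl_mul hh hm]
    refine add_mem (zsmul_mem ?_ _) ?_
    · rw [add_left_comm]; exact sym_mul_mem (incl_mem hm) (ih hh)
    · rw [← add_assoc]; exact ih (comp_symLeft_mem hh hm)

/-- Each term of `id * h` contains a value of `h`, which lies in `M`, hence there is no constant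
term. This is why constants have zero derivative. -/
theorem counit_coderOf (h : SymAlg k M →ₗ[kᵐᵒᵖ] M) (s : SymAlg k M) :
    counit k M (coderOf k M h s) = 0 := by
  induction h using homog_induction with
  | hadd a b ha hb => rw [map_add, LinearMap.add_apply, map_add, ha, hb, add_zero]
  | hom i h hh =>
  induction s using sym_induction generalizing i h with
  | one => rw [coderOf_one, counit_incl]
  | add s t hs ht => rw [map_add, map_add, hs i h hh, ht i h hh, add_zero]
  | smul s α hs => rw [map_smul, rsmul_eq_mul, map_mul, hs i h hh, zero_mul]
  | mul j m hm s hs =>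
    rw [coderOf_incl_mul hh hm, map_add, map_zsmul, map_mul, counit_incl, zero_mul, smul_zero,
      hs _ _ (comp_symLeft_mem hh hm), add_zero]

/-- Products of two or more elements of `M` are killed, so only the constant term of `s`
contributes. -/
theorem genericPoint_incl_mul (m : M) (s : SymAlg k M) :
    genericPoint k M (incl k M m * s) = m <• counit k M s := by
  induction s using sym_induction with
  | one => rw [mul_one, genericPoint_incl, map_one, MulOpposite.op_one, one_smul]
  | add s t hs ht => rw [mul_add, map_add, hs, ht, map_add, MulOpposite.op_add, add_smul]
  | smul s α hs =>
    rw [rsmul_eq_mul, ← mul_assoc, ← rsmul_eq_mul, map_smul, hs, map_mul, counit_scal,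
      op_smul_op_smul]
  | mul i n hn s hs =>
    rw [genericPoint_mul, map_mul, counit_incl, zero_mul, MulOpposite.op_zero, zero_smul]

theorem genericPoint_comp_symLeft (m : M) :
    genericPoint k M ∘ₗ symLeft (incl k M m) = constHom k m :=
  LinearMap.ext fun s => genericPoint_incl_mul m s

/-- A vector field is the composition of its coderivation with the projection to `M`. -/
theorem genericPoint_comp_coderOf (h : SymAlg k M →ₗ[kᵐᵒᵖ] M) :
    genericPoint k M ∘ₗ coderOf k M h = h := by
  refine LinearMap.ext fun s => ?_
  rw [LinearMap.comp_apply]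
  induction h using homog_induction with
  | hadd a b ha hb => rw [map_add, LinearMap.add_apply, map_add, ha, hb]; rfl
  | hom i h hh =>
  induction s using sym_induction generalizing i h with
  | one => rw [coderOf_one, genericPoint_incl]
  | add s t hs ht => rw [map_add, map_add, hs i h hh, ht i h hh, map_add]
  | smul s α hs => rw [map_smul, map_smul, hs i h hh, map_smul]
  | mul j m hm s hs =>
    rw [coderOf_incl_mul hh hm, map_add, map_zsmul, genericPoint_incl_mul, counit_coderOf,
      hs _ _ (comp_symLeft_mem hh hm)]
    simp [symLeft_apply]

/-- The commutator of the coderivations attached to two vector fields. -/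
theorem superComm_coderOf {i j : ZMod 2} {f h : SymAlg k M →ₗ[kᵐᵒᵖ] M}
    (hf : f ∈ SuperGroup.part i) (hh : h ∈ SuperGroup.part j) :
    superComm (coderOf k M f) (coderOf k M h) =
      coderOf k M (f ∘ₗ coderOf k M h - sgn i j • (h ∘ₗ coderOf k M f)) := by
  rw [superComm_homog (coderOf_mem hf) (coderOf_mem hh)]
  refine LinearMap.ext fun s => ?_
  rw [map_sub, map_zsmul]
  show coderOf k M f (coderOf k M h s) - sgn i j • coderOf k M h (coderOf k M f s) =
    coderOf k M (f ∘ₗ coderOf k M h) s - sgn i j • coderOf k M (h ∘ₗ coderOf k M f) s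
  -- The factor `m` is absorbed by `f` or by `h`, so both are generalized. On `1` the two quadratic
  -- terms in `f 1` and `h 1` cancel by supercommutativity.
  induction s using sym_induction generalizing i j f h with
  | one =>
    have h1 := coderOf_incl_mul (k := k) hf (apply_one_mem hh) 1
    have h2 := coderOf_incl_mul (k := k) hh (apply_one_mem hf) 1
    rw [mul_one] at h1 h2
    simp only [coderOf_one, LinearMap.comp_apply, h1, h2, symLeft_apply, mul_one]
    rw [incl_mul_incl (apply_one_mem hh) (apply_one_mem hf), sgn_comm j i, smul_add,
      sgn_smul_smul]
    abel
  | add s t hs ht =>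
    have h1 := hs hf hh
    have h2 := ht hf hh
    simp only [map_add, smul_add]
    rw [add_sub_add_comm, h1, h2, add_sub_add_comm]
  | smul s α hs =>
    simp only [map_smul]
    simp only [← sgn_smul_rsmul, ← smul_sub, hs hf hh]
  | mul l m hm s hs =>
    have e1 := congrArg (incl k M m * ·) (hs hf hh)
    have e2 := hs (comp_symLeft_mem hf hm) hh
    have e3 := hs hf (comp_symLeft_mem hh hm)
    have c1 := comp_mem hf (coderOf_mem hh)
    have c2 := comp_mem hh (coderOf_mem hf)
    simp only [coderOf_incl_mul hf hm, coderOf_incl_mul hh hm, coderOf_incl_mul c1 hm,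
      coderOf_incl_mul c2 hm, LinearMap.comp_assoc, coderOf_comp_symLeft hf hm,
      coderOf_comp_symLeft hh hm, LinearMap.comp_add, LinearMap.comp_smul, map_add, map_zsmul,
      LinearMap.add_apply, LinearMap.smul_apply] at e1 e2 e3 ⊢
    -- The induction hypotheses `e1`, `e2`, `e3` concern the pairs `(f, h)`, `(∂f, h)` and `(f,
    -- ∂h)`, where `∂` is the derivative along `m`. In each case of the three parities the claim is
    -- their sum with appropriate signs.
    rcases parity_cases i with rfl | rfl <;> rcases parity_cases j with rfl | rfl <;>
      rcases parity_cases l with rfl | rfl <;>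
      simp only [sgn_zero_left, sgn_zero_right, sgn_one_one, one_smul, zero_add, add_zero,
        neg_smul, parity_one_add_one, mul_add, mul_sub, mul_neg, neg_neg] at e1 e2 e3 ⊢
    · linear_combination (norm := abel) e1 + e2 + e3
    · linear_combination (norm := abel) e1 + e2 + e3
    · linear_combination (norm := abel) e1 + e2 + e3
    · linear_combination (norm := abel) -e1 - e2 + e3
    · linear_combination (norm := abel) e1 + e2 + e3
    · linear_combination (norm := abel) -e1 + e2 + e3
    · linear_combination (norm := abel) e1 + e2 + e3
    · linear_combination (norm := abel) e1 - e2 + e3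

end Rules

/-! ### The coderivation property -/

section Coderivation

variable {k : Type*} [Ring k] [SuperGroup k] [CommSuperRing k]
  {M : Type*} [AddCommGroup M] [Module kᵐᵒᵖ M] [SuperGroup M] [SuperModule k M]

theorem tmap_tmap {i j l : ZMod 2} (F' : SymAlg k M →ₗ[kᵐᵒᵖ] SymAlg k M)
    {F G' G : SymAlg k M →ₗ[kᵐᵒᵖ] SymAlg k M} (hF : F ∈ SuperGroup.part i)
    (hG' : G' ∈ SuperGroup.part j) (hG : G ∈ SuperGroup.part l)
    (z : STensor k (SymAlg k M) (SymAlg k M)) :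
    tmap F' G' (tmap F G z) = sgn j i • tmap (F' ∘ₗ F) (G' ∘ₗ G) z := by
  refine tensor_homog_ext (f := fun z => tmap F' G' (tmap F G z))
    (g := fun z => sgn j i • tmap (F' ∘ₗ F) (G' ∘ₗ G) z) (by simp) (by simp) ?_ z
  intro a b v w hv hw
  show tmap F' G' (tmap F G (tm k v w)) = sgn j i • tmap (F' ∘ₗ F) (G' ∘ₗ G) (tm k v w)
  rw [tmap_homog F hG hv, map_zsmul, tmap_homog F' hG' (hF _ _ hv),
    tmap_homog _ (comp_mem hG' hG) hv, smul_smul, smul_smul, sgn_add_left, sgn_add_right]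
  congr 1
  ring

theorem tmap_zsmul_left (n : ℤ) (F G : SymAlg k M →ₗ[kᵐᵒᵖ] SymAlg k M) :
    tmap (n • F) G = n • tmap F G :=
  map_zsmul (AddMonoidHom.mk' (fun F : SymAlg k M →ₗ[kᵐᵒᵖ] SymAlg k M => tmap F G)
    fun F F' => tmap_add_left F F' G) n F

theorem tmap_zsmul_right (n : ℤ) (F G : SymAlg k M →ₗ[kᵐᵒᵖ] SymAlg k M) :
    tmap F (n • G) = n • tmap F G :=
  map_zsmul (AddMonoidHom.mk' (fun G : SymAlg k M →ₗ[kᵐᵒᵖ] SymAlg k M => tmap F G)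
    fun G G' => tmap_add_right F G G') n G

/-- On `1` this says that the elements of `M` are primitive. Both sides obey the recursion of
`coderOf_incl_mul` because `Δ` is multiplicative, so they agree on all products, whatever the field
`h`. -/
theorem isCoderivation_coderOf (h : SymAlg k M →ₗ[kᵐᵒᵖ] M) : IsCoderivation (coderOf k M h) := by
  refine LinearMap.ext fun s => ?_
  show comul k M (coderOf k M h s) = tmap (coderOf k M h) LinearMap.id (comul k M s) +
    tmap LinearMap.id (coderOf k M h) (comul k M s)
  induction h using homog_induction with
  | hadd a b ha hb =>
    simp only [map_add, LinearMap.add_apply, ha, hb, tmap_add_left, tmap_add_right]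
    abel
  | hom i h hh =>
  induction s using sym_induction generalizing i h with
  | one =>
    have e := comul_incl_mul (k := k) (h 1) 1
    rw [mul_one, comul_one, mulLeft₁_tm, mulLeft₂_tm (incl_mem (apply_one_mem hh)) one_mem_symAlg,
      sgn_zero_right, one_smul, mul_one] at e
    rw [tmap_comul_one, tmap_comul_one, coderOf_one, e]
    rfl
  | add s t hs ht => simp only [map_add, hs i h hh, ht i h hh]; abel
  | smul s α hs => simp only [map_smul, hs i h hh, smul_add]
  | mul l m hm s hs =>
    have hm' : symLeft (incl k M m) ∈ SuperGroup.part l := symLeft_mem (incl_mem hm)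
    have hid : (LinearMap.id : SymAlg k M →ₗ[kᵐᵒᵖ] SymAlg k M) ∈ SuperGroup.part 0 := id_mem
    have hD := coderOf_mem hh
    rw [tmap_comul_incl_mul _ id_mem hm, tmap_comul_incl_mul _ hD hm,
      coderOf_incl_mul hh hm, map_add, map_zsmul, comul_incl_mul, hs i h hh,
      hs _ _ (comp_symLeft_mem hh hm), coderOf_comp_symLeft hh hm]
    simp only [mulLeft₁, mulLeft₂, map_add, tmap_tmap _ hD hid hid, tmap_tmap _ hid hid hD,
      tmap_tmap _ hD hm' hid, tmap_tmap _ hid hm' hD, tmap_add_left, tmap_add_right,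
      tmap_zsmul_left, tmap_zsmul_right, LinearMap.add_apply, LinearMap.smul_apply,
      LinearMap.id_comp, LinearMap.comp_id, sgn_zero_left, sgn_zero_right, one_smul, smul_add]
    rw [sgn_comm l i, sgn_smul_smul]
    abel

end Coderivation

/-! ### The bracket of formal vector fields -/

section FormalFields

variable {k : Type*} [Ring k] [SuperGroup k] [CommSuperRing k]
  {g : Type*} [AddCommGroup g] [Module kᵐᵒᵖ g] [SuperGroup g] [Bracket g g] [LieSuperalgebra k g]

variable (k g) in
/-- The Lie bracket as a biadditive map. -/
def lieAddHom : g →+ g →+ g :=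
  AddMonoidHom.mk' (fun a => AddMonoidHom.mk' (fun b => ⁅a, b⁆) (LieSuperalgebra.lie_add k a))
    (fun a b => AddMonoidHom.ext fun c => LieSuperalgebra.add_lie k a b c)

variable (k g) in
/-- The bracket of formal vector fields as a biadditive map. -/
noncomputable def fieldBracketHom :
    (SymAlg k g →ₗ[kᵐᵒᵖ] g) →+ (SymAlg k g →ₗ[kᵐᵒᵖ] g) →+ (SymAlg k g →ₗ[kᵐᵒᵖ] g) :=
  AddMonoidHom.mk' (fun F => AddMonoidHom.mk' (fun G => fieldBracket F G) (fun G H => by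
      simp only [fieldBracket, tmap_add_right, LinearMap.add_comp, LinearMap.comp_add]))
    (fun F G => AddMonoidHom.ext fun H => by
      simp only [fieldBracket, AddMonoidHom.mk'_apply, AddMonoidHom.add_apply, tmap_add_left,
        LinearMap.add_comp, LinearMap.comp_add])

theorem fieldBracket_add (F G H : SymAlg k g →ₗ[kᵐᵒᵖ] g) :
    fieldBracket F (G + H) = fieldBracket F G + fieldBracket F H :=
  map_add (fieldBracketHom k g F) G H

theorem add_fieldBracket (F G H : SymAlg k g →ₗ[kᵐᵒᵖ] g) :
    fieldBracket (F + G) H = fieldBracket F H + fieldBracket G H :=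
  map_add ((fieldBracketHom k g).flip H) F G

theorem fieldBracket_zsmul (n : ℤ) (F G : SymAlg k g →ₗ[kᵐᵒᵖ] g) :
    fieldBracket F (n • G) = n • fieldBracket F G :=
  map_zsmul (fieldBracketHom k g F) n G

theorem zsmul_fieldBracket (n : ℤ) (F G : SymAlg k g →ₗ[kᵐᵒᵖ] g) :
    fieldBracket (n • F) G = n • fieldBracket F G :=
  map_zsmul ((fieldBracketHom k g).flip G) n F

theorem fieldBracket_one (F G : SymAlg k g →ₗ[kᵐᵒᵖ] g) : fieldBracket F G 1 = ⁅F 1, G 1⁆ := by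
  show lieHom k g (tmap F G (comul k g 1)) = _
  rw [tmap_comul_one, lieHom_tm]

/-- Differentiation in a constant direction is a derivation of the bracket. Identities of `g`
therefore pass to fields: on `1` they are identities in `g`, and differentiating both sides gives
instances of the same identity for other fields. -/
theorem fieldBracket_incl_mul {i j : ZMod 2} (F : SymAlg k g →ₗ[kᵐᵒᵖ] g)
    {G : SymAlg k g →ₗ[kᵐᵒᵖ] g} (hG : G ∈ SuperGroup.part i) {m : g}
    (hm : m ∈ SuperGroup.part j) (s : SymAlg k g) :
    fieldBracket F G (incl k g m * s) = sgn i j • fieldBracket (F ∘ₗ symLeft (incl k g m)) G s +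
      fieldBracket F (G ∘ₗ symLeft (incl k g m)) s := by
  show lieHom k g (tmap F G (comul k g _)) = _
  rw [tmap_comul_incl_mul _ hG hm, map_add, map_zsmul]
  rfl

theorem fieldBracket_scal_mul (F G : SymAlg k g →ₗ[kᵐᵒᵖ] g) {j : ZMod 2}
    {α : k} (hα : α ∈ SuperGroup.part j) (s : SymAlg k g) :
    fieldBracket F G (scal k g α * s) = fieldBracket F (G ∘ₗ symLeft (scal k g α)) s := by
  show lieHom k g (tmap F G (comul k g _)) = _
  rw [tmap_comul_scal_mul _ _ hα]
  rfl

theorem fieldBracket_comp_symLeft {i j : ZMod 2} (F : SymAlg k g →ₗ[kᵐᵒᵖ] g)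
    {G : SymAlg k g →ₗ[kᵐᵒᵖ] g} (hG : G ∈ SuperGroup.part i) {m : g}
    (hm : m ∈ SuperGroup.part j) :
    fieldBracket F G ∘ₗ symLeft (incl k g m) =
      sgn i j • fieldBracket (F ∘ₗ symLeft (incl k g m)) G +
        fieldBracket F (G ∘ₗ symLeft (incl k g m)) :=
  LinearMap.ext (fieldBracket_incl_mul F hG hm)

theorem fieldBracket_mem {i j : ZMod 2} {F G : SymAlg k g →ₗ[kᵐᵒᵖ] g}
    (hF : F ∈ SuperGroup.part i) (hG : G ∈ SuperGroup.part j) :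
    fieldBracket F G ∈ SuperGroup.part (i + j) := by
  refine mem_part_of_monomial fun l n s hs => ?_
  induction hs generalizing i j F G with
  | @scal l α hα =>
    rw [scal_eq_one_smul, map_smul, fieldBracket_one]
    exact SuperModule.smul_mem (LieSuperalgebra.lie_mem k (apply_one_mem hF) (apply_one_mem hG)) hα
  | @cons l l' m n s hm hs ih =>
    rw [fieldBracket_incl_mul F hG hm]
    refine add_mem (zsmul_mem ?_ _) ?_
    · rw [show i + j + (l + l') = i + l + j + l' by ring]
      exact ih (comp_symLeft_mem hF hm) hG
    · rw [show i + j + (l + l') = i + (j + l) + l' by ring]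
      exact ih hF (comp_symLeft_mem hG hm)

theorem fieldBracket_skew {i j : ZMod 2} {F G : SymAlg k g →ₗ[kᵐᵒᵖ] g}
    (hF : F ∈ SuperGroup.part i) (hG : G ∈ SuperGroup.part j) :
    fieldBracket F G = -(sgn i j • fieldBracket G F) := by
  refine LinearMap.ext fun s => ?_
  rw [LinearMap.neg_apply, LinearMap.smul_apply]
  induction s using sym_induction generalizing i j F G with
  | one =>
    rw [fieldBracket_one, fieldBracket_one]
    exact LieSuperalgebra.skew k (apply_one_mem hF) (apply_one_mem hG)
  | add s t hs ht => simp only [map_add, hs hF hG, ht hF hG, smul_add, neg_add]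
  | smul s α hs => rw [map_smul, map_smul, hs hF hG, smul_neg, sgn_smul_rsmul]
  | mul l m hm s hs =>
    rw [fieldBracket_incl_mul F hG hm, fieldBracket_incl_mul G hF hm,
      hs (comp_symLeft_mem hF hm) hG, hs hF (comp_symLeft_mem hG hm)]
    rcases parity_cases i with rfl | rfl <;> rcases parity_cases j with rfl | rfl <;>
      rcases parity_cases l with rfl | rfl <;>
      simp only [sgn_zero_left, sgn_zero_right, sgn_one_one, one_smul, zero_add, add_zero,
        neg_smul, parity_one_add_one, neg_neg, neg_add] <;> abel

/-- The value on `1` is the Jacobi identity of `g`. Differentiating along `m` produces three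
instances of the claim, one for each of the fields that may absorb `m`; the remaining work is to
match the signs. -/
theorem fieldBracket_jacobi {i j l : ZMod 2} {F G H : SymAlg k g →ₗ[kᵐᵒᵖ] g}
    (hF : F ∈ SuperGroup.part i) (hG : G ∈ SuperGroup.part j) (hH : H ∈ SuperGroup.part l) :
    fieldBracket F (fieldBracket G H) =
      fieldBracket (fieldBracket F G) H + sgn i j • fieldBracket G (fieldBracket F H) := by
  refine LinearMap.ext fun s => ?_
  rw [LinearMap.add_apply, LinearMap.smul_apply]
  induction s using sym_induction generalizing i j l F G H with
  | one =>
    simp only [fieldBracket_one]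
    rw [LieSuperalgebra.jacobi k _ (apply_one_mem hF) (apply_one_mem hG), sub_add_cancel]
  | add s t hs ht =>
    simp only [map_add, hs hF hG hH, ht hF hG hH, smul_add]; abel
  | smul s α hs => simp only [map_smul, hs hF hG hH, sgn_smul_rsmul, smul_add]
  | mul r m hm s hs =>
    have e1 := hs (comp_symLeft_mem hF hm) hG hH
    have e2 := hs hF (comp_symLeft_mem hG hm) hH
    have e3 := hs hF hG (comp_symLeft_mem hH hm)
    simp only [fieldBracket_incl_mul _ (fieldBracket_mem hG hH) hm, fieldBracket_incl_mul _ hH hm,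
      fieldBracket_incl_mul _ (fieldBracket_mem hF hH) hm, fieldBracket_comp_symLeft _ hH hm,
      fieldBracket_comp_symLeft _ hG hm, fieldBracket_add, add_fieldBracket, fieldBracket_zsmul,
      zsmul_fieldBracket, LinearMap.add_apply, LinearMap.smul_apply, smul_add, e1, e2, e3]
    rcases parity_cases i with rfl | rfl <;> rcases parity_cases j with rfl | rfl <;>
      rcases parity_cases l with rfl | rfl <;> rcases parity_cases r with rfl | rfl <;>
      simp only [sgn_zero_left, sgn_zero_right, sgn_one_one, one_smul, zero_add, add_zero,
        neg_smul, parity_one_add_one, neg_neg, neg_add] <;> abel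

/-- The derivative of a bracket of vector fields along a vector field. -/
theorem fieldBracket_comp_coderOf {i j l : ZMod 2} {F G h : SymAlg k g →ₗ[kᵐᵒᵖ] g}
    (hF : F ∈ SuperGroup.part i) (hG : G ∈ SuperGroup.part j) (hh : h ∈ SuperGroup.part l) :
    fieldBracket F G ∘ₗ coderOf k g h =
      sgn l j • fieldBracket (F ∘ₗ coderOf k g h) G + fieldBracket F (G ∘ₗ coderOf k g h) := by
  refine LinearMap.ext fun s => ?_
  rw [LinearMap.add_apply, LinearMap.smul_apply, LinearMap.comp_apply]
  induction s using sym_induction generalizing i j l F G h with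
  | one =>
    -- On `1` the coderivation has the value `h 1 ∈ g`, so this is the derivation rule in the
    -- constant direction `h 1`.
    have e := fieldBracket_incl_mul F hG (apply_one_mem hh) 1
    rw [mul_one] at e
    simp only [coderOf_one, e, fieldBracket_one, LinearMap.comp_apply, symLeft_apply, mul_one]
    rw [sgn_comm]
  | add s t hs ht => simp only [map_add, hs hF hG hh, ht hF hG hh, smul_add]; abel
  | smul s α hs => simp only [map_smul, hs hF hG hh, sgn_smul_rsmul, smul_add]
  | mul r m hm s hs =>
    have e1 := hs (comp_symLeft_mem hF hm) hG hh
    have e2 := hs hF (comp_symLeft_mem hG hm) hh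
    have e3 := hs hF hG (comp_symLeft_mem hh hm)
    rw [coderOf_incl_mul hh hm, map_add, map_zsmul, fieldBracket_incl_mul F hG hm,
      fieldBracket_incl_mul _ hG hm,
      fieldBracket_incl_mul _ (comp_mem hG (coderOf_mem hh)) hm, e1, e2, e3]
    simp only [LinearMap.comp_assoc, coderOf_comp_symLeft hh hm, LinearMap.comp_add,
      LinearMap.comp_smul, fieldBracket_add, add_fieldBracket, fieldBracket_zsmul,
      zsmul_fieldBracket, LinearMap.add_apply, LinearMap.smul_apply, smul_add]
    rcases parity_cases j with rfl | rfl <;>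
      rcases parity_cases l with rfl | rfl <;> rcases parity_cases r with rfl | rfl <;>
      simp only [sgn_zero_left, sgn_zero_right, sgn_one_one, one_smul, zero_add, add_zero,
        neg_smul, parity_one_add_one, neg_neg, neg_add] <;> abel

end FormalFields

/-! ### Scalar multiples of fields, constants and the generic point -/

section ScalarMultiples

variable {k : Type*} [Ring k] [SuperGroup k]
  {M : Type*} [AddCommGroup M] [Module kᵐᵒᵖ M] [SuperGroup M] [SuperModule k M]

theorem leftMul_mem {i j : ZMod 2} {α : k} {m : M} (hα : α ∈ SuperGroup.part i)
    (hm : m ∈ SuperGroup.part j) : leftMul k M α m ∈ SuperGroup.part (i + j) := by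
  rw [leftMul_homog hα hm, add_comm]
  exact zsmul_mem (SuperModule.smul_mem hm hα) _

variable [CommSuperRing k]

variable (k M) in
/-- The multiples `α F` of a morphism `F : S(M) → M`. -/
noncomputable def lsmul : k →+ (SymAlg k M →ₗ[kᵐᵒᵖ] M) →+ (SymAlg k M →ₗ[kᵐᵒᵖ] M) :=
  AddMonoidHom.mk' (fun α => AddMonoidHom.mk' (fun F =>
      { toFun := fun s => leftMul k M α (F s)
        map_add' := fun s t => by rw [map_add, map_add]
        map_smul' := fun β s => by
          obtain ⟨γ, rfl⟩ := MulOpposite.op_surjective β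
          rw [map_smul, leftMul_smul]; rfl })
      (fun F G => LinearMap.ext fun s => map_add (leftMul k M α) _ _))
    (fun α β => AddMonoidHom.ext fun F => LinearMap.ext fun s => by
      show leftMul k M (α + β) (F s) = _
      rw [map_add]; rfl)

theorem lsmul_apply (α : k) (F : SymAlg k M →ₗ[kᵐᵒᵖ] M) (s : SymAlg k M) :
    lsmul k M α F s = leftMul k M α (F s) := rfl

theorem lsmul_comp (α : k) (F : SymAlg k M →ₗ[kᵐᵒᵖ] M) (G : SymAlg k M →ₗ[kᵐᵒᵖ] SymAlg k M) :
    lsmul k M α F ∘ₗ G = lsmul k M α (F ∘ₗ G) := rfl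

theorem lsmul_mem {i j : ZMod 2} {α : k} {F : SymAlg k M →ₗ[kᵐᵒᵖ] M}
    (hα : α ∈ SuperGroup.part i) (hF : F ∈ SuperGroup.part j) :
    lsmul k M α F ∈ SuperGroup.part (i + j) := fun l s hs => by
  have h : leftMul k M α (F s) ∈ SuperGroup.part (i + (j + l)) := leftMul_mem hα (hF l s hs)
  rw [add_assoc]
  exact h

theorem mul_lsmul (α β : k) (F : SymAlg k M →ₗ[kᵐᵒᵖ] M) :
    lsmul k M (α * β) F = lsmul k M α (lsmul k M β F) :=
  LinearMap.ext fun s => by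
    rw [lsmul_apply, lsmul_apply, lsmul_apply, mul_leftMul]

variable (k M) in
theorem genericPoint_one : genericPoint k M 1 = 0 := by
  rw [← map_one (scal k M), genericPoint_scal]

theorem counit_incl_mul (m : M) (s : SymAlg k M) : counit k M (incl k M m * s) = 0 := by
  rw [map_mul, counit_incl, zero_mul]

theorem constHom_comp_symLeft (a m : M) :
    (constHom k a : SymAlg k M →ₗ[kᵐᵒᵖ] M) ∘ₗ symLeft (incl k M m) = 0 :=
  LinearMap.ext fun s => by
    show a <• counit k M (incl k M m * s) = 0
    rw [counit_incl_mul, MulOpposite.op_zero, zero_smul]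

theorem constHom_one (a : M) : (constHom k a : SymAlg k M →ₗ[kᵐᵒᵖ] M) 1 = a := by
  show a <• counit k M 1 = a
  rw [map_one, MulOpposite.op_one, one_smul]

theorem constHom_incl_mul (a m : M) (s : SymAlg k M) :
    (constHom k a : SymAlg k M →ₗ[kᵐᵒᵖ] M) (incl k M m * s) = 0 :=
  DFunLike.congr_fun (constHom_comp_symLeft a m) s

theorem constHom_mem {i : ZMod 2} {a : M} (ha : a ∈ SuperGroup.part i) :
    (constHom k a : SymAlg k M →ₗ[kᵐᵒᵖ] M) ∈ SuperGroup.part i := by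
  refine mem_part_of_monomial fun j n s hs => ?_
  cases hs with
  | scal hα =>
    rw [scal_eq_one_smul, map_smul, constHom_one]
    exact SuperModule.smul_mem ha hα
  | cons hm hs =>
    rw [constHom_incl_mul]
    exact zero_mem _

theorem genericPoint_mem : genericPoint k M ∈ SuperGroup.part 0 := by
  refine mem_part_of_monomial fun j n s hs => ?_
  cases hs with
  | scal hα => rw [genericPoint_scal]; exact zero_mem _
  | @cons i j n m s hm hs =>
    rw [zero_add]
    show (genericPoint k M ∘ₗ symLeft (incl k M m)) s ∈ _
    rw [genericPoint_comp_symLeft]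
    exact constHom_mem hm _ _ hs.mem

theorem constHom_comp_coderOf (a : M) (h : SymAlg k M →ₗ[kᵐᵒᵖ] M) :
    (constHom k a : SymAlg k M →ₗ[kᵐᵒᵖ] M) ∘ₗ coderOf k M h = 0 :=
  LinearMap.ext fun s => by
    show a <• counit k M (coderOf k M h s) = 0
    rw [counit_coderOf, MulOpposite.op_zero, zero_smul]

end ScalarMultiples

/-! ### Powers of `ad x` and their derivatives -/

section IteratedBrackets

variable {k : Type*} [Ring k] [SuperGroup k] [CommSuperRing k]
  {g : Type*} [AddCommGroup g] [Module kᵐᵒᵖ g] [SuperGroup g] [Bracket g g] [LieSuperalgebra k g]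

theorem leftMul_lie (α : k) (a b : g) : ⁅leftMul k g α a, b⁆ = leftMul k g α ⁅a, b⁆ := by
  show lieAddHom k g (leftMul k g α a) b = leftMul k g α (lieAddHom k g a b)
  induction α using homog_induction with
  | hadd x y hx hy => simp only [map_add, AddMonoidHom.add_apply, hx, hy]
  | hom e α hα =>
  induction a using homog_induction with
  | hadd x y hx hy => simp only [map_add, AddMonoidHom.add_apply, hx, hy]
  | hom i a ha =>
  induction b using homog_induction with
  | hadd x y hx hy => simp only [map_add, hx, hy]
  | hom j b hb =>
  have hab : lieAddHom k g a b ∈ SuperGroup.part (i + j) := LieSuperalgebra.lie_mem k ha hb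
  rw [leftMul_homog hα ha, leftMul_homog hα hab, map_zsmul]
  show sgn e i • ⁅a <• α, b⁆ = sgn e (i + j) • (⁅a, b⁆ <• α)
  rw [LieSuperalgebra.smul_lie a hb hα, smul_smul, sgn_add_right, mul_assoc, sgn_comm j e,
    sgn_mul_self, mul_one]

theorem lie_leftMul {e i : ZMod 2} {α : k} {a : g} (hα : α ∈ SuperGroup.part e)
    (ha : a ∈ SuperGroup.part i) (b : g) :
    ⁅a, leftMul k g α b⁆ = sgn i e • leftMul k g α ⁅a, b⁆ := by
  show lieAddHom k g a (leftMul k g α b) = sgn i e • leftMul k g α (lieAddHom k g a b)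
  induction b using homog_induction with
  | hadd x y hx hy => simp only [map_add, hx, hy, smul_add]
  | hom j b hb =>
  have hab : lieAddHom k g a b ∈ SuperGroup.part (i + j) := LieSuperalgebra.lie_mem k ha hb
  rw [leftMul_homog hα hb, leftMul_homog hα hab, map_zsmul]
  show sgn e j • ⁅a, b <• α⁆ = sgn i e • sgn e (i + j) • (⁅a, b⁆ <• α)
  rw [LieSuperalgebra.lie_smul, smul_smul, sgn_add_right, ← mul_assoc, sgn_comm i e,
    sgn_mul_self, one_mul]

theorem lsmul_fieldBracket (α : k) (F G : SymAlg k g →ₗ[kᵐᵒᵖ] g) :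
    fieldBracket (lsmul k g α F) G = lsmul k g α (fieldBracket F G) := by
  refine LinearMap.ext fun s => ?_
  rw [lsmul_apply]
  induction G using homog_induction with
  | hadd G H hG hH => simp only [fieldBracket_add, LinearMap.add_apply, map_add, hG, hH]
  | hom j G hG =>
  induction s using sym_induction generalizing j F G with
  | one => rw [fieldBracket_one, fieldBracket_one, lsmul_apply, leftMul_lie]
  | add s t hs ht => simp only [map_add, hs F j G hG, ht F j G hG]
  | smul s β hs => simp only [map_smul, hs F j G hG, leftMul_smul]
  | mul l m hm s hs =>
    rw [fieldBracket_incl_mul _ hG hm, fieldBracket_incl_mul _ hG hm, lsmul_comp,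
      hs _ j G hG, hs _ _ _ (comp_symLeft_mem hG hm), map_add, map_zsmul]

/-- The scalar leaves the bracket by passing `F`. The sign is trivial for the even generic point, so
`ad x` is linear over all scalars; for `F = (ad x)^r (a)` it is the source of `twist` in the
commutator formula. -/
theorem fieldBracket_lsmul {e i : ZMod 2} {α : k} (hα : α ∈ SuperGroup.part e)
    {F : SymAlg k g →ₗ[kᵐᵒᵖ] g} (hF : F ∈ SuperGroup.part i) (G : SymAlg k g →ₗ[kᵐᵒᵖ] g) :
    fieldBracket F (lsmul k g α G) = sgn i e • lsmul k g α (fieldBracket F G) := by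
  refine LinearMap.ext fun s => ?_
  rw [LinearMap.smul_apply, lsmul_apply]
  induction G using homog_induction with
  | hadd G H hG hH =>
    simp only [fieldBracket_add, LinearMap.add_apply, map_add, hG, hH, smul_add]
  | hom j G hG =>
  induction s using sym_induction generalizing i F j G with
  | one => rw [fieldBracket_one, fieldBracket_one, lsmul_apply, lie_leftMul hα (apply_one_mem hF)]
  | add s t hs ht => simp only [map_add, hs hF j G hG, ht hF j G hG, smul_add]
  | smul s β hs => simp only [map_smul, hs hF j G hG, leftMul_smul, sgn_smul_rsmul]
  | mul l m hm s hs =>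
    rw [fieldBracket_incl_mul _ (lsmul_mem hα hG) hm, fieldBracket_incl_mul _ hG hm, lsmul_comp,
      hs (comp_symLeft_mem hF hm) j G hG, hs hF _ _ (comp_symLeft_mem hG hm), map_add, map_zsmul,
      smul_add, smul_smul, smul_smul]
    congr 2
    rw [sgn_add_left, sgn_add_left, sgn_comm l e]
    linear_combination sgn j l * sgn i e * sgn_mul_self e l

variable (k g) in
/-- The operator `ad x`, where `x` is the generic point. -/
noncomputable def adPoint : (SymAlg k g →ₗ[kᵐᵒᵖ] g) →+ (SymAlg k g →ₗ[kᵐᵒᵖ] g) :=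
  fieldBracketHom k g (genericPoint k g)

theorem adPow_zero (a : g) : (adPow 0 a : SymAlg k g →ₗ[kᵐᵒᵖ] g) = constHom k a := rfl

theorem adPow_succ (n : ℕ) (a : g) :
    (adPow (n + 1) a : SymAlg k g →ₗ[kᵐᵒᵖ] g) = adPoint k g (adPow n a) :=
  Function.iterate_succ_apply' _ _ _

theorem adPoint_mem {i : ZMod 2} {F : SymAlg k g →ₗ[kᵐᵒᵖ] g} (hF : F ∈ SuperGroup.part i) :
    adPoint k g F ∈ SuperGroup.part i := by
  have h := fieldBracket_mem genericPoint_mem hF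
  rwa [zero_add] at h

theorem adPow_mem (n : ℕ) {i : ZMod 2} {a : g} (ha : a ∈ SuperGroup.part i) :
    (adPow n a : SymAlg k g →ₗ[kᵐᵒᵖ] g) ∈ SuperGroup.part i := by
  induction n with
  | zero => exact constHom_mem ha
  | succ n ih => rw [adPow_succ]; exact adPoint_mem ih

theorem adPow_add (n : ℕ) (a b : g) :
    (adPow n (a + b) : SymAlg k g →ₗ[kᵐᵒᵖ] g) = adPow n a + adPow n b := by
  induction n with
  | zero => exact LinearMap.ext fun s => smul_add _ _ _
  | succ n ih => rw [adPow_succ, ih, map_add, adPow_succ, adPow_succ]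

theorem adPoint_lsmul (α : k) (F : SymAlg k g →ₗ[kᵐᵒᵖ] g) :
    adPoint k g (lsmul k g α F) = lsmul k g α (adPoint k g F) := by
  induction α using homog_induction with
  | hadd x y hx hy => simp only [map_add, AddMonoidHom.add_apply, hx, hy]
  | hom e α hα =>
    refine (fieldBracket_lsmul hα genericPoint_mem F).trans ?_
    rw [sgn_zero_left, one_smul]
    rfl

theorem adPoint_fieldBracket {i j : ZMod 2} {F G : SymAlg k g →ₗ[kᵐᵒᵖ] g}
    (hF : F ∈ SuperGroup.part i) (hG : G ∈ SuperGroup.part j) :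
    adPoint k g (fieldBracket F G) =
      fieldBracket (adPoint k g F) G + fieldBracket F (adPoint k g G) := by
  refine (fieldBracket_jacobi genericPoint_mem hF hG).trans ?_
  rw [sgn_zero_left, one_smul]
  rfl

/-- The derivation rule is applied to `[x, G]`. The derivative of `x` along `h` is `h`, and the
signed bracket of `h` and `G` is `-[G, h]`, so no sign depending on parities remains. -/
theorem adPoint_comp_coderOf {j l : ZMod 2} {G h : SymAlg k g →ₗ[kᵐᵒᵖ] g}
    (hG : G ∈ SuperGroup.part j) (hh : h ∈ SuperGroup.part l) :
    adPoint k g G ∘ₗ coderOf k g h = adPoint k g (G ∘ₗ coderOf k g h) - fieldBracket G h := by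
  refine (fieldBracket_comp_coderOf genericPoint_mem hG hh).trans ?_
  rw [genericPoint_comp_coderOf, fieldBracket_skew hG hh, sgn_comm, sub_neg_eq_add, add_comm]
  rfl

/-- Pascal's rule in the shape needed for `adPow_comp_coderOf`: `ad x` raises either of the two
exponents in a bracket, and the term `f p 0` is the bracket with `h` itself that appears with each
further power. -/
theorem sum_choose_pascal {A : Type*} [AddCommGroup A] (f : ℕ → ℕ → A) (p : ℕ) :
    ∑ r ∈ Finset.range (p + 1), (p + 1).choose r • f r (p - r) =
      ∑ r ∈ Finset.range p, p.choose r • f (r + 1) (p - 1 - r) +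
      ∑ r ∈ Finset.range p, p.choose r • f r (p - r) + f p 0 := by
  have h : ∑ r ∈ Finset.range p, p.choose r • f r (p - r) + f p 0 =
      ∑ r ∈ Finset.range (p + 1), p.choose r • f r (p - r) := by
    rw [Finset.sum_range_succ]; simp
  rw [add_assoc, h, Finset.sum_range_succ', Finset.sum_range_succ', ← add_assoc,
    ← Finset.sum_add_distrib]
  congr 1
  · refine Finset.sum_congr rfl fun r _ => ?_
    rw [Nat.choose_succ_succ, add_smul, Nat.sub_add_eq, Nat.sub_right_comm]
  · simp

/-- The derivative of `(ad x)^p (a)` along a vector field. -/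
theorem adPow_comp_coderOf {i l : ZMod 2} {a : g} {h : SymAlg k g →ₗ[kᵐᵒᵖ] g}
    (ha : a ∈ SuperGroup.part i) (hh : h ∈ SuperGroup.part l) (p : ℕ) :
    adPow p a ∘ₗ coderOf k g h = -∑ r ∈ Finset.range p,
      p.choose r • fieldBracket (adPow r a) ((adPoint k g)^[p - 1 - r] h) := by
  have hit : ∀ n, (adPoint k g)^[n] h ∈ SuperGroup.part l := by
    intro n
    induction n with
    | zero => exact hh
    | succ n ih => rw [Function.iterate_succ_apply']; exact adPoint_mem ih
  induction p with
  | zero => rw [adPow_zero, constHom_comp_coderOf]; simp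
  | succ p ih =>
    rw [adPow_succ, adPoint_comp_coderOf (adPow_mem p ha) hh, ih, map_neg, map_sum]
    have e := sum_choose_pascal
      (fun r n => fieldBracket (adPow r a) ((adPoint k g)^[n] h)) p
    simp only [Nat.add_sub_cancel]
    rw [e, neg_add, Function.iterate_zero_apply, sub_eq_add_neg, ← Finset.sum_add_distrib]
    congr 2
    refine Finset.sum_congr rfl fun r hr => ?_
    rw [map_nsmul, adPoint_fieldBracket (adPow_mem r ha) (hit _), smul_add, adPow_succ,
      ← Function.iterate_succ_apply' (adPoint k g)]
    have := Finset.mem_range.1 hr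
    rw [show (p - 1 - r).succ = p - r by omega]

theorem fieldBracket_constHom (a b : g) :
    fieldBracket (constHom k a) (constHom k b) = constHom k ⁅a, b⁆ := by
  refine LinearMap.ext fun s => ?_
  induction b using homog_induction with
  | hadd x y hx hy =>
    have h : ∀ x y : g, (constHom k (x + y) : SymAlg k g →ₗ[kᵐᵒᵖ] g) =
      constHom k x + constHom k y := adPow_add 0
    rw [h, fieldBracket_add, LinearMap.add_apply, hx, hy, LieSuperalgebra.lie_add k, h]
    rfl
  | hom j b hb =>
  induction s using sym_induction with
  | one => rw [fieldBracket_one, constHom_one, constHom_one, constHom_one]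
  | add s t hs ht => simp only [map_add, hs, ht]
  | smul s α hs => simp only [map_smul, hs]
  | mul l m hm s hs =>
    rw [fieldBracket_incl_mul _ (constHom_mem hb) hm, constHom_comp_symLeft,
      constHom_comp_symLeft, constHom_incl_mul]
    have h1 : fieldBracket (0 : SymAlg k g →ₗ[kᵐᵒᵖ] g) (constHom k b) = 0 :=
      map_zero ((fieldBracketHom k g).flip (constHom k b))
    have h2 : fieldBracket (constHom k a) (0 : SymAlg k g →ₗ[kᵐᵒᵖ] g) = 0 :=
      map_zero (fieldBracketHom k g (constHom k a))
    rw [h1, h2]; simp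

/-- `(ad x)^n ([a, b])` by the Leibniz rule. -/
theorem adPow_lie (n : ℕ) (a b : g) :
    (adPow n ⁅a, b⁆ : SymAlg k g →ₗ[kᵐᵒᵖ] g) = ∑ x ∈ Finset.HasAntidiagonal.antidiagonal n,
      n.choose x.1 • fieldBracket (adPow x.1 a) (adPow x.2 b) := by
  have hlr : ∀ x y z : g, ⁅x + y, z⁆ = ⁅x, z⁆ + ⁅y, z⁆ := LieSuperalgebra.add_lie k
  have hll : ∀ x y z : g, ⁅x, y + z⁆ = ⁅x, y⁆ + ⁅x, z⁆ := LieSuperalgebra.lie_add k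
  induction a using homog_induction with
  | hadd x y hx hy =>
    simp only [hlr, adPow_add, hx, hy, add_fieldBracket, smul_add, Finset.sum_add_distrib]
  | hom i a ha =>
  induction b using homog_induction with
  | hadd x y hx hy =>
    simp only [hll, adPow_add, hx, hy, fieldBracket_add, smul_add, Finset.sum_add_distrib]
  | hom j b hb =>
  induction n with
  | zero => simp [adPow_zero, fieldBracket_constHom]
  | succ n ih =>
    -- By the Jacobi identity `ad x` is an even derivation of the bracket, so the coefficients
    -- follow the binomial recursion.
    rw [Finset.sum_antidiagonal_choose_succ_nsmul
      (fun p q => fieldBracket (adPow p a) (adPow q b : SymAlg k g →ₗ[kᵐᵒᵖ] g)) n, adPow_succ, ih,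
      map_sum, ← Finset.sum_add_distrib]
    refine Finset.sum_congr rfl fun x hx => ?_
    rw [map_nsmul, adPoint_fieldBracket (adPow_mem _ ha) (adPow_mem _ hb), smul_add, adPow_succ,
      adPow_succ, add_comm, Nat.choose_symm_of_eq_add (Finset.HasAntidiagonal.mem_antidiagonal.1 hx).symm]

/-- The commutator of vector fields `α (ad x)^p (a)` and `β (ad x)^q (b)`. -/
theorem monomial_field_comm {e l i j : ZMod 2} {α β : k} {a b : g} (hα : α ∈ SuperGroup.part e)
    (hβ : β ∈ SuperGroup.part l) (ha : a ∈ SuperGroup.part i) (hb : b ∈ SuperGroup.part j)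
    (p q : ℕ) :
    lsmul k g α (adPow p a) ∘ₗ coderOf k g (lsmul k g β (adPow q b)) -
      sgn (e + i) (l + j) • (lsmul k g β (adPow q b) ∘ₗ coderOf k g (lsmul k g α (adPow p a))) =
    -lsmul k g (α * sgn i l • β)
      (∑ r ∈ Finset.range p, p.choose r • fieldBracket (adPow r a) (adPow (p - 1 - r + q) b) +
       ∑ r ∈ Finset.range q, q.choose r • fieldBracket (adPow (q - 1 - r + p) a) (adPow r b)) := by
  have hA := adPow_mem (k := k) p ha
  have hB := adPow_mem (k := k) q hb
  have hit : ∀ (γ : k) (c : g) (n q : ℕ),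
      (adPoint k g)^[n] (lsmul k g γ (adPow q c)) = lsmul k g γ (adPow (n + q) c) := by
    intro γ c n q
    induction n with
    | zero => simp
    | succ n ih =>
      rw [Function.iterate_succ_apply', ih, adPoint_lsmul, ← adPow_succ]
      congr 2
      ring
  rw [lsmul_comp, lsmul_comp, adPow_comp_coderOf ha (lsmul_mem hβ hB),
    adPow_comp_coderOf hb (lsmul_mem hα hA)]
  -- In the first term `β` passes `(ad x)^r (a)`, whose parity is that of `a`.
  have e1 : ∀ r, fieldBracket (adPow r a) (lsmul k g β (adPow (p - 1 - r + q) b)) =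
      sgn i l • lsmul k g β (fieldBracket (adPow r a) (adPow (p - 1 - r + q) b)) := fun r =>
    fieldBracket_lsmul hβ (adPow_mem _ ha) _
  -- In the second term skew-symmetry restores the order of `a` and `b`. This makes the two terms
  -- comparable and turns their difference into a sum.
  have e2 : ∀ r, fieldBracket (adPow r b) (lsmul k g α (adPow (q - 1 - r + p) a)) =
      -(sgn j (e + i) • lsmul k g α (fieldBracket (adPow (q - 1 - r + p) a) (adPow r b))) :=
    fun r => by
      rw [fieldBracket_skew (adPow_mem _ hb) (lsmul_mem hα (adPow_mem _ ha)), lsmul_fieldBracket]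
  have e3 : ∀ F, lsmul k g β (lsmul k g α F) = sgn l e • lsmul k g α (lsmul k g β F) := by
    intro F
    rw [← mul_lsmul, ← mul_lsmul, CommSuperRing.mul_comm hβ hα, map_zsmul]; rfl
  simp only [hit, e1, e2]
  simp only [map_neg, map_sum, map_nsmul, map_zsmul, e3, mul_lsmul, map_add, AddMonoidHom.smul_apply,
    AddMonoidHom.coe_smul, Pi.smul_apply]
  rw [sub_eq_add_neg, neg_add]
  congr 1
  refine congrArg Neg.neg ?_
  rw [smul_neg, Finset.smul_sum, ← Finset.sum_neg_distrib]
  refine Finset.sum_congr rfl fun r _ => ?_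
  rw [smul_neg, smul_neg, neg_neg, smul_comm (sgn (e + i) (l + j)), smul_smul, smul_smul]
  congr 2
  -- What remains is an equality of signs depending on four parities.
  clear e1 e2 e3 hit hA hB hα hβ ha hb
  revert e i l j
  decide

end IteratedBrackets

/-! ### Dependence on finitely many degrees -/

section Truncation

variable {k : Type*} [Ring k] [SuperGroup k] [CommSuperRing k]
  {M : Type*} [AddCommGroup M] [Module kᵐᵒᵖ M] [SuperGroup M] [SuperModule k M]

variable (k M) in
/-- The additive subgroup spanned by the monomials of degree less than `N`. -/
noncomputable def degLT (N : ℕ) : AddSubgroup (SymAlg k M) :=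
  AddSubgroup.closure {s | ∃ j n, n < N ∧ IsMonomial k j n s}

theorem IsMonomial.mem_degLT {j : ZMod 2} {n N : ℕ} {s : SymAlg k M} (hs : IsMonomial k j n s)
    (hn : n < N) : s ∈ degLT k M N := AddSubgroup.subset_closure ⟨j, n, hn, hs⟩

theorem incl_mul_mem_degLT {N : ℕ} (m : M) {s : SymAlg k M} (hs : s ∈ degLT k M N) :
    incl k M m * s ∈ degLT k M (N + 1) := by
  induction m using homog_induction with
  | hadd a b ha hb => rw [map_add, add_mul]; exact add_mem ha hb
  | hom i m hm =>
  induction hs using AddSubgroup.closure_induction with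
  | mem s hs =>
    obtain ⟨j, n, hn, hs⟩ := hs
    exact (IsMonomial.cons hm hs).mem_degLT (by omega)
  | zero => rw [mul_zero]; exact zero_mem _
  | add x y _ _ hx hy => rw [mul_add]; exact add_mem hx hy
  | neg x _ hx => rw [mul_neg]; exact neg_mem hx

theorem degLT_mono {N N' : ℕ} (h : N ≤ N') : degLT k M N ≤ degLT k M N' :=
  AddSubgroup.closure_mono fun _ ⟨j, n, hn, hs⟩ => ⟨j, n, hn.trans_le h, hs⟩

/-- The constant term of `h` adds one factor, and the other terms add none. Degrees at most `n + 1`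
are degrees less than `n + 2`. -/
theorem coderOf_mem_degLT {i j : ZMod 2} {n : ℕ} {h : SymAlg k M →ₗ[kᵐᵒᵖ] M}
    (hh : h ∈ SuperGroup.part i) {s : SymAlg k M} (hs : IsMonomial k j n s) :
    coderOf k M h s ∈ degLT k M (n + 2) := by
  induction hs generalizing i h with
  | @scal j α hα =>
    rw [scal_eq_one_smul, map_smul, coderOf_one]
    exact ((isMonomial_incl (apply_one_mem hh)).mul_scal hα).mem_degLT (by omega)
  | @cons l j n m s hm hs ih =>
    rw [coderOf_incl_mul hh hm]
    exact add_mem (zsmul_mem (incl_mul_mem_degLT m (ih hh)) _)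
      (degLT_mono (by omega) (ih (comp_symLeft_mem hh hm)))

theorem eqOn_degLT {N : ℕ} {F G : SymAlg k M →ₗ[kᵐᵒᵖ] M}
    (h : ∀ j n s, n < N → IsMonomial k j n s → F s = G s) {s : SymAlg k M}
    (hs : s ∈ degLT k M N) : F s = G s := by
  refine AddMonoidHom.eqOn_closure (f := F.toAddMonoidHom) (g := G.toAddMonoidHom) ?_ hs
  rintro s ⟨j, n, hn, hs⟩
  exact h j n s hn hs

/-- On a product of `n` factors, `id * f` evaluates `f` only on partial products of these factors.
-/
theorem coderOf_eq_zero {N : ℕ} {i : ZMod 2} {f : SymAlg k M →ₗ[kᵐᵒᵖ] M}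
    (hf : f ∈ SuperGroup.part i) (h : ∀ j n s, n < N → IsMonomial k j n s → f s = 0)
    {j : ZMod 2} {n : ℕ} {s : SymAlg k M} (hn : n < N) (hs : IsMonomial k j n s) :
    coderOf k M f s = 0 := by
  induction hs generalizing i f N with
  | @scal j α hα =>
    rw [scal_eq_one_smul, map_smul, coderOf_one, h 0 0 1 hn isMonomial_one, map_zero, smul_zero]
  | @cons l j n m s hm hs ih =>
    rw [coderOf_incl_mul hf hm, ih (N := N) hf h (by omega), mul_zero, smul_zero, zero_add]
    -- The derivative of `f` uses up one factor, so it vanishes only in degrees less than `N - 1`.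
    exact ih (N := N - 1) (comp_symLeft_mem hf hm)
      (fun j' n' s' hn' hs' => h _ (n' + 1) _ (by omega) (.cons hm hs')) (by omega)

theorem coderOf_eq_of_eqOn {N : ℕ} {i : ZMod 2} {f f' : SymAlg k M →ₗ[kᵐᵒᵖ] M}
    (hf : f ∈ SuperGroup.part i) (hf' : f' ∈ SuperGroup.part i)
    (h : ∀ j n s, n < N → IsMonomial k j n s → f s = f' s)
    {j : ZMod 2} {n : ℕ} {s : SymAlg k M} (hn : n < N) (hs : IsMonomial k j n s) :
    coderOf k M f s = coderOf k M f' s := by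
  have e := coderOf_eq_zero (f := f - f') (sub_mem hf hf')
    (fun j n s hn hs => by rw [LinearMap.sub_apply, h j n s hn hs, sub_self]) hn hs
  rwa [map_sub, LinearMap.sub_apply, sub_eq_zero] at e

end Truncation

/-! ### Homogeneous fields and truncated series -/

section Degrees

variable {k : Type*} [Ring k] [SuperGroup k] [CommSuperRing k]
  {g : Type*} [AddCommGroup g] [Module kᵐᵒᵖ g] [SuperGroup g] [Bracket g g] [LieSuperalgebra k g]

/-- `F` vanishes on the monomials of degree different from `d`. -/
def IsHomogeneousField (d : ℤ) (F : SymAlg k g →ₗ[kᵐᵒᵖ] g) : Prop :=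
  ∀ j n s, IsMonomial k j n s → (n : ℤ) ≠ d → F s = 0

/-- Degrees are integers because differentiation lowers them even from `0`; a field of degree `-1`
vanishes on all monomials. -/
theorem IsHomogeneousField.comp_symLeft {d : ℤ} {F : SymAlg k g →ₗ[kᵐᵒᵖ] g}
    (hF : IsHomogeneousField d F) {i : ZMod 2} {m : g} (hm : m ∈ SuperGroup.part i) :
    IsHomogeneousField (d - 1) (F ∘ₗ symLeft (incl k g m)) := fun _ _ _ hs hn =>
  hF _ _ _ (.cons hm hs) (by push_cast; omega)

theorem IsHomogeneousField.fieldBracket {p q : ℤ} {F G : SymAlg k g →ₗ[kᵐᵒᵖ] g} {i : ZMod 2}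
    (hF : IsHomogeneousField p F) (hG : IsHomogeneousField q G) (hG' : G ∈ SuperGroup.part i) :
    IsHomogeneousField (p + q) (fieldBracket F G) := by
  intro j n s hs hn
  induction hs generalizing p q F G i with
  | @scal j α hα =>
    rw [scal_eq_one_smul, map_smul, fieldBracket_one]
    have h0 : ∀ c : g, lieAddHom k g c 0 = 0 ∧ lieAddHom k g 0 c = 0 := fun c => by simp
    by_cases hp : p = 0
    · rw [hG 0 0 1 isMonomial_one (by push_cast at hn ⊢; omega)]
      exact (congrArg _ (h0 _).1).trans (smul_zero _)
    · rw [hF 0 0 1 isMonomial_one (by push_cast; omega)]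
      exact (congrArg _ (h0 _).2).trans (smul_zero _)
  | @cons l j n m s hm hs ih =>
    rw [fieldBracket_incl_mul F hG' hm, ih (hF.comp_symLeft hm) hG hG' (by push_cast at hn; omega),
      ih hF (hG.comp_symLeft hm) (comp_symLeft_mem hG' hm) (by push_cast at hn; omega), smul_zero,
      zero_add]

theorem isHomogeneousField_genericPoint : IsHomogeneousField 1 (genericPoint k g) := by
  intro j n s hs hn
  cases hs with
  | scal hα => rw [genericPoint_scal]
  | cons hm hs =>
    rw [genericPoint_incl_mul]
    cases hs with
    | scal hα => simp at hn
    | cons hm hs => rw [counit_incl_mul, MulOpposite.op_zero, zero_smul]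

theorem isHomogeneousField_adPow (n : ℕ) {i : ZMod 2} {a : g} (ha : a ∈ SuperGroup.part i) :
    IsHomogeneousField n (adPow n a : SymAlg k g →ₗ[kᵐᵒᵖ] g) := by
  induction n with
  | zero =>
    intro j n s hs hn
    cases hs with
    | scal hα => simp at hn
    | cons hm hs => exact constHom_incl_mul _ _ _
  | succ n ih =>
    rw [adPow_succ, Nat.cast_succ, add_comm]
    exact isHomogeneousField_genericPoint.fieldBracket ih (adPow_mem n ha)

theorem field_monomial (φ : PowerSeries k) (a : g) {j : ZMod 2} {n : ℕ} {s : SymAlg k g}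
    (hs : IsMonomial k j n s) :
    field φ a s = leftMul k g (PowerSeries.coeff n φ) (adPow n a s) := by
  show fieldAux φ a (degCoaction k g s) = _
  rw [hs.degCoaction, fieldAux_monomial]

theorem field_add_left (φ ψ : PowerSeries k) (a : g) :
    field (φ + ψ) a = field φ a + field ψ a :=
  symHom_ext_monomial fun j n s hs => by
    rw [LinearMap.add_apply, field_monomial _ _ hs, field_monomial _ _ hs, field_monomial _ _ hs,
      map_add, map_add]
    rfl

theorem field_add_right (φ : PowerSeries k) (a b : g) :
    field φ (a + b) = field φ a + field φ b :=
  symHom_ext_monomial fun j n s hs => by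
    rw [LinearMap.add_apply, field_monomial _ _ hs, field_monomial _ _ hs, field_monomial _ _ hs,
      adPow_add, LinearMap.add_apply, map_add]

theorem coder_eq (φ : PowerSeries k) (a : g) : coder φ a = coderOf k g (field φ a) := rfl

theorem coder_add_left (φ ψ : PowerSeries k) (a : g) :
    coder (φ + ψ) a = coder φ a + coder ψ a := by
  simp only [coder_eq, field_add_left, map_add]

theorem coder_add_right (φ : PowerSeries k) (a b : g) :
    coder φ (a + b) = coder φ a + coder φ b := by
  simp only [coder_eq, field_add_right, map_add]

/-- The power series `φ` has coefficients of parity `e`. -/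
def HasCoeffsIn (e : ZMod 2) (φ : PowerSeries k) : Prop :=
  ∀ n, PowerSeries.coeff n φ ∈ SuperGroup.part e

theorem field_mem {e i : ZMod 2} {φ : PowerSeries k} (hφ : HasCoeffsIn e φ) {a : g}
    (ha : a ∈ SuperGroup.part i) : field φ a ∈ SuperGroup.part (e + i) :=
  mem_part_of_monomial fun j n s hs => by
    rw [field_monomial φ a hs, add_assoc]
    exact leftMul_mem (hφ n) (adPow_mem n ha j s hs.mem)

/-- The terms of degree less than `N` of the vector field `φ^a`. -/
noncomputable def truncField (N : ℕ) (φ : PowerSeries k) (a : g) : SymAlg k g →ₗ[kᵐᵒᵖ] g :=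
  ∑ p ∈ Finset.range N, lsmul k g (PowerSeries.coeff p φ) (adPow p a)

theorem truncField_mem {e i : ZMod 2} {φ : PowerSeries k} (hφ : HasCoeffsIn e φ) {a : g}
    (ha : a ∈ SuperGroup.part i) (N : ℕ) : truncField N φ a ∈ SuperGroup.part (e + i) :=
  sum_mem fun p _ => lsmul_mem (hφ p) (adPow_mem p ha)

theorem field_eq_truncField {N : ℕ} (φ : PowerSeries k) {i : ZMod 2} {a : g}
    (ha : a ∈ SuperGroup.part i) {j : ZMod 2} {n : ℕ} {s : SymAlg k g} (hn : n < N)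
    (hs : IsMonomial k j n s) : field φ a s = truncField N φ a s := by
  rw [field_monomial φ a hs, truncField, LinearMap.sum_apply, Finset.sum_eq_single n]
  · rfl
  · intro p _ hp
    rw [lsmul_apply, isHomogeneousField_adPow p ha _ _ _ hs (by exact_mod_cast hp.symm), map_zero]
  · intro h
    exact absurd (Finset.mem_range.2 hn) h

/-- The sign `(-1) ^ (p(α) i)` applied to `α`. -/
def twist {A : Type*} [AddCommGroup A] [SuperGroup A] (i : ZMod 2) : A →+ A :=
  ∑ l, sgn i l • proj l

theorem twist_homog {A : Type*} [AddCommGroup A] [SuperGroup A] (i : ZMod 2) {l : ZMod 2} {α : A}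
    (hα : α ∈ SuperGroup.part l) : twist i α = sgn i l • α := by
  rw [twist, AddMonoidHom.finsetSum_apply, Finset.sum_eq_single l]
  · rw [AddMonoidHom.smul_apply, proj_of_mem hα]
  · intro j _ hj
    rw [AddMonoidHom.smul_apply, proj_of_mem_ne hα hj.symm, smul_zero]
  · simp

end Degrees

/-! ### Coefficients of the functional equation -/

section Coefficients

variable {k : Type*} [Ring k]

/-- The coefficient of `t^p u^q` in
`-((φ(t + u) - φ(t)) / u) ψ(u) - φ(t) ((ψ(t + u) - ψ(u)) / t)`, where `φ = ∑ c_n t^n` and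
`ψ = ∑ d_n t^n`. -/
def feCoeff (c d : ℕ → k) (p q : ℕ) : k :=
  -(∑ y ∈ Finset.HasAntidiagonal.antidiagonal q,
      (p + y.1 + 1).choose p • (c (p + y.1 + 1) * d y.2) +
    ∑ y ∈ Finset.HasAntidiagonal.antidiagonal p,
      (q + y.1 + 1).choose q • (c y.2 * d (q + y.1 + 1)))

theorem feCoeff_add_left (c c' d : ℕ → k) (p q : ℕ) :
    feCoeff (c + c') d p q = feCoeff c d p q + feCoeff c' d p q := by
  simp only [feCoeff, Pi.add_apply, add_mul, smul_add, Finset.sum_add_distrib]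
  abel

theorem feCoeff_add_right (c d d' : ℕ → k) (p q : ℕ) :
    feCoeff c (d + d') p q = feCoeff c d p q + feCoeff c d' p q := by
  simp only [feCoeff, Pi.add_apply, mul_add, smul_add, Finset.sum_add_distrib]
  abel

/-- The terms that contribute have `p + q = n + 1` and `r < p`. They are indexed by the exponents `x
= (r, n - r)` of the bracket to which they belong, together with `y = (p - r - 1, q)`. The range `n
+ 2` contains all such `p` and `q`. -/
theorem sum_range_eq_sum_antidiagonal {A : Type*} [AddCommMonoid A] (n : ℕ) (G : ℕ → ℕ → ℕ → A)
    (hG : ∀ p q r, r < p → p + q ≠ n + 1 → G p q r = 0) :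
    ∑ p ∈ Finset.range (n + 2), ∑ q ∈ Finset.range (n + 2), ∑ r ∈ Finset.range p, G p q r =
      ∑ x ∈ Finset.HasAntidiagonal.antidiagonal n,
        ∑ y ∈ Finset.HasAntidiagonal.antidiagonal x.2, G (x.1 + y.1 + 1) y.2 x.1 := by
  simp only [Finset.sum_sigma']
  symm
  refine Finset.sum_of_injOn (fun z => ⟨z.1.1 + z.2.1 + 1, z.2.2, z.1.1⟩) ?_ ?_ ?_ ?_
  · rintro ⟨⟨a, b⟩, ⟨c, d⟩⟩ h ⟨⟨a', b'⟩, ⟨c', d'⟩⟩ h' e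
    simp at h h' e
    obtain ⟨e1, e2, e3⟩ := e
    obtain ⟨h1, h2⟩ := h
    obtain ⟨h3, h4⟩ := h'
    have : b = b' := by omega
    have : c = c' := by omega
    subst_vars
    simp_all
  · rintro ⟨⟨a, b⟩, ⟨c, d⟩⟩ h
    simp at h ⊢
    omega
  · rintro ⟨p, q, r⟩ h h'
    simp at h
    refine hG p q r h.2.2 fun hpq => h' ?_
    refine ⟨⟨(r, n - r), (p - r - 1, q)⟩, ?_, ?_⟩
    · simp; omega
    · simp; omega
  · intro z _
    rfl

end Coefficients

/-! ### Commutators of the coderivations in terms of coefficients -/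

section Commutator

variable {k : Type*} [Ring k] [SuperGroup k] [CommSuperRing k]
  {g : Type*} [AddCommGroup g] [Module kᵐᵒᵖ g] [SuperGroup g] [Bracket g g] [LieSuperalgebra k g]

/-- The coefficients of `φ` as a function. -/
noncomputable def coeffFun (φ : PowerSeries k) (n : ℕ) : k := PowerSeries.coeff n φ

theorem monomial_field_comm_apply {e l i j : ZMod 2} {α β : k} {a b : g}
    (hα : α ∈ SuperGroup.part e) (hβ : β ∈ SuperGroup.part l) (ha : a ∈ SuperGroup.part i)
    (hb : b ∈ SuperGroup.part j) (p q : ℕ) (s : SymAlg k g) :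
    lsmul k g α (adPow p a) (coderOf k g (lsmul k g β (adPow q b)) s) -
      sgn (e + i) (l + j) •
        lsmul k g β (adPow q b) (coderOf k g (lsmul k g α (adPow p a)) s) =
    -(∑ r ∈ Finset.range p, leftMul k g (p.choose r • (α * sgn i l • β))
        (fieldBracket (adPow r a) (adPow (p - 1 - r + q) b) s) +
      ∑ r ∈ Finset.range q, leftMul k g (q.choose r • (α * sgn i l • β))
        (fieldBracket (adPow (q - 1 - r + p) a) (adPow r b) s)) := by
  have h : ∀ (γ : k) (t : Finset ℕ) (c : ℕ → ℕ) (F : ℕ → SymAlg k g →ₗ[kᵐᵒᵖ] g),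
      lsmul k g γ (∑ r ∈ t, c r • F r) s = ∑ r ∈ t, leftMul k g (c r • γ) (F r s) := by
    intro γ t c F
    rw [map_sum, LinearMap.sum_apply]
    refine Finset.sum_congr rfl fun r _ => ?_
    rw [map_nsmul, map_nsmul]
    rfl
  rw [← h, ← h, ← LinearMap.add_apply, ← map_add, ← LinearMap.neg_apply,
    ← monomial_field_comm hα hβ ha hb p q]
  rfl

/-- The terms of exponents `p` and `q` contribute brackets of total degree `p + q - 1`, and only
those of total degree `n` are nonzero on a monomial of degree `n`. The coefficients of a given
bracket add up to a value of `feCoeff`. -/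
theorem truncField_comm {e l i j : ZMod 2} {φ ψ : PowerSeries k} (hφ : HasCoeffsIn e φ)
    (hψ : HasCoeffsIn l ψ) {a b : g} (ha : a ∈ SuperGroup.part i) (hb : b ∈ SuperGroup.part j)
    {r : ZMod 2} {n : ℕ} {s : SymAlg k g} (hs : IsMonomial k r n s) :
    truncField (n + 2) φ a (coderOf k g (truncField (n + 2) ψ b) s) -
      sgn (e + i) (l + j) •
        truncField (n + 2) ψ b (coderOf k g (truncField (n + 2) φ a) s) =
    ∑ x ∈ Finset.HasAntidiagonal.antidiagonal n,
      leftMul k g (feCoeff (coeffFun φ) (fun m => twist i (coeffFun ψ m)) x.1 x.2)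
        (fieldBracket (adPow x.1 a) (adPow x.2 b) s) := by
  have hdd : ∀ m, twist i (coeffFun ψ m) = sgn i l • coeffFun ψ m := fun m => twist_homog i (hψ m)
  simp only [hdd]
  obtain ⟨d, hd⟩ : ∃ d : ℕ → k, ∀ m, sgn i l • coeffFun ψ m = d m := ⟨_, fun _ => rfl⟩
  obtain ⟨c, hc⟩ : ∃ c : ℕ → k, ∀ m, coeffFun φ m = c m := ⟨_, fun _ => rfl⟩
  rw [show coeffFun φ = c from funext hc, show (fun m => sgn i l • coeffFun ψ m) = d from funext hd]
  have hW : ∀ p q, p + q ≠ n → fieldBracket (adPow p a) (adPow q b) s = 0 := by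
    intro p q hpq
    refine ((isHomogeneousField_adPow p ha).fieldBracket (isHomogeneousField_adPow q hb)
      (adPow_mem q hb)) r n s hs ?_
    intro h
    exact hpq (by exact_mod_cast h.symm)
  have h1 : truncField (n + 2) φ a (coderOf k g (truncField (n + 2) ψ b) s) -
      sgn (e + i) (l + j) •
        truncField (n + 2) ψ b (coderOf k g (truncField (n + 2) φ a) s) =
      ∑ p ∈ Finset.range (n + 2), ∑ q ∈ Finset.range (n + 2),
        (lsmul k g (coeffFun φ p) (adPow p a)
            (coderOf k g (lsmul k g (coeffFun ψ q) (adPow q b)) s) -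
          sgn (e + i) (l + j) • lsmul k g (coeffFun ψ q) (adPow q b)
            (coderOf k g (lsmul k g (coeffFun φ p) (adPow p a)) s)) := by
    simp only [truncField, LinearMap.sum_apply, map_sum, Finset.sum_sub_distrib,
      Finset.smul_sum]
    congr 1
    exact Finset.sum_comm
  have h2 : ∀ p q, lsmul k g (coeffFun φ p) (adPow p a)
            (coderOf k g (lsmul k g (coeffFun ψ q) (adPow q b)) s) -
          sgn (e + i) (l + j) • lsmul k g (coeffFun ψ q) (adPow q b)
            (coderOf k g (lsmul k g (coeffFun φ p) (adPow p a)) s) =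
      -(∑ r ∈ Finset.range p, leftMul k g (p.choose r • (c p * d q))
          (fieldBracket (adPow r a) (adPow (p - 1 - r + q) b) s) +
        ∑ r ∈ Finset.range q, leftMul k g (q.choose r • (c p * d q))
          (fieldBracket (adPow (q - 1 - r + p) a) (adPow r b) s)) := by
    intro p q
    rw [← hd, ← hc]
    exact monomial_field_comm_apply (α := coeffFun φ p) (β := coeffFun ψ q) (hφ p) (hψ q) ha hb
      p q s
  simp only [h1, h2, Finset.sum_neg_distrib, Finset.sum_add_distrib]
  rw [sum_range_eq_sum_antidiagonal n (fun p q r => leftMul k g (p.choose r • (c p * d q))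
    (fieldBracket (adPow r a) (adPow (p - 1 - r + q) b) s)),
    -- In the second sum the inner index runs below `q`. The same reindexing applies with `p` and
    -- `q` exchanged, and its outer antidiagonal is then swapped back.
    Finset.sum_comm (s := Finset.range (n + 2)) (t := Finset.range (n + 2)),
    sum_range_eq_sum_antidiagonal n (fun q p r => leftMul k g (q.choose r • (c p * d q))
    (fieldBracket (adPow (q - 1 - r + p) a) (adPow r b) s)),
    ← Finset.Nat.sum_antidiagonal_swap (n := n)
      (f := fun x => ∑ y ∈ Finset.HasAntidiagonal.antidiagonal x.2,
        leftMul k g ((x.1 + y.1 + 1).choose x.1 • (c y.2 * d (x.1 + y.1 + 1)))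
          (fieldBracket (adPow (x.1 + y.1 + 1 - 1 - x.1 + y.2) a) (adPow x.1 b) s))]
  · rw [← Finset.sum_add_distrib, ← Finset.sum_neg_distrib]
    refine Finset.sum_congr rfl fun x hx => ?_
    rw [feCoeff, map_neg, map_add, map_sum, map_sum, AddMonoidHom.neg_apply,
      AddMonoidHom.add_apply, AddMonoidHom.finsetSum_apply, AddMonoidHom.finsetSum_apply]
    congr 2
    · refine Finset.sum_congr rfl fun y hy => ?_
      rw [show x.1 + y.1 + 1 - 1 - x.1 + y.2 = x.2 by
        have := Finset.HasAntidiagonal.mem_antidiagonal.1 hy; omega]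
    · refine Finset.sum_congr rfl fun y hy => ?_
      have := Finset.HasAntidiagonal.mem_antidiagonal.1 hy
      simp only [Prod.fst_swap, Prod.snd_swap] at this ⊢
      rw [show x.2 + y.1 + 1 - 1 - x.2 + y.2 = x.1 by omega]
  · intro q p r hr h
    rw [hW _ _ (by omega), map_zero]
  · intro p q r hr h
    rw [hW _ _ (by omega), map_zero]

/-- The vector field of the commutator of two coderivations `Φ^a` and `Ψ^b`. -/
theorem genericPoint_superComm_coder_homog {e l i j : ZMod 2} {φ ψ : PowerSeries k}
    (hφ : HasCoeffsIn e φ) (hψ : HasCoeffsIn l ψ) {a b : g} (ha : a ∈ SuperGroup.part i)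
    (hb : b ∈ SuperGroup.part j) {r : ZMod 2} {n : ℕ} {s : SymAlg k g}
    (hs : IsMonomial k r n s) :
    genericPoint k g (superComm (coder φ a) (coder ψ b) s) =
    ∑ x ∈ Finset.HasAntidiagonal.antidiagonal n,
      leftMul k g (feCoeff (coeffFun φ) (fun m => twist i (coeffFun ψ m)) x.1 x.2)
        (fieldBracket (adPow x.1 a) (adPow x.2 b) s) := by
  have hf := field_mem hφ ha
  have hh := field_mem hψ hb
  -- On a monomial of degree `n` the inner coderivation uses its field in degrees at most `n` and
  -- has values of degree at most `n + 1`. Truncation below `n + 2` therefore changes neither the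
  -- inner nor the outer field.
  have key : ∀ {e l i j : ZMod 2} {φ ψ : PowerSeries k} {a b : g}, HasCoeffsIn e φ →
      HasCoeffsIn l ψ → a ∈ SuperGroup.part i → b ∈ SuperGroup.part j →
      field φ a (coderOf k g (field ψ b) s) =
        truncField (n + 2) φ a (coderOf k g (truncField (n + 2) ψ b) s) := by
    intro e l i j φ ψ a b hφ hψ ha hb
    rw [coderOf_eq_of_eqOn (N := n + 2) (field_mem hψ hb) (truncField_mem hψ hb (n + 2))
      (fun _ _ _ hn hs => field_eq_truncField ψ hb hn hs) (by omega) hs]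
    exact eqOn_degLT (fun j n s hn hs => field_eq_truncField φ ha hn hs)
      (coderOf_mem_degLT (truncField_mem hψ hb _) hs)
  rw [coder_eq, coder_eq, superComm_coderOf hf hh, ← LinearMap.comp_apply,
    genericPoint_comp_coderOf, LinearMap.sub_apply, LinearMap.smul_apply, LinearMap.comp_apply,
    LinearMap.comp_apply, key hφ hψ ha hb, key hψ hφ hb ha, truncField_comm hφ hψ ha hb hs]

/-- The terms of `φ` with coefficients of parity `e`. -/
noncomputable def seriesPart (e : ZMod 2) (φ : PowerSeries k) : PowerSeries k :=
  PowerSeries.mk fun n => proj e (PowerSeries.coeff n φ)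

theorem seriesPart_hasCoeffsIn (e : ZMod 2) (φ : PowerSeries k) :
    HasCoeffsIn e (seriesPart e φ) := fun n => by
  rw [seriesPart, PowerSeries.coeff_mk]; exact proj_mem _ _

theorem series_induction {P : PowerSeries k → Prop} (add : ∀ φ ψ, P φ → P ψ → P (φ + ψ))
    (hom : ∀ e φ, HasCoeffsIn e φ → P φ) (φ : PowerSeries k) : P φ := by
  have h : φ = seriesPart 0 φ + seriesPart 1 φ := by
    ext n
    rw [map_add, seriesPart, seriesPart, PowerSeries.coeff_mk, PowerSeries.coeff_mk]
    conv_lhs => rw [← sum_proj (PowerSeries.coeff n φ),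
      show (Finset.univ : Finset (ZMod 2)) = {0, 1} from rfl, Finset.sum_pair (by decide)]
  rw [h]
  exact add _ _ (hom 0 _ (seriesPart_hasCoeffsIn _ _)) (hom 1 _ (seriesPart_hasCoeffsIn _ _))

theorem coeffFun_add (φ ψ : PowerSeries k) : coeffFun (φ + ψ) = coeffFun φ + coeffFun ψ :=
  funext fun _ => map_add _ _ _

/-- Both sides are additive in `φ`, `ψ` and `b`, which reduces the claim to homogeneous data. Only
`a` stays homogeneous, as its parity enters through `twist`. -/
theorem genericPoint_superComm_coder {i : ZMod 2} (φ ψ : PowerSeries k) {a : g}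
    (ha : a ∈ SuperGroup.part i) (b : g) {r : ZMod 2} {n : ℕ} {s : SymAlg k g}
    (hs : IsMonomial k r n s) :
    genericPoint k g (superComm (coder φ a) (coder ψ b) s) =
    ∑ x ∈ Finset.HasAntidiagonal.antidiagonal n,
      leftMul k g (feCoeff (coeffFun φ) (fun m => twist i (coeffFun ψ m)) x.1 x.2)
        (fieldBracket (adPow x.1 a) (adPow x.2 b) s) := by
  induction b using homog_induction with
  | hadd b b' hb hb' =>
    simp only [coder_add_right, superComm_add_right, LinearMap.add_apply, map_add, hb, hb',
      adPow_add, fieldBracket_add, Finset.sum_add_distrib]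
  | hom j b hb =>
  induction φ using series_induction with
  | add φ φ' h h' =>
    simp only [coder_add_left, superComm_add_left, LinearMap.add_apply, map_add, h, h',
      coeffFun_add, feCoeff_add_left, AddMonoidHom.add_apply, Finset.sum_add_distrib]
  | hom e φ hφ =>
  induction ψ using series_induction with
  | add ψ ψ' h h' =>
    have hd : (fun m => twist i (coeffFun (ψ + ψ') m)) =
        (fun m => twist i (coeffFun ψ m)) + fun m => twist i (coeffFun ψ' m) :=
      funext fun m => by simp [coeffFun_add]
    simp only [coder_add_left, superComm_add_right, LinearMap.add_apply, map_add, h, h',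
      hd, feCoeff_add_right, AddMonoidHom.add_apply, Finset.sum_add_distrib]
  | hom l ψ hψ => exact genericPoint_superComm_coder_homog hφ hψ ha hb hs

/-- By additivity this follows from `superComm_coderOf`. It allows commutators to be compared
through their vector fields alone. -/
theorem superComm_coderOf_eq (f h : SymAlg k g →ₗ[kᵐᵒᵖ] g) :
    superComm (coderOf k g f) (coderOf k g h) =
      coderOf k g (genericPoint k g ∘ₗ superComm (coderOf k g f) (coderOf k g h)) := by
  induction f using homog_induction with
  | hadd a b ha hb => rw [map_add, superComm_add_left, LinearMap.comp_add, map_add, ← ha, ← hb]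
  | hom i f hf =>
  induction h using homog_induction with
  | hadd a b ha hb => rw [map_add, superComm_add_right, LinearMap.comp_add, map_add, ← ha, ← hb]
  | hom j h hh => rw [superComm_coderOf hf hh, genericPoint_comp_coderOf]

/-- The Leibniz rule for `(ad x)^n` on `[a, b]` produces binomial coefficients, so that the
coefficients of `χ(t + u)` appear. -/
theorem field_lie (χ : PowerSeries k) (a b : g) {r : ZMod 2} {n : ℕ} {s : SymAlg k g}
    (hs : IsMonomial k r n s) :
    field χ ⁅a, b⁆ s = ∑ x ∈ Finset.HasAntidiagonal.antidiagonal n,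
      leftMul k g ((x.1 + x.2).choose x.1 • PowerSeries.coeff (x.1 + x.2) χ)
        (fieldBracket (adPow x.1 a) (adPow x.2 b) s) := by
  rw [field_monomial _ _ hs, adPow_lie, LinearMap.sum_apply, map_sum]
  refine Finset.sum_congr rfl fun x hx => ?_
  rw [Finset.HasAntidiagonal.mem_antidiagonal.1 hx, LinearMap.smul_apply, map_nsmul, map_nsmul]
  rfl

/-- The commutation relation of coderivations on a homogeneous element `a`, in coefficients. -/
theorem superComm_coder_eq_iff {i : ZMod 2} (φ ψ χ : PowerSeries k) {a : g}
    (ha : a ∈ SuperGroup.part i) (b : g) :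
    superComm (coder φ a) (coder ψ b) = coder (k := k) χ ⁅a, b⁆ ↔
      ∀ (r : ZMod 2) (n : ℕ) (s : SymAlg k g), IsMonomial k r n s →
        ∑ x ∈ Finset.HasAntidiagonal.antidiagonal n,
          leftMul k g (feCoeff (coeffFun φ) (fun m => twist i (coeffFun ψ m)) x.1 x.2 -
            (x.1 + x.2).choose x.1 • PowerSeries.coeff (x.1 + x.2) χ)
            (fieldBracket (adPow x.1 a) (adPow x.2 b) s) = 0 := by
  have h1 : superComm (coder φ a) (coder ψ b) = coder (k := k) χ ⁅a, b⁆ ↔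
      genericPoint k g ∘ₗ superComm (coder φ a) (coder ψ b) = field χ ⁅a, b⁆ := by
    constructor
    · intro h
      rw [h, coder_eq, genericPoint_comp_coderOf]
    · intro h
      rw [coder_eq χ, ← h]
      exact superComm_coderOf_eq _ _
  rw [h1]
  have h2 : ∀ (r : ZMod 2) (n : ℕ) (s : SymAlg k g), IsMonomial k r n s →
      (∑ x ∈ Finset.HasAntidiagonal.antidiagonal n,
          leftMul k g (feCoeff (coeffFun φ) (fun m => twist i (coeffFun ψ m)) x.1 x.2 -
            (x.1 + x.2).choose x.1 • PowerSeries.coeff (x.1 + x.2) χ)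
            (fieldBracket (adPow x.1 a) (adPow x.2 b) s) = 0 ↔
        (genericPoint k g ∘ₗ superComm (coder φ a) (coder ψ b)) s = field χ ⁅a, b⁆ s) := by
    intro r n s hs
    simp only [map_sub, AddMonoidHom.sub_apply, Finset.sum_sub_distrib]
    rw [sub_eq_zero, field_lie χ a b hs, LinearMap.comp_apply,
      genericPoint_superComm_coder φ ψ ha b hs]
  constructor
  · intro h r n s hs
    rw [h2 r n s hs, h]
  · intro h
    exact symHom_ext_monomial fun r n s hs => (h2 r n s hs).1 (h r n s hs)

end Commutator

/-! ### Power series in two variables -/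

section SeriesCoefficients

variable {k : Type*} [Ring k]

/-- The exponent of `t^p u^q`. -/
noncomputable def bideg (p q : ℕ) : Fin 2 →₀ ℕ := Finsupp.single 0 p + Finsupp.single 1 q

theorem bideg_zero (p q : ℕ) : bideg p q 0 = p := by simp [bideg]

theorem bideg_one (p q : ℕ) : bideg p q 1 = q := by simp [bideg]

theorem eq_bideg (d : Fin 2 →₀ ℕ) : d = bideg (d 0) (d 1) := by
  ext i; fin_cases i <;> simp [bideg]

theorem bideg_eq_single_zero (p q : ℕ) : bideg p q = Finsupp.single 0 p ↔ q = 0 := by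
  simp [bideg]

theorem bideg_eq_single_one (p q : ℕ) : bideg p q = Finsupp.single 1 q ↔ p = 0 := by
  simp [bideg]

theorem coeff_mul_bideg (A B : MvPowerSeries (Fin 2) k) (p q : ℕ) :
    MvPowerSeries.coeff (bideg p q) (A * B) =
      ∑ u ∈ Finset.HasAntidiagonal.antidiagonal p, ∑ v ∈ Finset.HasAntidiagonal.antidiagonal q,
        MvPowerSeries.coeff (bideg u.1 v.1) A * MvPowerSeries.coeff (bideg u.2 v.2) B := by
  classical
  rw [MvPowerSeries.coeff_mul, ← Finset.sum_product']
  symm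
  refine Finset.sum_bij' (fun z _ => (bideg z.1.1 z.2.1, bideg z.1.2 z.2.2))
    (fun w _ => ((w.1 0, w.2 0), (w.1 1, w.2 1))) ?_ ?_ ?_ ?_ ?_
  · rintro ⟨⟨a, b⟩, ⟨c, d⟩⟩ h
    simp only [Finset.mem_product, Finset.HasAntidiagonal.mem_antidiagonal] at h ⊢
    obtain ⟨rfl, rfl⟩ := h
    ext i; fin_cases i <;> simp [bideg]
  · rintro ⟨a, b⟩ h
    simp only [Finset.mem_product, Finset.HasAntidiagonal.mem_antidiagonal] at h ⊢
    rw [← Finsupp.add_apply, ← Finsupp.add_apply, h, bideg_zero, bideg_one]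
    exact ⟨rfl, rfl⟩
  · rintro ⟨⟨a, b⟩, ⟨c, d⟩⟩ h
    simp [bideg_zero, bideg_one]
  · rintro ⟨a, b⟩ h
    simp [← eq_bideg]
  · intro _ _
    rfl

theorem coeff_inVar_zero (φ : PowerSeries k) (p q : ℕ) :
    MvPowerSeries.coeff (bideg p q) (inVar 0 φ) = if q = 0 then coeffFun φ p else 0 := by
  show (if bideg p q = Finsupp.single 0 (bideg p q 0) then coeffFun φ (bideg p q 0) else 0) = _
  simp only [bideg_zero, bideg_eq_single_zero]

theorem coeff_inVar_one (φ : PowerSeries k) (p q : ℕ) :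
    MvPowerSeries.coeff (bideg p q) (inVar 1 φ) = if p = 0 then coeffFun φ q else 0 := by
  show (if bideg p q = Finsupp.single 1 (bideg p q 1) then coeffFun φ (bideg p q 1) else 0) = _
  simp only [bideg_one, bideg_eq_single_one]

theorem coeff_inSum (φ : PowerSeries k) (p q : ℕ) :
    MvPowerSeries.coeff (bideg p q) (inSum φ) = (p + q).choose p • coeffFun φ (p + q) := by
  rw [nsmul_eq_mul]
  show ((bideg p q 0 + bideg p q 1).choose (bideg p q 0) : k) *
    coeffFun φ (bideg p q 0 + bideg p q 1) = _
  rw [bideg_zero, bideg_one]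

theorem coeff_divVar_zero (f : MvPowerSeries (Fin 2) k) (p q : ℕ) :
    MvPowerSeries.coeff (bideg p q) (divVar 0 f) = MvPowerSeries.coeff (bideg (p + 1) q) f := by
  show MvPowerSeries.coeff (bideg p q + Finsupp.single 0 1) f = _
  congr 2
  ext i; fin_cases i <;> simp [bideg]

theorem coeff_divVar_one (f : MvPowerSeries (Fin 2) k) (p q : ℕ) :
    MvPowerSeries.coeff (bideg p q) (divVar 1 f) = MvPowerSeries.coeff (bideg p (q + 1)) f := by
  show MvPowerSeries.coeff (bideg p q + Finsupp.single 1 1) f = _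
  congr 2
  ext i; fin_cases i <;> simp [bideg]

theorem sum_antidiagonal_eq_ite {A : Type*} [AddCommMonoid A] (p : ℕ) (f : ℕ × ℕ → A) :
    ∑ u ∈ Finset.HasAntidiagonal.antidiagonal p, (if u.2 = 0 then f u else 0) = f (p, 0) := by
  rw [Finset.sum_eq_single (p, 0)]
  · simp
  · rintro ⟨a, b⟩ h hne
    rw [if_neg]
    rintro rfl
    simp at h
    exact hne (by rw [h])
  · intro h
    simp at h

theorem sum_antidiagonal_eq_ite' {A : Type*} [AddCommMonoid A] (p : ℕ) (f : ℕ × ℕ → A) :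
    ∑ u ∈ Finset.HasAntidiagonal.antidiagonal p, (if u.1 = 0 then f u else 0) = f (0, p) := by
  rw [← Finset.Nat.sum_antidiagonal_swap]
  exact sum_antidiagonal_eq_ite p fun u => f u.swap

/-- A series in one variable is supported on an axis, so in each product the convolution in the
other variable collapses to a single term. -/
theorem coeff_functionalEq (φ ψ : PowerSeries k) (p q : ℕ) :
    MvPowerSeries.coeff (bideg p q) (-(divVar 1 (inSum φ - inVar 0 φ) * inVar 1 ψ) -
      inVar 0 φ * divVar 0 (inSum ψ - inVar 1 ψ)) = feCoeff (coeffFun φ) (coeffFun ψ) p q := by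
  rw [map_sub, map_neg, coeff_mul_bideg, coeff_mul_bideg]
  simp only [coeff_inVar_zero, coeff_inVar_one, coeff_divVar_one, coeff_divVar_zero, map_sub,
    coeff_inSum, mul_ite, ite_mul, mul_zero, zero_mul, Nat.succ_ne_zero, if_false, sub_zero]
  have h := fun u : ℕ × ℕ => sum_antidiagonal_eq_ite' q fun v =>
    coeffFun φ u.1 * ((u.2 + 1 + v.2).choose (u.2 + 1) • coeffFun ψ (u.2 + 1 + v.2))
  rw [Finset.sum_comm]
  simp only [sum_antidiagonal_eq_ite, h]
  rw [feCoeff, neg_add, sub_eq_add_neg]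
  congr 2
  · refine Finset.sum_congr rfl fun y _ => ?_
    rw [smul_mul_assoc, add_assoc]
  · rw [← Finset.Nat.sum_antidiagonal_swap]
    refine Finset.sum_congr rfl fun y _ => ?_
    simp only [Prod.fst_swap, Prod.snd_swap]
    rw [mul_smul_comm, show y.1 + 1 + q = q + y.1 + 1 by ring,
      Nat.choose_symm_of_eq_add (show q + y.1 + 1 = (y.1 + 1) + q by ring)]

theorem functionalEq_iff (φ ψ χ : PowerSeries k) : FunctionalEq φ ψ χ ↔
    ∀ p q, feCoeff (coeffFun φ) (coeffFun ψ) p q = (p + q).choose p • coeffFun χ (p + q) := by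
  constructor
  · intro h p q
    rw [← coeff_functionalEq, ← coeff_inSum, h]
  · intro h
    ext d
    rw [eq_bideg d, coeff_functionalEq, coeff_inSum, h]

end SeriesCoefficients

/-! ### Vanishing of the odd coefficients -/

section Evenness

variable {k : Type*} [Ring k] [SuperGroup k] [CommSuperRing k]

theorem feCoeff_mem {e l : ZMod 2} {c d : ℕ → k} (hc : ∀ n, c n ∈ SuperGroup.part e)
    (hd : ∀ n, d n ∈ SuperGroup.part l) (p q : ℕ) :
    feCoeff c d p q ∈ SuperGroup.part (e + l) :=
  neg_mem (add_mem (sum_mem fun _ _ => nsmul_mem (CommSuperRing.mul_mem (hc _) (hd _)) _)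
    (sum_mem fun _ _ => nsmul_mem (CommSuperRing.mul_mem (hc _) (hd _)) _))

theorem feCoeff_right_zero (c d : ℕ → k) (n : ℕ) : feCoeff c d n 0 =
    -((n + 1) • (c (n + 1) * d 0) +
      ∑ y ∈ Finset.HasAntidiagonal.antidiagonal n, c y.2 * d (y.1 + 1)) := by
  simp [feCoeff]

theorem feCoeff_left_zero (c d : ℕ → k) (n : ℕ) : feCoeff c d 0 n =
    -(∑ y ∈ Finset.HasAntidiagonal.antidiagonal n, c (y.1 + 1) * d y.2 +
      (n + 1) • (c 0 * d (n + 1))) := by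
  simp [feCoeff]

/-- Let `S_n = ∑_{i+j=n} c_i d_{j+1}`. Once `d_0 = 0` is known, `h2` at `(n, 0)` gives `2 S_n = 0`,
and then `h` at `(n, 0)` gives `d_n = -n c_0 d_{n+1}`. With these, `h2` at `(0, n)` gives `2 d_n =
0`. Using the recursion twice, `d_n = n (n + 1) c_0^2 d_{n+2}`, and `n (n + 1)` is even. -/
theorem odd_part_eq_zero {c d : ℕ → k} (hc : ∀ n, c n ∈ SuperGroup.part 0)
    (hd : ∀ n, d n ∈ SuperGroup.part 1)
    (h : ∀ p q, feCoeff c d p q + feCoeff d c p q = (p + q).choose p • d (p + q))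
    (h2 : ∀ p q, 2 • feCoeff c d p q = 0) (n : ℕ) : d n = 0 := by
  have comm : ∀ m n, d m * c n = c n * d m := fun m n => by
    rw [CommSuperRing.mul_comm (hd m) (hc n), sgn_zero_right, one_smul]
  -- At `(0, 0)` the two values of `feCoeff` in `h` agree by commutativity, so their sum is twice
  -- one of them.
  have h0 : d 0 = 0 := by
    have e1 := h 0 0
    have e2 := h2 0 0
    simp [feCoeff, comm] at e1 e2
    rw [← e1, ← e2]
    noncomm_ring
  set S : ℕ → k := fun n => ∑ y ∈ Finset.HasAntidiagonal.antidiagonal n, c y.2 * d (y.1 + 1)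
    with hS
  set T : ℕ → k := fun n => ∑ y ∈ Finset.HasAntidiagonal.antidiagonal n, c (y.1 + 1) * d y.2
    with hT
  -- Either end term is split off from `∑_{i+j=n+1} c_i d_j`; the one containing `d_0` is zero.
  have hTS : ∀ n, T n = S n - c 0 * d (n + 1) := by
    intro n
    have e1 := Finset.Nat.sum_antidiagonal_succ (n := n) (f := fun y => c y.1 * d y.2)
    have e2 := Finset.Nat.sum_antidiagonal_succ' (n := n) (f := fun y => c y.1 * d y.2)
    rw [e1] at e2
    have e3 : ∑ y ∈ Finset.HasAntidiagonal.antidiagonal n, c y.1 * d (y.2 + 1) = S n :=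
      (Finset.Nat.sum_antidiagonal_swap (n := n) (f := fun y => c y.1 * d (y.2 + 1))).symm
    simp only [h0, mul_zero, zero_add, add_zero, e3] at e2
    rw [← e2]
    simp only [hT]
    abel
  have hT' : ∀ n, ∑ y ∈ Finset.HasAntidiagonal.antidiagonal n, d y.2 * c (y.1 + 1) = T n :=
    fun n => Finset.sum_congr rfl fun y _ => comm _ _
  have k1 : ∀ n, 2 • S n = 0 := by
    intro n
    have e := h2 n 0
    rw [feCoeff_right_zero, h0, mul_zero, smul_zero, zero_add, smul_neg, neg_eq_zero] at e
    exact e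
  have k2 : ∀ n, d n = -(n • (c 0 * d (n + 1))) := by
    intro n
    have e := h n 0
    rw [feCoeff_right_zero, feCoeff_right_zero, h0, hT', hTS, comm, mul_zero, smul_zero, zero_add,
      add_zero, Nat.choose_self, one_smul] at e
    have e' := k1 n
    rw [two_smul] at e'
    rw [← e, add_smul, one_smul]
    linear_combination (norm := abel) -e'
  have k3 : ∀ n, 2 • d n = 0 := by
    intro n
    have e := h2 0 n
    rw [feCoeff_left_zero] at e
    have e1 : 2 • (S n - c 0 * d (n + 1) + (n + 1) • (c 0 * d (n + 1))) = 0 := by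
      rw [← hTS, ← neg_eq_zero, ← smul_neg]; exact e
    rw [k2 n, smul_neg, neg_eq_zero]
    have e' := k1 n
    rw [add_smul, one_smul] at e1
    linear_combination (norm := module) e1 - e'
  obtain ⟨m, hm⟩ := Nat.even_mul_succ_self n
  have k4 : 2 • (c 0 * d (n + 1 + 1)) = 0 := by rw [← mul_smul_comm, k3, mul_zero]
  rw [k2 n, k2 (n + 1), mul_neg, smul_neg, neg_neg, mul_smul_comm, smul_smul, hm, ← two_mul,
    mul_comm 2 m, mul_smul, ← mul_smul_comm, k4, mul_zero, smul_zero]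

/-- With `c` and `d` the even and odd parts of the coefficients, the twist replaces `c + d` by `c -
d`. The odd component of the first system, and that of the difference of the two systems, are the
hypotheses of `odd_part_eq_zero`. -/
theorem hasEvenCoeffs_of_feCoeff {φ : PowerSeries k}
    (h0 : ∀ p q, feCoeff (coeffFun φ) (coeffFun φ) p q = (p + q).choose p • coeffFun φ (p + q))
    (h1 : ∀ p q, feCoeff (coeffFun φ) (fun m => twist 1 (coeffFun φ m)) p q =
      (p + q).choose p • coeffFun φ (p + q)) : HasEvenCoeffs φ := by
  set c : ℕ → k := fun n => proj 0 (coeffFun φ n) with hc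
  set d : ℕ → k := fun n => proj 1 (coeffFun φ n) with hd
  have hc' : ∀ n, c n ∈ SuperGroup.part 0 := fun n => proj_mem 0 _
  have hd' : ∀ n, d n ∈ SuperGroup.part 1 := fun n => proj_mem 1 _
  have hφ : coeffFun φ = c + d := funext fun n => by
    conv_lhs => rw [← sum_proj (coeffFun φ n),
      show (Finset.univ : Finset (ZMod 2)) = {0, 1} from rfl, Finset.sum_pair (by decide)]
    rfl
  have htw : (fun m => twist 1 (coeffFun φ m)) + (d + d) = c + d := funext fun n => by
    show twist 1 (coeffFun φ n) + (d n + d n) = c n + d n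
    rw [hφ, Pi.add_apply, map_add, twist_homog 1 (hc' n), twist_homog 1 (hd' n), sgn_zero_right,
      sgn_one_one]
    module
  have odd : ∀ {e o : k}, e ∈ SuperGroup.part 0 → o ∈ SuperGroup.part 1 →
      proj 1 (e + o) = o := fun he ho => by
    rw [map_add, proj_of_mem_ne he (by decide), proj_of_mem ho, zero_add]
  have key := odd_part_eq_zero hc' hd' (fun p q => ?_) (fun p q => ?_)
  · intro n
    have h := hc' n
    have h' : coeffFun φ n = c n := by rw [hφ, Pi.add_apply, key n, add_zero]
    rw [← h'] at h
    exact h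
  · have e := congrArg (proj 1) (h0 p q)
    rw [hφ, feCoeff_add_left, feCoeff_add_right, feCoeff_add_right, map_nsmul, Pi.add_apply,
      odd (hc' _) (hd' _)] at e
    rw [← e, ← odd (add_mem (feCoeff_mem hc' hc' p q) (feCoeff_mem hd' hd' p q))
      (add_mem (feCoeff_mem hc' hd' p q) (feCoeff_mem hd' hc' p q))]
    congr 1
    abel
  · have e : feCoeff (c + d) (d + d) p q = 0 := by
      have e2 := feCoeff_add_right (c + d) (fun m => twist 1 (coeffFun φ m)) (d + d) p q
      rw [htw, ← hφ, h1, h0] at e2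
      rw [← hφ]
      exact left_eq_add.1 e2
    have e3 := congrArg (proj 1) e
    rw [feCoeff_add_left, feCoeff_add_right, feCoeff_add_right, map_zero, add_comm,
      odd (add_mem (feCoeff_mem hd' hd' p q) (feCoeff_mem hd' hd' p q))
      (add_mem (feCoeff_mem hc' hd' p q) (feCoeff_mem hc' hd' p q))] at e3
    rw [two_smul, e3]

end Evenness

/-! ### Associative superalgebras and their supercommutators -/

/-- Associative superalgebras over `k`. -/
class SuperAlgebra (k A : Type*) [Ring k] [SuperGroup k] [Ring A] [Module kᵐᵒᵖ A]
    [SuperGroup A] : Prop extends SuperModule k A where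
  mul_mem : ∀ {i j : ZMod 2} {a b : A},
    a ∈ SuperGroup.part i → b ∈ SuperGroup.part j → a * b ∈ SuperGroup.part (i + j)
  mul_rsmul : ∀ (a b : A) (α : k), (a * b) <• α = a * (b <• α)
  rsmul_mul : ∀ {i j : ZMod 2} (a : A) {b : A} {α : k}, b ∈ SuperGroup.part i →
    α ∈ SuperGroup.part j → (a * b) <• α = sgn i j • ((a <• α) * b)

section Commutator

/-- The group underlying the Lie superalgebra of an associative superalgebra. -/
def SuperLie (A : Type*) := A

variable {A : Type*} [Ring A] [SuperGroup A]

instance : AddCommGroup (SuperLie A) := inferInstanceAs (AddCommGroup A)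

instance : SuperGroup (SuperLie A) := inferInstanceAs (SuperGroup A)

instance {k : Type*} [Ring k] [Module kᵐᵒᵖ A] : Module kᵐᵒᵖ (SuperLie A) :=
  inferInstanceAs (Module kᵐᵒᵖ A)

/-- The supercommutator `a b - (-1) ^ (p(a) p(b)) b a`. -/
def superBr (A : Type*) [Ring A] [SuperGroup A] : A →+ A →+ A :=
  AddMonoidHom.mul (R := A) - signed (AddMonoidHom.mul (R := A)).flip

theorem superBr_homog {i j : ZMod 2} {a b : A} (ha : a ∈ SuperGroup.part i)
    (hb : b ∈ SuperGroup.part j) : superBr A a b = a * b - sgn i j • (b * a) := by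
  show a * b - signed (AddMonoidHom.mul (R := A)).flip a b = _
  rw [signed_homog _ ha hb]
  rfl

theorem superBr_even {a : A} (ha : a ∈ SuperGroup.part 0) (b : A) :
    superBr A a b = a * b - b * a := by
  induction b using homog_induction with
  | hadd x y hx hy => rw [map_add, hx, hy, mul_add, add_mul]; abel
  | hom j b hb => rw [superBr_homog ha hb, sgn_zero_left, one_smul]

instance : Bracket (SuperLie A) (SuperLie A) := ⟨fun a b => superBr A a b⟩

variable {k : Type*} [Ring k] [SuperGroup k] [Module kᵐᵒᵖ A] [SuperAlgebra k A]

theorem superBr_mem (k : Type*) [Ring k] [SuperGroup k] [Module kᵐᵒᵖ A] [SuperAlgebra k A]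
    {i j : ZMod 2} {a b : A} (ha : a ∈ SuperGroup.part i)
    (hb : b ∈ SuperGroup.part j) : superBr A a b ∈ SuperGroup.part (i + j) := by
  rw [superBr_homog ha hb]
  refine sub_mem (SuperAlgebra.mul_mem k ha hb) (zsmul_mem ?_ _)
  rw [add_comm]
  exact SuperAlgebra.mul_mem k hb ha

theorem superBr_rsmul (a b : A) (α : k) : superBr A a b <• α = superBr A a (b <• α) := by
  induction a using homog_induction with
  | hadd x y hx hy => simp only [map_add, AddMonoidHom.add_apply, smul_add, hx, hy]
  | hom i a ha =>
  induction b using homog_induction with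
  | hadd x y hx hy => simp only [map_add, smul_add, hx, hy]
  | hom j b hb =>
  induction α using homog_induction with
  | hadd x y hx hy => simp only [map_add, MulOpposite.op_add, add_smul, hx, hy]
  | hom l α hα =>
  rw [superBr_homog ha hb, superBr_homog ha (SuperModule.smul_mem hb hα), smul_sub,
    sgn_smul_rsmul, SuperAlgebra.mul_rsmul, SuperAlgebra.rsmul_mul b ha hα, smul_smul,
    sgn_add_right]

theorem rsmul_superBr {i j : ZMod 2} (a : A) {b : A} {α : k} (hb : b ∈ SuperGroup.part i)
    (hα : α ∈ SuperGroup.part j) :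
    superBr A a b <• α = sgn i j • superBr A (a <• α) b := by
  induction a using homog_induction with
  | hadd x y hx hy => simp only [map_add, AddMonoidHom.add_apply, smul_add, hx, hy]
  | hom l a ha =>
  rw [superBr_homog ha hb, superBr_homog (SuperModule.smul_mem ha hα) hb, smul_sub,
    sgn_smul_rsmul, SuperAlgebra.rsmul_mul a hb hα, SuperAlgebra.mul_rsmul, smul_sub, smul_smul,
    sgn_add_left, sgn_comm i j, mul_left_comm, sgn_mul_self, mul_one]

theorem superBr_skew {i j : ZMod 2} {a b : A} (ha : a ∈ SuperGroup.part i)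
    (hb : b ∈ SuperGroup.part j) : superBr A a b = -(sgn i j • superBr A b a) := by
  rw [superBr_homog ha hb, superBr_homog hb ha, smul_sub, sgn_comm j i, sgn_smul_smul, neg_sub]

theorem superBr_self {a : A} (ha : a ∈ SuperGroup.part 0) : superBr A a a = 0 := by
  rw [superBr_even ha, sub_self]

theorem superBr_jacobi (k : Type*) [Ring k] [SuperGroup k] [Module kᵐᵒᵖ A] [SuperAlgebra k A]
    {i j : ZMod 2} {a b : A} (c : A) (ha : a ∈ SuperGroup.part i)
    (hb : b ∈ SuperGroup.part j) : superBr A (superBr A a b) c =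
      superBr A a (superBr A b c) - sgn i j • superBr A b (superBr A a c) := by
  induction c using homog_induction with
  | hadd x y hx hy => simp only [map_add, smul_add, hx, hy]; abel
  | hom l c hc =>
  rw [superBr_homog (superBr_mem k ha hb) hc, superBr_homog ha (superBr_mem k hb hc),
    superBr_homog hb (superBr_mem k ha hc), superBr_homog ha hb, superBr_homog hb hc,
    superBr_homog ha hc]
  rcases parity_cases i with rfl | rfl <;> rcases parity_cases j with rfl | rfl <;>
    rcases parity_cases l with rfl | rfl <;>
    simp only [sgn_zero_left, sgn_zero_right, sgn_one_one, one_smul, zero_add, add_zero,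
      neg_smul, parity_one_add_one, neg_neg, sub_neg_eq_add, mul_add, add_mul, mul_sub, sub_mul,
      mul_assoc] <;> abel

theorem superBr_superBr_self (k : Type*) [Ring k] [SuperGroup k] [Module kᵐᵒᵖ A] [SuperAlgebra k A]
    {a : A} (ha : a ∈ SuperGroup.part 1) :
    superBr A a (superBr A a a) = 0 := by
  have h := superBr_mem k ha ha
  rw [superBr_homog ha h, superBr_homog ha ha, parity_one_add_one, sgn_zero_right, one_smul,
    sgn_one_one, neg_smul, one_smul, sub_neg_eq_add, mul_add, add_mul, mul_assoc, sub_self]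

instance : LieSuperalgebra k (SuperLie A) where
  smul_mem := SuperModule.smul_mem (k := k) (M := A)
  add_lie a b c := DFunLike.congr_fun (map_add (superBr A) a b) c
  lie_add a b c := map_add (superBr A a) b c
  lie_mem ha hb := superBr_mem k (A := A) ha hb
  lie_smul a b α := superBr_rsmul (A := A) a b α
  smul_lie a _ _ hb hα := rsmul_superBr (A := A) a hb hα
  skew ha hb := superBr_skew (A := A) ha hb
  lie_self ha := superBr_self (A := A) ha
  jacobi c ha hb := superBr_jacobi k (A := A) c ha hb
  lie_lie_self ha := superBr_superBr_self k (A := A) ha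

end Commutator

/-! ### Matrices over a superalgebra -/

section Matrices

variable {I R : Type*} [Ring R] [SuperGroup R]

/-- The grading of matrices by the parity of the entries. -/
noncomputable instance matrixSuperGroup : SuperGroup (Matrix I I R) :=
  SuperGroup.ofProj
    (fun i =>
      { carrier := {X | ∀ r s, X r s ∈ SuperGroup.part i}
        zero_mem' := fun _ _ => zero_mem _
        add_mem' := fun hX hY r s => add_mem (hX r s) (hY r s)
        neg_mem' := fun hX r s => neg_mem (hX r s) })
    (fun i => (proj i : R →+ R).mapMatrix)
    (fun i X r s => proj_mem i (X r s))
    (fun i X hX => by ext r s; exact proj_of_mem (hX r s))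
    (fun i j hij X hX => by ext r s; exact proj_of_mem_ne (hX r s) hij)
    (fun X => by
      ext r s
      rw [Matrix.sum_apply]
      exact sum_proj (X r s))

theorem matrix_mem_iff {i : ZMod 2} {X : Matrix I I R} :
    X ∈ SuperGroup.part i ↔ ∀ r s, X r s ∈ SuperGroup.part i := Iff.rfl

variable {k : Type*} [Ring k] [SuperGroup k] [Module kᵐᵒᵖ R] [SuperAlgebra k R] [Fintype I]
  [DecidableEq I]

instance : SuperAlgebra k (Matrix I I R) where
  smul_mem hX hα := fun r s => SuperModule.smul_mem (hX r s) hα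
  mul_mem := by
    intro i j X Y hX hY r s
    rw [Matrix.mul_apply]
    exact sum_mem fun t _ => SuperAlgebra.mul_mem k (hX r t) (hY t s)
  mul_rsmul := by
    intro X Y α
    ext r s
    rw [Matrix.smul_apply, Matrix.mul_apply, Matrix.mul_apply, Finset.smul_sum]
    exact Finset.sum_congr rfl fun t _ => SuperAlgebra.mul_rsmul _ _ _
  rsmul_mul := by
    intro i j X Y α hY hα
    ext r s
    rw [Matrix.smul_apply, Matrix.smul_apply, Matrix.mul_apply, Matrix.mul_apply,
      Finset.smul_sum, Finset.smul_sum]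
    exact Finset.sum_congr rfl fun t _ => SuperAlgebra.rsmul_mul _ (hY t s) hα

end Matrices

/-! ### An odd variable -/

section OddVariable

/-- The module `k` with the opposite parity. -/
def ParityShift (k : Type*) := k

variable {k : Type*} [Ring k] [SuperGroup k]

instance : AddCommGroup (ParityShift k) := inferInstanceAs (AddCommGroup k)

instance : Module kᵐᵒᵖ (ParityShift k) := inferInstanceAs (Module kᵐᵒᵖ k)

instance : SuperGroup (ParityShift k) :=
  SuperGroup.ofProj (M := k) (fun i => SuperGroup.part (i + 1)) (fun i => proj (i + 1))
    (fun _ => proj_mem _) (fun _ _ => proj_of_mem)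
    (fun i j hij _ hm => proj_of_mem_ne hm (by simpa using hij))
    (fun m => by
      conv_rhs => rw [← sum_proj m]
      exact Fintype.sum_equiv (Equiv.addRight 1) _ _ fun _ => rfl)

variable [CommSuperRing k]

instance : SuperModule k (ParityShift k) where
  smul_mem := by
    intro i j m α hm hα
    have h := CommSuperRing.mul_mem (k := k) (a := m) (b := α) hm hα
    rw [add_right_comm] at h
    exact h

/-- Applied to `k` with shifted parity, this provides a superalgebra with an odd element that no
nonzero scalar annihilates. -/
instance {M : Type*} [AddCommGroup M] [Module kᵐᵒᵖ M] [SuperGroup M] [SuperModule k M] :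
    SuperAlgebra k (SymAlg k M) where
  mul_mem := sym_mul_mem
  mul_rsmul a b α := mul_assoc a b (scal k M α)
  rsmul_mul := by
    intro i j a b α hb hα
    rw [rsmul_eq_mul, rsmul_eq_mul, mul_assoc, mul_assoc, scal_mul_homog hα hb, mul_smul_comm,
      sgn_comm j i, sgn_smul_smul]

end OddVariable

/-! ### Values of fields on products of even elements -/

section EvenProducts

variable {k : Type*} [Ring k] [SuperGroup k] [CommSuperRing k]
  {g : Type*} [AddCommGroup g] [Module kᵐᵒᵖ g] [SuperGroup g] [Bracket g g] [LieSuperalgebra k g]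

variable (k) in
/-- The product in `S(g)` of a list of elements of `g`. -/
noncomputable def inclProd (l : List g) : SymAlg k g := (l.map (incl k g)).prod

theorem inclProd_nil : inclProd k ([] : List g) = 1 := rfl

theorem inclProd_cons (m : g) (l : List g) :
    inclProd k (m :: l) = incl k g m * inclProd k l := by
  rw [inclProd, List.map_cons, List.prod_cons]; rfl

theorem isMonomial_inclProd {l : List g} (hl : ∀ m ∈ l, m ∈ SuperGroup.part 0) :
    IsMonomial k 0 l.length (inclProd k l) := by
  induction l with
  | nil => exact isMonomial_one
  | cons m l ih =>
    rw [inclProd_cons]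
    have h := IsMonomial.cons (hl m List.mem_cons_self)
      (ih fun x hx => hl x (List.mem_cons_of_mem m hx))
    rwa [zero_add] at h

/-- An even factor passes `G` without a sign, so `G` need not be homogeneous. -/
theorem fieldBracket_incl_mul_even (F G : SymAlg k g →ₗ[kᵐᵒᵖ] g) {m : g}
    (hm : m ∈ SuperGroup.part 0) (s : SymAlg k g) :
    fieldBracket F G (incl k g m * s) = fieldBracket (F ∘ₗ symLeft (incl k g m)) G s +
      fieldBracket F (G ∘ₗ symLeft (incl k g m)) s := by
  induction G using homog_induction with
  | hadd G H hG hH =>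
    simp only [fieldBracket_add, LinearMap.add_comp, LinearMap.add_apply, hG, hH]
    abel
  | hom i G hG => rw [fieldBracket_incl_mul F hG hm, sgn_zero_right, one_smul]

theorem zero_lie_eq (k : Type*) [Ring k] [SuperGroup k]
    {g : Type*} [AddCommGroup g] [Module kᵐᵒᵖ g] [SuperGroup g] [Bracket g g]
    [LieSuperalgebra k g] (a : g) : ⁅(0 : g), a⁆ = 0 :=
  map_zero (AddMonoidHom.mk' (fun b : g => ⁅b, a⁆) fun b c => LieSuperalgebra.add_lie k b c a)

theorem lie_zero_eq (k : Type*) [Ring k] [SuperGroup k]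
    {g : Type*} [AddCommGroup g] [Module kᵐᵒᵖ g] [SuperGroup g] [Bracket g g]
    [LieSuperalgebra k g] (a : g) : ⁅a, (0 : g)⁆ = 0 :=
  map_zero (AddMonoidHom.mk' (fun b : g => ⁅a, b⁆) (LieSuperalgebra.lie_add k a))

/-- The morphism `F` vanishes on the products of elements of `T`, one of which is in `Y`. -/
def VanishesOn (T Y : Set g) (F : SymAlg k g →ₗ[kᵐᵒᵖ] g) : Prop :=
  ∀ l : List g, (∀ m ∈ l, m ∈ T) → (∃ y ∈ l, y ∈ Y) → F (inclProd k l) = 0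

theorem VanishesOn.comp_symLeft {T Y : Set g} {F : SymAlg k g →ₗ[kᵐᵒᵖ] g}
    (hF : VanishesOn T Y F) {m : g} (hm : m ∈ T) :
    VanishesOn T Y (F ∘ₗ symLeft (incl k g m)) := by
  rintro l hl ⟨y, hy, hyY⟩
  show F (incl k g m * inclProd k l) = 0
  rw [← inclProd_cons]
  refine hF _ ?_ ⟨y, List.mem_cons_of_mem m hy, hyY⟩
  simpa using ⟨hm, hl⟩

/-- However the factors are distributed over the two fields, `F` is evaluated on a product of
elements of `T`. -/
theorem fieldBracket_inclProd_eq_zero {T : Set g} (hT : ∀ m ∈ T, m ∈ SuperGroup.part 0)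
    {F : SymAlg k g →ₗ[kᵐᵒᵖ] g} (G : SymAlg k g →ₗ[kᵐᵒᵖ] g)
    (hF : ∀ l : List g, (∀ m ∈ l, m ∈ T) → F (inclProd k l) = 0) (l : List g)
    (hl : ∀ m ∈ l, m ∈ T) :
    fieldBracket F G (inclProd k l) = 0 ∧ fieldBracket G F (inclProd k l) = 0 := by
  induction l generalizing F G with
  | nil =>
    have h : F 1 = 0 := hF [] (by simp)
    rw [inclProd_nil, fieldBracket_one, fieldBracket_one, h, zero_lie_eq k,
      lie_zero_eq k]
    exact ⟨rfl, rfl⟩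
  | cons m l ih =>
    have hm := hl m List.mem_cons_self
    have hl' : ∀ x ∈ l, x ∈ T := fun x hx => hl x (List.mem_cons_of_mem m hx)
    have hF' : ∀ l : List g, (∀ m ∈ l, m ∈ T) →
        (F ∘ₗ symLeft (incl k g m)) (inclProd k l) = 0 := by
      intro l h
      show F (incl k g m * inclProd k l) = 0
      rw [← inclProd_cons]
      exact hF _ (by simpa using ⟨hm, h⟩)
    rw [inclProd_cons, fieldBracket_incl_mul_even _ _ (hT m hm),
      fieldBracket_incl_mul_even _ _ (hT m hm), (ih G hF' hl').1, (ih _ hF hl').1,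
      (ih G hF' hl').2, (ih _ hF hl').2]
    simp

/-- The bracket of two fields on a product of two lists, each of which is killed by one field. -/
theorem fieldBracket_inclProd_append {T X Y : Set g} (hT : ∀ m ∈ T, m ∈ SuperGroup.part 0)
    (hX : X ⊆ T) (hY : Y ⊆ T) {F G : SymAlg k g →ₗ[kᵐᵒᵖ] g} (hF : VanishesOn T Y F)
    (hG : VanishesOn T X G) (xs ys : List g) (hxs : ∀ m ∈ xs, m ∈ X) (hys : ∀ m ∈ ys, m ∈ Y) :
    fieldBracket F G (inclProd k (xs ++ ys)) = ⁅F (inclProd k xs), G (inclProd k ys)⁆ := by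
  -- A factor given to the field that it kills makes this field vanish on all further products. Only
  -- the distribution of `xs` to `F` and `ys` to `G` is left.
  have key : ∀ {S : Set g} {H : SymAlg k g →ₗ[kᵐᵒᵖ] g} {m : g}, S ⊆ T → VanishesOn T S H →
      m ∈ S → ∀ l : List g, (∀ x ∈ l, x ∈ T) →
        (H ∘ₗ symLeft (incl k g m)) (inclProd k l) = 0 := by
    intro S H m hS hH hm l hl
    show H (incl k g m * inclProd k l) = 0
    rw [← inclProd_cons]
    exact hH _ (by simpa using ⟨hS hm, hl⟩) ⟨m, List.mem_cons_self, hm⟩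
  induction xs generalizing F with
  | nil =>
    rw [List.nil_append]
    induction ys generalizing G with
    | nil => exact fieldBracket_one F G
    | cons m ys ih =>
      have hm := hys m List.mem_cons_self
      have hys' : ∀ x ∈ ys, x ∈ Y := fun x hx => hys x (List.mem_cons_of_mem m hx)
      rw [inclProd_cons, fieldBracket_incl_mul_even _ _ (hT m (hY hm)),
        (fieldBracket_inclProd_eq_zero hT G (key hY hF hm) ys fun x hx => hY (hys' x hx)).1,
        zero_add]
      exact ih (hG.comp_symLeft (hY hm)) hys'
  | cons m xs ih =>
    have hm := hxs m List.mem_cons_self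
    have hxs' : ∀ x ∈ xs, x ∈ X := fun x hx => hxs x (List.mem_cons_of_mem m hx)
    rw [List.cons_append, inclProd_cons, fieldBracket_incl_mul_even _ _ (hT m (hX hm)),
      (fieldBracket_inclProd_eq_zero hT F (key hX hG hm) (xs ++ ys) fun x hx => ?_).2, add_zero,
      inclProd_cons]
    · exact ih (hF.comp_symLeft (hX hm)) hxs'
    · rcases List.mem_append.1 hx with h | h
      · exact hX (hxs' x h)
      · exact hY (hys x h)

theorem fieldBracket_constHom_inclProd (a : g) (F : SymAlg k g →ₗ[kᵐᵒᵖ] g) (l : List g)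
    (hl : ∀ m ∈ l, m ∈ SuperGroup.part 0) :
    fieldBracket (constHom k a) F (inclProd k l) = ⁅a, F (inclProd k l)⁆ := by
  induction l generalizing F with
  | nil => rw [inclProd_nil, fieldBracket_one, constHom_one]
  | cons m l ih =>
    have h1 : fieldBracket (0 : SymAlg k g →ₗ[kᵐᵒᵖ] g) F = 0 :=
      map_zero ((fieldBracketHom k g).flip F)
    rw [inclProd_cons, fieldBracket_incl_mul_even _ _ (hl m List.mem_cons_self),
      constHom_comp_symLeft, h1, LinearMap.zero_apply, zero_add,
      ih _ fun x hx => hl x (List.mem_cons_of_mem m hx)]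
    rfl

theorem adPoint_nil (F : SymAlg k g →ₗ[kᵐᵒᵖ] g) : adPoint k g F (inclProd k []) = 0 := by
  refine (fieldBracket_one _ _).trans ?_
  rw [genericPoint_one, zero_lie_eq k]

/-- In `[x, F]` the factor `m` is either inserted for `x`, whose derivative along `m` is the
constant `m`, or passed on to `F`. -/
theorem adPoint_cons (F : SymAlg k g →ₗ[kᵐᵒᵖ] g) (m : g) (l : List g)
    (hl : ∀ x ∈ m :: l, x ∈ SuperGroup.part 0) :
    adPoint k g F (inclProd k (m :: l)) = ⁅m, F (inclProd k l)⁆ +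
      adPoint k g (F ∘ₗ symLeft (incl k g m)) (inclProd k l) := by
  rw [inclProd_cons]
  refine (fieldBracket_incl_mul_even _ _ (hl m List.mem_cons_self) _).trans ?_
  rw [genericPoint_comp_symLeft,
    fieldBracket_constHom_inclProd _ _ _ fun x hx => hl x (List.mem_cons_of_mem m hx)]
  rfl

/-- If `L` is stable under bracketing with `T` and killed by `Y`, then the values of `(ad x)^n (a)`,
`a ∈ L`, on products of elements of `T` are in `L`, and vanish if a factor is in `Y`. -/
theorem adPow_inclProd_mem {T Y : Set g} (hT : ∀ m ∈ T, m ∈ SuperGroup.part 0)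
    (L : AddSubgroup g) (hTL : ∀ m ∈ T, ∀ x ∈ L, ⁅m, x⁆ ∈ L) (hYL : ∀ y ∈ Y, ∀ x ∈ L, ⁅y, x⁆ = 0)
    {a : g} (ha : a ∈ L) (n : ℕ) :
    (∀ l : List g, (∀ m ∈ l, m ∈ T) → (adPow n a : SymAlg k g →ₗ[kᵐᵒᵖ] g) (inclProd k l) ∈ L) ∧
      VanishesOn T Y (adPow n a : SymAlg k g →ₗ[kᵐᵒᵖ] g) := by
  have shift : ∀ {F : SymAlg k g →ₗ[kᵐᵒᵖ] g} {m : g} (_ : m ∈ T)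
      (_ : ∀ l : List g, (∀ m ∈ l, m ∈ T) → F (inclProd k l) ∈ L) (l : List g),
      (∀ m ∈ l, m ∈ T) → (F ∘ₗ symLeft (incl k g m)) (inclProd k l) ∈ L := by
    intro F m hm hF l hl
    show F (incl k g m * inclProd k l) ∈ L
    rw [← inclProd_cons]
    exact hF _ (by simpa using ⟨hm, hl⟩)
  have h1 : ∀ (l : List g), (∀ m ∈ l, m ∈ T) → ∀ (F : SymAlg k g →ₗ[kᵐᵒᵖ] g),
      (∀ l : List g, (∀ m ∈ l, m ∈ T) → F (inclProd k l) ∈ L) →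
      adPoint k g F (inclProd k l) ∈ L := by
    intro l
    induction l with
    | nil => intro _ F _; rw [adPoint_nil]; exact zero_mem _
    | cons m l ih =>
      intro hl F hF
      have hm := hl m List.mem_cons_self
      have hl' : ∀ x ∈ l, x ∈ T := fun x hx => hl x (List.mem_cons_of_mem m hx)
      rw [adPoint_cons _ _ _ fun x hx => hT x (hl x hx)]
      exact add_mem (hTL m hm _ (hF l hl')) (ih hl' _ (shift hm hF))
  -- If the factor `y ∈ Y` is inserted for `x`, it kills the value of `F`, which lies in `L`.
  -- Otherwise `F` is evaluated on a product still containing `y`.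
  have h2 : ∀ (l : List g), (∀ m ∈ l, m ∈ T) → (∃ y ∈ l, y ∈ Y) →
      ∀ (F : SymAlg k g →ₗ[kᵐᵒᵖ] g),
      (∀ l : List g, (∀ m ∈ l, m ∈ T) → F (inclProd k l) ∈ L) → VanishesOn T Y F →
      adPoint k g F (inclProd k l) = 0 := by
    intro l
    induction l with
    | nil => rintro _ ⟨y, hy, _⟩; simp at hy
    | cons m l ih =>
      rintro hl ⟨y, hy, hyY⟩ F hF hF'
      have hm := hl m List.mem_cons_self
      have hl' : ∀ x ∈ l, x ∈ T := fun x hx => hl x (List.mem_cons_of_mem m hx)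
      rw [adPoint_cons _ _ _ fun x hx => hT x (hl x hx)]
      rcases List.mem_cons.1 hy with rfl | hy
      · rw [hYL y hyY _ (hF l hl'), zero_add]
        refine (fieldBracket_inclProd_eq_zero hT _ (fun l hl => ?_) l hl').2
        show F (incl k g y * inclProd k l) = 0
        rw [← inclProd_cons]
        exact hF' _ (by simpa using ⟨hm, hl⟩) ⟨y, List.mem_cons_self, hyY⟩
      · rw [hF' l hl' ⟨y, hy, hyY⟩, lie_zero_eq k, zero_add]
        exact ih hl' ⟨y, hy, hyY⟩ _ (shift hm hF) (hF'.comp_symLeft hm)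
  induction n with
  | zero =>
    rw [adPow_zero]
    refine ⟨fun l _ => ?_, ?_⟩
    · cases l with
      | nil => rw [inclProd_nil, constHom_one]; exact ha
      | cons m l => rw [inclProd_cons, constHom_incl_mul]; exact zero_mem _
    · rintro l _ ⟨y, hy, _⟩
      cases l with
      | nil => simp at hy
      | cons m l => rw [inclProd_cons, constHom_incl_mul]
  | succ n ih =>
    rw [adPow_succ]
    exact ⟨fun l hl => h1 l hl _ ih.1, fun l hl hy => h2 l hl hy _ ih.1 ih.2⟩

/-- Evaluation of `(ad x)^n (a)` on a product `z_j z_(j+1) ⋯` along functionals `f_j` for which only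
one order of the factors contributes. -/
theorem adPow_inclProd_chain {C : Type*} [AddCommGroup C] (f : ℕ → g →+ C) (z : ℕ → g) (ε : ℤ)
    (B : ℕ) (hz : ∀ i, i < B → z i ∈ SuperGroup.part 0)
    (h_diag : ∀ i, i < B → ∀ x, f i ⁅z i, x⁆ = ε • f (i + 1) x)
    (h_off : ∀ i j, j < i → i < B → ∀ x, f j ⁅z i, x⁆ = 0) (a : g) (n j : ℕ) (hn : j + n ≤ B) :
    f j ((adPow n a : SymAlg k g →ₗ[kᵐᵒᵖ] g) (inclProd k ((List.range' j n).map z))) =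
      ε ^ n • f (j + n) a := by
  -- When all the indices exceed `j`, any factor inserted for the outermost `x` is killed by `f j`.
  have h0 : ∀ (n i j : ℕ), j < i → i + n ≤ B → ∀ F : SymAlg k g →ₗ[kᵐᵒᵖ] g,
      f j (adPoint k g F (inclProd k ((List.range' i n).map z))) = 0 := by
    intro n
    induction n with
    | zero => intro i j _ _ F; rw [List.range'_zero, List.map_nil, adPoint_nil, map_zero]
    | succ n ih =>
      intro i j hij hi F
      have hev : ∀ x ∈ (List.range' i (n + 1)).map z, x ∈ SuperGroup.part 0 := by
        intro x hx
        obtain ⟨l, hl, rfl⟩ := List.mem_map.1 hx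
        have := List.mem_range'_1.1 hl
        exact hz l (by omega)
      rw [List.range'_succ, List.map_cons] at hev ⊢
      rw [adPoint_cons _ _ _ hev, map_add, h_off i j hij (by omega), zero_add]
      exact ih (i + 1) j (by omega) (by omega) _
  induction n generalizing j with
  | zero =>
    rw [adPow_zero, List.range'_zero, List.map_nil, inclProd_nil, constHom_one, pow_zero,
      one_smul]; rfl
  | succ n ih =>
    have hev : ∀ x ∈ (List.range' j (n + 1)).map z, x ∈ SuperGroup.part 0 := by
      intro x hx
      obtain ⟨l, hl, rfl⟩ := List.mem_map.1 hx
      have := List.mem_range'_1.1 hl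
      exact hz l (by omega)
    rw [List.range'_succ, List.map_cons] at hev ⊢
    -- Only the term with `z j` in the outermost bracket survives, and it passes from `f j` to `f (j
    -- + 1)`.
    rw [adPow_succ, adPoint_cons _ _ _ hev, map_add, h_diag j (by omega),
      h0 n (j + 1) j (by omega) (by omega), add_zero, ih (j + 1) (by omega), smul_smul, pow_succ',
      show j + 1 + n = j + (n + 1) by omega]

end EvenProducts

/-! ### Entries of brackets of matrices -/

section MatrixLie

variable {k : Type*} [Ring k] [SuperGroup k] [CommSuperRing k]
  {R : Type*} [Ring R] [SuperGroup R] [Module kᵐᵒᵖ R] [SuperAlgebra k R]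
  {I : Type*} [Fintype I] [DecidableEq I]

/-- The matrix of an element of the matrix Lie superalgebra. -/
def entry (s t : I) : SuperLie (Matrix I I R) →+ R :=
  AddMonoidHom.mk' (fun X => (show Matrix I I R from X) s t) fun _ _ => rfl

/-- An elementary matrix, as an element of the matrix Lie superalgebra. -/
def elem (s t : I) (c : R) : SuperLie (Matrix I I R) := Matrix.single s t c

theorem entry_elem (s t : I) (c : R) (s' t' : I) :
    entry s' t' (elem s t c) = if s = s' ∧ t = t' then c else 0 :=
  Matrix.single_apply (i := s) (j := t) c s' t'

theorem superLie_ext {X Y : SuperLie (Matrix I I R)} (h : ∀ s t, entry s t X = entry s t Y) :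
    X = Y :=
  Matrix.ext h

theorem elem_mem {i : ZMod 2} {c : R} (hc : c ∈ SuperGroup.part i) (s t : I) :
    elem s t c ∈ SuperGroup.part (M := SuperLie (Matrix I I R)) i := by
  refine matrix_mem_iff.2 fun s' t' => ?_
  show entry s' t' (elem s t c) ∈ _
  rw [entry_elem]
  split_ifs
  · exact hc
  · exact zero_mem _

theorem entry_elem_lie (h1 : (1 : R) ∈ SuperGroup.part 0) (s t : I)
    (X : SuperLie (Matrix I I R)) (s' t' : I) :
    entry s' t' ⁅elem s t (1 : R), X⁆ =
      (if s = s' then entry t t' X else 0) - if t = t' then entry s' s X else 0 := by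
  have h : ⁅elem s t (1 : R), X⁆ = Matrix.single s t (1 : R) * (show Matrix I I R from X) -
      (show Matrix I I R from X) * Matrix.single s t (1 : R) :=
    superBr_even (A := Matrix I I R) (elem_mem h1 s t) X
  have e : entry s' t' ⁅elem s t (1 : R), X⁆ =
      (Matrix.single s t (1 : R) * (show Matrix I I R from X)) s' t' -
      ((show Matrix I I R from X) * Matrix.single s t (1 : R)) s' t' := by
    rw [h]; rfl
  rw [e]
  congr 1
  · split_ifs with h
    · subst h
      rw [Matrix.single_mul_apply_same, one_mul]; rfl
    · rw [Matrix.single_mul_apply_of_ne _ _ _ _ _ (Ne.symm h)]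
  · split_ifs with h
    · subst h
      rw [Matrix.mul_single_apply_same, mul_one]; rfl
    · rw [Matrix.mul_single_apply_of_ne _ _ _ _ _ (Ne.symm h)]

/-- With `Y` even the supercommutator is the ordinary commutator for either parity of `X`. In the
application `X` comes from `a` and `Y` from the even element `b`. -/
theorem entry_lie {i : ZMod 2} {X Y : SuperLie (Matrix I I R)} (hX : X ∈ SuperGroup.part i)
    (hY : Y ∈ SuperGroup.part 0) (s t : I) :
    entry s t ⁅X, Y⁆ = ∑ r, entry s r X * entry r t Y - ∑ r, entry s r Y * entry r t X := by
  have h : ⁅X, Y⁆ = (show Matrix I I R from X) * (show Matrix I I R from Y) -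
      (show Matrix I I R from Y) * (show Matrix I I R from X) := by
    refine (superBr_homog (A := Matrix I I R) hX hY).trans ?_
    rw [sgn_zero_right, one_smul]
  rw [h]
  show ((show Matrix I I R from X) * (show Matrix I I R from Y)) s t -
    ((show Matrix I I R from Y) * (show Matrix I I R from X)) s t = _
  rw [Matrix.mul_apply, Matrix.mul_apply]
  rfl

theorem entry_leftMul (α : k) (X : SuperLie (Matrix I I R)) (s t : I) :
    entry s t (leftMul k _ α X) = leftMul k R α (entry s t X) := by
  induction X using homog_induction with
  | hadd X Y hX hY => simp only [map_add, hX, hY]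
  | hom i X hX =>
  induction α using homog_induction with
  | hadd α β hα hβ => simp only [map_add, AddMonoidHom.add_apply, hα, hβ]
  | hom j α hα =>
    rw [leftMul_homog hα hX, leftMul_homog hα (show entry s t X ∈ _ from hX s t), map_zsmul]
    rfl

end MatrixLie

/-! ### A matrix Lie superalgebra that isolates one coefficient -/

section Detection

/-- If the commutation relation holds in every Lie superalgebra for `a` of parity `i`, and an
element of parity `i` of a superalgebra has no nonzero annihilating scalars, then the coefficients
of both sides of the functional equation agree. -/
theorem feCoeff_eq_of_superComm {k : Type u} [Ring k] [SuperGroup k] [CommSuperRing k]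
    {R : Type u} [Ring R] [SuperGroup R] [Module kᵐᵒᵖ R] [SuperAlgebra k R]
    (h1 : (1 : R) ∈ SuperGroup.part 0) {i : ZMod 2} {r : R} (hr : r ∈ SuperGroup.part i)
    (hann : ∀ α : k, leftMul k R α r = 0 → α = 0) (φ ψ χ : PowerSeries k)
    (H : ∀ (g : Type (max u v)) [AddCommGroup g] [Module kᵐᵒᵖ g] [SuperGroup g]
      [Bracket g g] [LieSuperalgebra k g] (a b : g), a ∈ SuperGroup.part (M := g) i →
      superComm (coder φ a) (coder ψ b) = coder (k := k) χ ⁅a, b⁆) (p q : ℕ) :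
    feCoeff (coeffFun φ) (fun m => twist i (coeffFun ψ m)) p q =
      (p + q).choose p • coeffFun χ (p + q) := by
  -- The vertices `0, …, p + q + 2` form a path with edges `e n` from `n` to `n + 1`. The matrices
  -- `a` and `b` sit on the edges `p` and `p + 1`, with `p` edges before and `q` edges after them.
  -- The lift places the matrices in the required universe.
  let I : Type v := ULift.{v} (Fin (p + q + 3))
  let vtx : ℕ → I := fun n => ULift.up (Fin.ofNat (p + q + 3) n)
  let lev : I → ℕ := fun x => x.down.val
  have hlev : ∀ n, n < p + q + 3 → lev (vtx n) = n := fun n hn => Nat.mod_eq_of_lt hn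
  have hvtx : ∀ m n, m < p + q + 3 → n < p + q + 3 → (vtx m = vtx n ↔ m = n) := fun m n hm hn =>
    ⟨fun h => by rw [← hlev m hm, ← hlev n hn, h], fun h => h ▸ rfl⟩
  let g : Type (max u v) := SuperLie (Matrix I I R)
  let e : ℕ → g := fun n => elem (vtx n) (vtx (n + 1)) 1
  have he : ∀ n, e n ∈ SuperGroup.part 0 := fun n => elem_mem h1 _ _
  have he_lie : ∀ n (X : g) (s t : I), entry s t ⁅e n, X⁆ =
      (if vtx n = s then entry (vtx (n + 1)) t X else 0) -
        if vtx (n + 1) = t then entry s (vtx n) X else 0 := fun n X s t =>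
    entry_elem_lie h1 _ _ X s t
  let a : g := elem (vtx p) (vtx (p + 1)) r
  let b : g := e (p + 1)
  have ha : a ∈ SuperGroup.part i := elem_mem hr _ _
  have hb : b ∈ SuperGroup.part 0 := he _
  -- matrices supported on a set of vertices
  let supp : (ℕ → Prop) → AddSubgroup g := fun P =>
    { carrier := {X | ∀ s t, ¬ (P (lev s) ∧ P (lev t)) → entry s t X = 0}
      zero_mem' := fun s t _ => map_zero (entry s t)
      add_mem' := fun hX hY s t h => by rw [map_add, hX s t h, hY s t h, add_zero]
      neg_mem' := fun hX s t h => by rw [map_neg, hX s t h, neg_zero] }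
  have supp_kill : ∀ (P : ℕ → Prop) (n : ℕ), n + 1 < p + q + 3 → ¬ P n → ¬ P (n + 1) →
      ∀ X ∈ supp P, ⁅e n, X⁆ = 0 := by
    intro P n hn h h' X hX
    refine superLie_ext fun s t => ?_
    rw [he_lie, map_zero, hX _ _ (fun h'' => h' (hlev (n + 1) hn ▸ h''.1)),
      hX _ _ (fun h'' => h (hlev n (by omega) ▸ h''.2))]
    simp
  have supp_stable : ∀ (P : ℕ → Prop) (n : ℕ), n + 1 < p + q + 3 → P n → P (n + 1) →
      ∀ X ∈ supp P, ⁅e n, X⁆ ∈ supp P := by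
    intro P n hn h h' X hX s t hst
    rw [he_lie]
    have c1 : (if vtx n = s then entry (vtx (n + 1)) t X else 0) = 0 := by
      split_ifs with hs
      · refine hX _ _ fun h'' => hst ⟨?_, h''.2⟩
        rw [← hs, hlev n (by omega)]; exact h
      · rfl
    have c2 : (if vtx (n + 1) = t then entry s (vtx n) X else 0) = 0 := by
      split_ifs with hs
      · refine hX _ _ fun h'' => hst ⟨h''.1, ?_⟩
        rw [← hs, hlev (n + 1) hn]; exact h'
      · rfl
    rw [c1, c2, sub_zero]
  have supp_elem : ∀ (P : ℕ → Prop) (n : ℕ) (c : R), n + 1 < p + q + 3 → P n → P (n + 1) →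
      (elem (vtx n) (vtx (n + 1)) c : g) ∈ supp P := by
    intro P n c hn h h' s t hst
    rw [entry_elem, if_neg]
    rintro ⟨rfl, rfl⟩
    exact hst ⟨(hlev n (by omega)).symm ▸ h, (hlev (n + 1) hn).symm ▸ h'⟩
  let X : Set g := {m | ∃ n, n < p ∧ m = e n}
  let Y : Set g := {m | ∃ n, p + 2 ≤ n ∧ n < p + q + 2 ∧ m = e n}
  have hT : ∀ m ∈ X ∪ Y, m ∈ SuperGroup.part 0 := by
    rintro m (⟨n, _, rfl⟩ | ⟨n, _, _, rfl⟩) <;> exact he n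
  -- The two blocks of vertices meet only in `p + 1`. The first contains `a` and is killed by the
  -- edges in `Y`; the second contains `b` and is killed by the edges in `X`.
  let L := supp (· ≤ p + 1)
  let K := supp (p + 1 ≤ ·)
  have hYL : ∀ y ∈ Y, ∀ x ∈ L, ⁅y, x⁆ = 0 := by
    rintro _ ⟨n, h, h', rfl⟩ x hx
    exact supp_kill (· ≤ p + 1) n (by omega) (by omega) (by omega) x hx
  have hXK : ∀ y ∈ X, ∀ x ∈ K, ⁅y, x⁆ = 0 := by
    rintro _ ⟨n, h, rfl⟩ x hx
    exact supp_kill (p + 1 ≤ ·) n (by omega) (by omega) (by omega) x hx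
  have hTL : ∀ m ∈ X ∪ Y, ∀ x ∈ L, ⁅m, x⁆ ∈ L := by
    rintro m (⟨n, h, rfl⟩ | hm) x hx
    · exact supp_stable (· ≤ p + 1) n (by omega) (by omega) (by omega) x hx
    · rw [hYL m hm x hx]; exact zero_mem _
  have hTK : ∀ m ∈ X ∪ Y, ∀ x ∈ K, ⁅m, x⁆ ∈ K := by
    rintro m (hm | ⟨n, h, h', rfl⟩) x hx
    · rw [hXK m hm x hx]; exact zero_mem _
    · exact supp_stable (p + 1 ≤ ·) n (by omega) (by omega) (by omega) x hx
  have haL : a ∈ L := supp_elem (· ≤ p + 1) p r (by omega) (by omega) (by omega)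
  have hbK : b ∈ K := supp_elem (p + 1 ≤ ·) (p + 1) 1 (by omega) (by omega) (by omega)
  have hA := adPow_inclProd_mem (k := k) hT L hTL hYL haL
  have hB := adPow_inclProd_mem (k := k) hT K hTK hXK hbK
  -- The factors are listed from the outermost bracket inwards: `e 0, …, e (p - 1)` prolong `a` to
  -- the left, and `e (p + q + 1), …, e (p + 2)` prolong `b` to the right.
  let xs : List g := (List.range' 0 p).map e
  let ys : List g := (List.range' 0 q).map fun n => e (p + q + 1 - n)
  have hxs : ∀ m ∈ xs, m ∈ X := by
    intro m hm
    obtain ⟨n, hn, rfl⟩ := List.mem_map.1 hm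
    have := List.mem_range'_1.1 hn
    exact ⟨n, by omega, rfl⟩
  have hys : ∀ m ∈ ys, m ∈ Y := by
    intro m hm
    obtain ⟨n, hn, rfl⟩ := List.mem_map.1 hm
    have := List.mem_range'_1.1 hn
    exact ⟨p + q + 1 - n, by omega, by omega, rfl⟩
  have hxT : ∀ m ∈ xs, m ∈ X ∪ Y := fun m hm => Or.inl (hxs m hm)
  have hyT : ∀ m ∈ ys, m ∈ X ∪ Y := fun m hm => Or.inr (hys m hm)
  have hmx := isMonomial_inclProd (k := k) fun m hm => hT m (hxT m hm)
  have hmy := isMonomial_inclProd (k := k) fun m hm => hT m (hyT m hm)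
  have hlx : xs.length = p := by simp [xs]
  have hly : ys.length = q := by simp [ys]
  have hmono : IsMonomial k 0 (p + q) (inclProd k (xs ++ ys)) := by
    have h := isMonomial_inclProd (k := k) (l := xs ++ ys) (by
      intro m hm
      rcases List.mem_append.1 hm with h | h
      · exact hT m (hxT m h)
      · exact hT m (hyT m h))
    rwa [List.length_append, hlx, hly] at h
  have hmain := (superComm_coder_eq_iff φ ψ χ ha b).1 (H g a b ha) 0 (p + q) _ hmono
  have hval : ∀ p' q', fieldBracket (adPow p' a) (adPow q' b) (inclProd k (xs ++ ys)) =
      ⁅(adPow p' a : SymAlg k g →ₗ[kᵐᵒᵖ] g) (inclProd k xs),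
        (adPow q' b : SymAlg k g →ₗ[kᵐᵒᵖ] g) (inclProd k ys)⁆ := fun p' q' =>
    fieldBracket_inclProd_append hT Set.subset_union_left Set.subset_union_right
      (hA p').2 (hB q').2 xs ys hxs hys
  -- The field `(ad x)^p' (a)` vanishes on the product of the `p` factors `xs` unless `p' = p`.
  rw [Finset.sum_eq_single (p, q)] at hmain
  rotate_left
  · rintro ⟨p', q'⟩ hpq hne
    have hpq := Finset.HasAntidiagonal.mem_antidiagonal.1 hpq
    have hp : p' ≠ p := fun h => hne (Prod.ext h (by simp only at hpq ⊢; omega))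
    rw [hval, isHomogeneousField_adPow p' ha _ _ _ hmx (by rw [hlx]; exact_mod_cast hp.symm),
      zero_lie_eq k, map_zero]
  · intro h
    exact (h (Finset.HasAntidiagonal.mem_antidiagonal.2 rfl)).elim
  rw [hval] at hmain
  have hWA := adPow_mem (k := k) p ha _ _ hmx.mem
  have hWB := adPow_mem (k := k) q hb _ _ hmy.mem
  -- The only contribution is `[e 0, [e 1, …, [e (p - 1), a]]]`. Each bracket moves the row index
  -- one step to the left without a sign.
  have eA : entry (vtx 0) (vtx (p + 1))
      ((adPow p a : SymAlg k g →ₗ[kᵐᵒᵖ] g) (inclProd k xs)) = r := by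
    refine (adPow_inclProd_chain (k := k) (fun j => entry (vtx j) (vtx (p + 1))) e 1 p (fun n _ => he n)
      ?_ ?_ a p 0 (by omega)).trans ?_
    · intro n hn x
      rw [he_lie, if_pos rfl, if_neg (by rw [hvtx _ _ (by omega) (by omega)]; omega), sub_zero,
        one_smul]
    · intro n j hj hn x
      rw [he_lie, if_neg (by rw [hvtx _ _ (by omega) (by omega)]; omega),
        if_neg (by rw [hvtx _ _ (by omega) (by omega)]; omega), sub_zero]
    · rw [one_pow, one_smul, zero_add, entry_elem, if_pos ⟨rfl, rfl⟩]
  -- On this side the edges multiply from the right in the commutator, so each bracket contributes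
  -- the factor `-1`.
  have eB : entry (vtx (p + 1)) (vtx (p + q + 2))
      ((adPow q b : SymAlg k g →ₗ[kᵐᵒᵖ] g) (inclProd k ys)) = (-1 : ℤ) ^ q • (1 : R) := by
    refine (adPow_inclProd_chain (k := k) (fun j => entry (vtx (p + 1)) (vtx (p + q + 2 - j)))
      (fun n => e (p + q + 1 - n)) (-1) q (fun n _ => he _) ?_ ?_ b q 0 (by omega)).trans ?_
    · intro n hn x
      rw [he_lie, if_neg (by rw [hvtx _ _ (by omega) (by omega)]; omega),
        if_pos (by rw [hvtx _ _ (by omega) (by omega)]; omega), zero_sub, neg_smul, one_smul,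
        show p + q + 2 - (n + 1) = p + q + 1 - n by omega]
    · intro n j hj hn x
      rw [he_lie, if_neg (by rw [hvtx _ _ (by omega) (by omega)]; omega),
        if_neg (by rw [hvtx _ _ (by omega) (by omega)]; omega), sub_zero]
    · rw [zero_add, entry_elem, if_pos ⟨rfl, by rw [hvtx _ _ (by omega) (by omega)]; omega⟩]
  -- In this corner entry the supports leave a single product, the one through the common vertex `p
  -- + 1`. It equals `± r`, so `hann` applies to the difference of the coefficients.
  have hent := congrArg (entry (vtx 0) (vtx (p + q + 2))) hmain
  rw [entry_leftMul, entry_lie (zero_add i ▸ hWA) (zero_add (0 : ZMod 2) ▸ hWB), map_zero,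
    Finset.sum_eq_single (vtx (p + 1)), eA, eB, Finset.sum_eq_zero, sub_zero, mul_smul_comm,
    mul_one, map_zsmul] at hent
  · refine sub_eq_zero.1 (hann _ ?_)
    rcases neg_one_pow_eq_or ℤ q with h | h <;> rw [h] at hent
    · rwa [one_smul] at hent
    · rwa [neg_smul, one_smul, neg_eq_zero] at hent
  · intro s _
    rw [(hB q).1 ys hyT (vtx 0) s (fun h => by have := h.1; rw [hlev 0 (by omega)] at this; omega),
      zero_mul]
  · intro s _ hs
    by_cases h : lev s ≤ p + 1
    · rw [(hB q).1 ys hyT s (vtx (p + q + 2)) (fun h' => hs ?_), mul_zero]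
      have e1 : lev s = p + 1 := le_antisymm h h'.1
      refine ULift.ext _ _ (Fin.ext ?_)
      exact e1.trans (hlev (p + 1) (by omega)).symm
    · rw [(hA p).1 xs hxT (vtx 0) s (fun h' => h h'.2), zero_mul]
  · intro h
    exact absurd (Finset.mem_univ _) h

variable {k : Type*} [Ring k] [SuperGroup k] [CommSuperRing k]

theorem leftMul_one_eq_zero {M : Type*} [AddCommGroup M] [Module kᵐᵒᵖ M] [SuperGroup M]
    [SuperModule k M] (α : k) (h : leftMul k (SymAlg k M) α 1 = 0) : α = 0 := by
  have e : leftMul k (SymAlg k M) α 1 = scal k M α := by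
    clear h
    induction α using homog_induction with
    | hadd α β hα hβ => simp only [map_add, AddMonoidHom.add_apply, hα, hβ]
    | hom i α hα => rw [leftMul_homog hα one_mem_symAlg, sgn_zero_right, one_smul, scal_eq_one_smul]
  rw [← counit_scal (M := M) α, ← e, h, map_zero]

variable (k) in
/-- The odd generator of the symmetric algebra of the shifted module `k`. -/
noncomputable def oddVar : SymAlg k (ParityShift k) := incl k (ParityShift k) (show ParityShift k from (1 : k))

theorem oddVar_mem : oddVar k ∈ SuperGroup.part 1 :=
  incl_mem (show (1 : k) ∈ SuperGroup.part (1 + 1) from CommSuperRing.one_mem)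

/-- Up to sign, `α θ` is `θ α` for the odd generator `θ`. Since `θ` is a free generator of the
shifted module, the generic point reads off `± α`. -/
theorem leftMul_oddVar_eq_zero (α : k) (h : leftMul k (SymAlg k (ParityShift k)) α (oddVar k) = 0) :
    α = 0 := by
  have e : genericPoint k (ParityShift k) (leftMul k _ α (oddVar k)) = (twist 1 α : k) := by
    clear h
    induction α using homog_induction with
    | hadd α β hα hβ =>
      rw [map_add, AddMonoidHom.add_apply, map_add, hα, hβ, map_add]; rfl
    | hom i α hα =>
      rw [leftMul_homog hα oddVar_mem, map_zsmul, map_smul, oddVar, genericPoint_incl]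
      show sgn i 1 • (show k from _) = _
      rw [twist_homog 1 hα, sgn_comm 1 i]
      refine congrArg (sgn i 1 • ·) ?_
      exact one_mul α
  have h2 : ∀ β : k, twist 1 (twist 1 β) = β := by
    intro β
    induction β using homog_induction with
    | hadd α β hα hβ => rw [map_add, map_add, hα, hβ]
    | hom i β hβ => rw [twist_homog 1 hβ, map_zsmul, twist_homog 1 hβ, sgn_smul_smul]
  rw [h, map_zero] at e
  rw [← h2 α, ← e]
  exact map_zero _

end Detection

/-! ### Sufficiency: linearity in `a` and the representation -/

section Linearity

variable {k : Type*} [Ring k] [SuperGroup k] [CommSuperRing k]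
  {g : Type*} [AddCommGroup g] [Module kᵐᵒᵖ g] [SuperGroup g] [Bracket g g] [LieSuperalgebra k g]

/-- The constant `a α` evaluated on `s` is the constant `a` evaluated on `α s`. The operator `ad x`
preserves this relation, because in the bracket the scalar is absorbed by the second field. -/
theorem adPow_smul (n : ℕ) (a : g) {j : ZMod 2} {α : k} (hα : α ∈ SuperGroup.part j) :
    (adPow n (a <• α) : SymAlg k g →ₗ[kᵐᵒᵖ] g) = adPow n a ∘ₗ symLeft (scal k g α) := by
  refine LinearMap.ext fun s => ?_
  show adPow n (a <• α) s = adPow n a (scal k g α * s)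
  induction n generalizing s with
  | zero =>
    show a <• α <• counit k g s = a <• counit k g (scal k g α * s)
    rw [map_mul, counit_scal, op_smul_op_smul]
  | succ n ih =>
    rw [adPow_succ, adPow_succ]
    refine Eq.trans ?_ (fieldBracket_scal_mul _ _ hα s).symm
    rw [show adPow n a ∘ₗ symLeft (scal k g α) = adPow n (a <• α) from
      LinearMap.ext fun s => (ih s).symm]
    rfl

theorem field_smul (φ : PowerSeries k) (a : g) {j : ZMod 2} {α : k}
    (hα : α ∈ SuperGroup.part j) : field φ (a <• α) = field φ a ∘ₗ symLeft (scal k g α) := by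
  refine symHom_ext_monomial fun i n s hs => ?_
  have h : field φ a (s * scal k g α) =
      leftMul k g (PowerSeries.coeff n φ) (adPow n a (s * scal k g α)) :=
    field_monomial φ a (hs.mul_scal hα)
  show field φ (a <• α) s = field φ a (scal k g α * s)
  rw [field_monomial φ _ hs, adPow_smul n a hα]
  show leftMul k g _ (adPow n a (scal k g α * s)) = _
  rw [scal_mul_homog hα hs.mem, map_zsmul, map_zsmul, map_zsmul, h]

theorem coder_smul (φ : PowerSeries k) {i j : ZMod 2} (a : g) {α : k} {s : SymAlg k g}
    (hs : s ∈ SuperGroup.part i) (hα : α ∈ SuperGroup.part j) :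
    coder φ (a <• α) s = sgn i j • (coder φ a s <• α) := by
  rw [coder_eq, coder_eq, field_smul φ a hα, ← coderOf_scal_mul _ hα, scal_mul_homog hα hs,
    sgn_comm j i]
  refine (map_zsmul (coderOf k g (field φ a)) _ _).trans (congrArg (sgn i j • ·) ?_)
  exact map_smul (coderOf k g (field φ a)) (MulOpposite.op α) s

/-- The functional equation implies the commutation relation of the coderivations. -/
theorem superComm_coder_of_functionalEq {φ ψ χ : PowerSeries k} (hψ : HasEvenCoeffs ψ)
    (h : FunctionalEq φ ψ χ) (a b : g) :
    superComm (coder φ a) (coder ψ b) = coder (k := k) χ ⁅a, b⁆ := by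
  induction a using homog_induction with
  | hadd x y hx hy =>
    rw [coder_add_right, superComm_add_left, hx, hy, LieSuperalgebra.add_lie k, coder_add_right]
  | hom i a ha =>
    refine (superComm_coder_eq_iff φ ψ χ ha b).2 fun r n s _ => Finset.sum_eq_zero fun x _ => ?_
    -- Even coefficients are fixed by the twist, so for either parity of `a` the condition is the
    -- functional equation itself.
    have ht : (fun m => twist i (coeffFun ψ m)) = coeffFun ψ := funext fun m =>
      (twist_homog i (hψ m)).trans (by rw [sgn_zero_right, one_smul]; rfl)
    rw [ht, (functionalEq_iff φ ψ χ).1 h, coeffFun, sub_self, map_zero, AddMonoidHom.zero_apply]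

theorem isCoderivationRep_coder {φ : PowerSeries k} (hφ : HasEvenCoeffs φ)
    (h : FunctionalEq φ φ φ) : IsCoderivationRep fun a : g => coder (k := k) φ a where
  map_add := coder_add_right φ
  map_smul a _ _ hs hα := coder_smul φ a hs hα
  map_mem := by
    intro i a ha
    have h := coderOf_mem (field_mem (e := 0) hφ ha)
    rwa [zero_add] at h
  map_lie a b := (superComm_coder_of_functionalEq hφ h a b).symm
  coderivation a := isCoderivation_coderOf (field φ a)

end Linearity

/-! ### Necessity: the functional equation and evenness -/

section Converse

variable {k : Type u} [Ring k] [SuperGroup k] [CommSuperRing k]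

/-- The detecting element is `r = 1`; as it is even, the twist is trivial. -/
theorem functionalEq_of_superComm (φ ψ χ : PowerSeries k)
    (H : ∀ (g : Type (max u v)) [AddCommGroup g] [Module kᵐᵒᵖ g] [SuperGroup g]
      [Bracket g g] [LieSuperalgebra k g] (a b : g),
      superComm (coder φ a) (coder ψ b) = coder (k := k) χ ⁅a, b⁆) : FunctionalEq φ ψ χ := by
  refine (functionalEq_iff φ ψ χ).2 fun p q => ?_
  have h := feCoeff_eq_of_superComm.{u, v} (one_mem_symAlg (k := k) (M := ParityShift k))
    one_mem_symAlg leftMul_one_eq_zero φ ψ χ (fun g _ _ _ _ _ a b _ => H g a b) p q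
  have ht : (fun m => twist 0 (coeffFun ψ m)) = coeffFun ψ := funext fun m => by
    generalize coeffFun ψ m = β
    induction β using homog_induction with
    | hadd x y hx hy => rw [map_add, hx, hy]
    | hom i β hβ => rw [twist_homog 0 hβ, sgn_zero_left, one_smul]
  rwa [ht] at h

/-- The even element `1` gives the functional equation and the odd variable gives its twisted form.
Both are needed in order to separate the odd coefficients. -/
theorem hasEvenCoeffs_of_superComm (φ : PowerSeries k)
    (H : ∀ (g : Type (max u v)) [AddCommGroup g] [Module kᵐᵒᵖ g] [SuperGroup g]
      [Bracket g g] [LieSuperalgebra k g] (a b : g),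
      superComm (coder φ a) (coder φ b) = coder (k := k) φ ⁅a, b⁆) : HasEvenCoeffs φ :=
  hasEvenCoeffs_of_feCoeff
    ((functionalEq_iff φ φ φ).1 (functionalEq_of_superComm.{u, v} φ φ φ H))
    (feCoeff_eq_of_superComm.{u, v} (one_mem_symAlg (k := k) (M := ParityShift k))
      oddVar_mem leftMul_oddVar_eq_zero φ φ φ (fun g _ _ _ _ _ a b _ => H g a b))

end Converse

end SuperSym

theorem mainTheorem2 {k : Type u} [Ring k] [SuperSym.SuperGroup k] [SuperSym.CommSuperRing k] :
    (∀ φ ψ χ : PowerSeries k, SuperSym.HasEvenCoeffs φ → SuperSym.HasEvenCoeffs ψ →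
      SuperSym.HasEvenCoeffs χ →
      ((∀ (g : Type (max u v)) [AddCommGroup g] [Module kᵐᵒᵖ g] [SuperSym.SuperGroup g]
          [Bracket g g] [SuperSym.LieSuperalgebra k g] (a b : g),
          SuperSym.superComm (SuperSym.coder φ a) (SuperSym.coder ψ b) =
            SuperSym.coder (k := k) χ ⁅a, b⁆) ↔
        SuperSym.FunctionalEq φ ψ χ)) ∧
    (∀ φ : PowerSeries k,
      (∀ (g : Type (max u v)) [AddCommGroup g] [Module kᵐᵒᵖ g] [SuperSym.SuperGroup g]
          [Bracket g g] [SuperSym.LieSuperalgebra k g] (a b : g),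
          SuperSym.superComm (SuperSym.coder φ a) (SuperSym.coder φ b) =
            SuperSym.coder (k := k) φ ⁅a, b⁆) ↔
        SuperSym.HasEvenCoeffs φ ∧ SuperSym.FunctionalEq φ φ φ) ∧
    (∀ φ : PowerSeries k,
      (∀ (g : Type (max u v)) [AddCommGroup g] [Module kᵐᵒᵖ g] [SuperSym.SuperGroup g]
          [Bracket g g] [SuperSym.LieSuperalgebra k g],
          SuperSym.IsCoderivationRep fun a : g => SuperSym.coder (k := k) φ a) ↔
        SuperSym.HasEvenCoeffs φ ∧ SuperSym.FunctionalEq φ φ φ) := by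
  refine ⟨fun φ ψ χ _ hψ _ => ⟨fun H => SuperSym.functionalEq_of_superComm.{u, v} φ ψ χ H,
      fun h g _ _ _ _ _ a b => SuperSym.superComm_coder_of_functionalEq hψ h a b⟩,
    fun φ => ⟨fun H => ⟨SuperSym.hasEvenCoeffs_of_superComm.{u, v} φ H,
        SuperSym.functionalEq_of_superComm.{u, v} φ φ φ H⟩,
      fun h g _ _ _ _ _ a b => SuperSym.superComm_coder_of_functionalEq h.1 h.2 a b⟩,
    fun φ => ⟨fun H => ?_, fun h g _ _ _ _ _ => SuperSym.isCoderivationRep_coder h.1 h.2⟩⟩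
  -- Compatibility with the brackets already forces both conditions, as in the second part.
  have H' : ∀ (g : Type (max u v)) [AddCommGroup g] [Module kᵐᵒᵖ g] [SuperSym.SuperGroup g]
      [Bracket g g] [SuperSym.LieSuperalgebra k g] (a b : g),
      SuperSym.superComm (SuperSym.coder φ a) (SuperSym.coder φ b) =
        SuperSym.coder (k := k) φ ⁅a, b⁆ := fun g _ _ _ _ _ a b => ((H g).map_lie a b).symm
  exact ⟨SuperSym.hasEvenCoeffs_of_superComm.{u, v} φ H',
    SuperSym.functionalEq_of_superComm.{u, v} φ φ φ H'⟩
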